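/- Write $g\in SL_2(\mathbb{R})$ in Iwasawa coordinates $g=\begin{pmatrix}1&x\\0&1\end{pmatrix}\begin{pmatrix}y^{1/2}&0\\0&y^{-1/2}\end{pmatrix}\begin{pmatrix}\cos\theta&\sin\theta\\-\sin\theta&\cos\theta\end{pmatrix}$ with $y>0$, and put $\pi(g)=x+iy$, $\theta_g=\theta$, $d\chi=\frac{dx\,dy\,d\theta}{y^2}$ $(0\le\theta<2\pi)$. Let $\mathfrak{C}=-y^2(\partial_x^2+\partial_y^2)+y\,\partial_x\partial_\theta$ be the Casimir operator. A function $f$ has pure weight $n\in\mathbb{Z}$ if right translation by the rotation matrix with angle $\theta$ above multiplies $f$ by $e^{in\theta}$. For $N\ge 1$ call $(t,n)\in\mathbb{C}\times\mathbb{Z}$ a spectral pair of level $N$ if there is a nonzero smooth function $f$ on $\Gamma_0(N)\backslash SL_2(\mathbb{R})$ of pure weight $n$ with $\mathfrak{C}f=(\frac14+t^2)f$ such that either $f$ is square integrable on $\Gamma_0(N)\backslash SL_2(\mathbb{R})$, or $t$ is real (as for the Eisenstein series $E_{\mathfrak a,n}(\cdot,\frac12+it)$). For $\Phi_n:[0,\infty)\to\mathbb{R}$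 of class $C^2$, the weight-$n$ point-pair invariant attached to $\Phi_n$ is $$k_n(g,h)=\Phi_n\!\left(\frac{|z-w|^2}{4\,\mathrm{Im}\,z\,\mathrm{Im}\,w}\right) i^n\frac{(w-\overline z)^n}{|w-\overline z|^n}\,e^{in(\theta_g-\theta_h)},\qquad z=\pi(g),\ w=\pi(h).$$ **Theorem 7.1.** There exists a function $\rho(t,n):\mathbb{C}\times\mathbb{Z}\to\mathbb{C}$, vanishing for all odd $n$, and a family of weight-$n$ point-pair invariants $k_n$ $(n\in\mathbb{Z})$ as above with $k_n=0$ for odd $n$, with the following properties. 1. $\rho(t,n)$ is real and $\rho(t,n)>0$ for every spectral pair $(t,n)$ of every level $N\ge1$. 2. The series $k(g,h)=\sum_{n\in2\mathbb{Z}}k_n(g,h)$ converges absolutely for all $g,h\in SL_2(\mathbb{R})$; for every $N\ge1$, every smooth eigenfunction $f$ of $\mathfrak{C}$ on $\Gamma_0(N)\backslash SL_2(\mathbb{R})$ and every $g$, one has $\int_{SL_2(\mathbb{R})}\sum_n|k_n(g,h)f(h)|\,d\chi(h)<\infty$; and $\rho$ is the Harish-Chandra/Selberg transform of $k$: for all $t\in\mathbb{C}$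 and $n\in\mathbb{Z}$, $$\rho(t,n)=\int_{SL_2(\mathbb{R})}k(I,h)\,y(h)^{1/2+it}e^{in\theta_h}\,d\chi(h),$$ with an absolutely convergent integral. 3. $k(g,h)\in\mathbb{R}$ for all $g,h$. 4. $k_0(g,h)\in\mathbb{R}$ and $k_0(g,h)\ge\sum_{n\ne0}|k_n(g,h)|$ for all $g,h$. 5. $\rho(t,n)^{-1}$ is bounded by a polynomial at the spectral pairs: there are $C\in\mathbb{R}$ and $A\in\mathbb{N}$ such that $|\rho(t,n)^{-1}|\le C(1+|t|+|n|)^A$ for every spectral pair $(t,n)$ of every level $N\ge1$. -/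

import Mathlib

open MeasureTheory
open scoped MatrixGroups UpperHalfPlane ContDiff

namespace SL2Kernel

noncomputable section

/-! ### Iwasawa coordinates and Haar measure on `SL(2, ℝ)` -/

instance instMeasurableSpaceSL2R : MeasurableSpace SL(2, ℝ) := borel _

instance instBorelSpaceSL2R : BorelSpace SL(2, ℝ) := ⟨rfl⟩

/-- The rotation `k(θ)`, in the orientation for which `g = n(x) a(y) k(θ)` makes the Casimir operator
equal to `-y² (∂ₓ² + ∂ᵧ²) + y ∂ₓ ∂_θ`. -/
def rot (θ : ℝ) : SL(2, ℝ) :=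
  ⟨!![Real.cos θ, Real.sin θ; -Real.sin θ, Real.cos θ], by
    rw [Matrix.det_fin_two_of]
    nlinarith [Real.sin_sq_add_cos_sq θ]⟩

/-- The element `n(x) a(y) k(θ)` with Iwasawa coordinates `z = x + i y` and `θ`. Here
`z.toSL2R` is the matrix `!![√y, x / √y; 0, 1 / √y]`. -/
def iwasawa (z : ℍ) (θ : ℝ) : SL(2, ℝ) := z.toSL2R * rot θ

/-- The projection `π(g) = x(g) + i y(g)`, which is `g • i`. -/
def proj (g : SL(2, ℝ)) : ℍ := g • UpperHalfPlane.I

/-- The Iwasawa angle `θ(g)` (the representative in `[-π, π)`): if `g = n(x) a(y) k(θ)` has lower row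
`(c, d)`, then `c i + d = y ^ (-1/2) * exp (-i θ)`. -/
def angle (g : SL(2, ℝ)) : ℝ := -Complex.arg ((g 1 0 : ℂ) * Complex.I + (g 1 1 : ℂ))

/-- The Haar measure `dx dy dθ / y²` on `SL(2, ℝ)`, with `0 ≤ θ < 2π`; the volume on `ℍ` is
`dx dy / y²`. -/
def haar : Measure SL(2, ℝ) :=
  Measure.map (fun p : ℍ × ℝ => iwasawa p.1 p.2)
    ((volume : Measure ℍ).prod (volume.restrict (Set.Ico 0 (2 * Real.pi))))

/-! ### Functions on `Γ₀(N) \ SL(2, ℝ)` -/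

/-- `f` in Iwasawa coordinates, meaningful for `y > 0`. -/
def coords (f : SL(2, ℝ) → ℂ) (x y θ : ℝ) : ℂ :=
  f (iwasawa (UpperHalfPlane.ofComplex ((x : ℂ) + (y : ℂ) * Complex.I)) θ)

/-- `f` is of class `C^∞` on `SL(2, ℝ)`. -/
def IsSmooth (f : SL(2, ℝ) → ℂ) : Prop :=
  ContDiffOn ℝ ∞ (fun p : ℝ × ℝ × ℝ => coords f p.1 p.2.1 p.2.2) {p | 0 < p.2.1}

/-- The Casimir operator (the Laplacian on `SL(2, ℝ)`) at the point with coordinates `(x, y, θ)`. -/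
def casimir (f : SL(2, ℝ) → ℂ) (x y θ : ℝ) : ℂ :=
  -(y : ℂ) ^ 2 * (iteratedDeriv 2 (fun s => coords f s y θ) x
      + iteratedDeriv 2 (fun s => coords f x s θ) y)
    + (y : ℂ) * deriv (fun s => deriv (fun φ => coords f s y φ) θ) x

/-- `Γ₀(N)` as a subgroup of `SL(2, ℝ)`. -/
def Gamma0R (N : ℕ) : Subgroup SL(2, ℝ) :=
  (CongruenceSubgroup.Gamma0 N).map (Matrix.SpecialLinearGroup.map (Int.castRingHom ℝ))

/-- `f` is a smooth function on `Γ₀(N) \ SL(2, ℝ)` with `𝔠 f = lam f`, for `𝔠` the Casimir operator. -/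
structure IsCasimirEigenfunction (N : ℕ) (lam : ℂ) (f : SL(2, ℝ) → ℂ) : Prop where
  smooth : IsSmooth f
  invariant : ∀ γ ∈ Gamma0R N, ∀ g, f (γ * g) = f g
  eigen : ∀ x y θ : ℝ, 0 < y → casimir f x y θ = lam * coords f x y θ

/-- `f` has pure weight `n`. -/
def IsPureWeight (n : ℤ) (f : SL(2, ℝ) → ℂ) : Prop :=
  ∀ g θ, f (g * rot θ) = Complex.exp (Complex.I * n * θ) * f g

/-- The `Γ₀(N)`-invariant function `f` is square integrable on `Γ₀(N) \ SL(2, ℝ)`. (For an invariant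
function this does not depend on the fundamental domain.) -/
def IsSquareIntegrable (N : ℕ) (f : SL(2, ℝ) → ℂ) : Prop :=
  ∃ D : Set SL(2, ℝ), IsFundamentalDomain (Gamma0R N) D haar ∧ MemLp f 2 (haar.restrict D)

/-- `(t, n)` is the type and weight of an eigenform of the spectral decomposition of
`Γ₀(N) \ SL(2, ℝ)`: there is a nonzero eigenfunction of pure weight `n` with Casimir eigenvalue
`1/4 + t²` which is square integrable (discrete spectrum) or whose type `t` is real (continuous
spectrum). The second alternative includes all Eisenstein series `E_{𝔞,n}(·, 1/2 + i t)`, `t` real. -/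
def IsSpectralPair (N : ℕ) (t : ℂ) (n : ℤ) : Prop :=
  ∃ f : SL(2, ℝ) → ℂ, f ≠ 0 ∧ IsCasimirEigenfunction N (1 / 4 + t ^ 2) f ∧ IsPureWeight n f ∧
    (IsSquareIntegrable N f ∨ t.im = 0)

/-! ### Point-pair invariants -/

/-- The point-pair quantity `u(z, w) = |z - w|² / (4 Im z Im w)`. -/
def uDist (z w : ℍ) : ℝ := ‖(z : ℂ) - (w : ℂ)‖ ^ 2 / (4 * z.im * w.im)

/-- `H_n(z, w) = iⁿ (w - z̄)ⁿ / |w - z̄|ⁿ`. -/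
def hFactor (n : ℤ) (z w : ℍ) : ℂ :=
  Complex.I ^ n * (((w : ℂ) - (starRingEnd ℂ) (z : ℂ)) ^ n
    / ((‖(w : ℂ) - (starRingEnd ℂ) (z : ℂ)‖ : ℝ) : ℂ) ^ n)

/-- The weight-`n` point-pair invariant attached to `φ : ℝ₊ → ℝ`. -/
def weightKernel (n : ℤ) (φ : ℝ → ℝ) (g h : SL(2, ℝ)) : ℂ :=
  (φ (uDist (proj g) (proj h)) : ℂ) * hFactor n (proj g) (proj h)
    * Complex.exp (Complex.I * n * ((angle g : ℂ) - (angle h : ℂ)))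

/-- The point-pair invariant `k = ∑ₙ kₙ` attached to a family `Φₙ`. -/
def kernel (Φ : ℤ → ℝ → ℝ) (g h : SL(2, ℝ)) : ℂ := ∑' n : ℤ, weightKernel n (Φ n) g h

/-- The family `Φ` defines a point-pair invariant `∑_{n ∈ 2ℤ} kₙ`: each `Φₙ` is of class `C²` on
`[0, ∞)`, only even weights occur, and the series converges absolutely at every `(g, h)`. -/
structure IsEvenPointPairFamily (Φ : ℤ → ℝ → ℝ) : Prop where
  contDiff : ∀ n, ContDiffOn ℝ 2 (Φ n) (Set.Ici 0)
  even : ∀ n, Odd n → Φ n = 0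
  summable : ∀ g h, Summable fun n : ℤ => ‖weightKernel n (Φ n) g h‖

/-- The absolute convergence property: `∫ ∑ₙ |kₙ(g, h) f(h)| dχ(h) < ∞` for every `g` and every
smooth Casimir eigenfunction `f` on `Γ₀(N) \ SL(2, ℝ)`, for every level `N ≥ 1`. -/
def HasAbsoluteConvergence (Φ : ℤ → ℝ → ℝ) : Prop :=
  ∀ (N : ℕ), 0 < N → ∀ (lam : ℂ) (f : SL(2, ℝ) → ℂ), IsCasimirEigenfunction N lam f →
    ∀ g, ∫⁻ h, ∑' n : ℤ, ‖weightKernel n (Φ n) g h * f h‖ₑ ∂haar < ⊤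

/-- The integrand `k(I, h) y(h)^(1/2 + i t) exp (i n θ(h))` of the Harish-Chandra/Selberg
transform. -/
def transformIntegrand (k : SL(2, ℝ) → SL(2, ℝ) → ℂ) (t : ℂ) (n : ℤ) (h : SL(2, ℝ)) : ℂ :=
  k 1 h * ((proj h).im : ℂ) ^ (1 / 2 + Complex.I * t)
    * Complex.exp (Complex.I * n * (angle h : ℂ))

/-- `ρ` is the Harish-Chandra/Selberg transform of `k`, the defining integral being absolutely
convergent. -/
def IsSelbergTransform (ρ : ℂ → ℤ → ℂ) (k : SL(2, ℝ) → SL(2, ℝ) → ℂ) : Prop :=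
  ∀ t n, Integrable (transformIntegrand k t n) haar ∧
    ρ t n = ∫ h, transformIntegrand k t n h ∂haar

end

end SL2Kernel

open MeasureTheory
open scoped MatrixGroups UpperHalfPlane ContDiff

namespace SL2Kernel

/-! ### Iwasawa coordinates -/

/-! The kernel is constructed from its transform. For even weight n = 2m, the transform of the
kernel attached to Φ_n is 4π times the Fourier transform in r of the weight-2m Abel transform of Φ_n
at w = sinh²(r/2) (`integral_radial_eq_abel`). The Abel transform has an explicit right inverse with
positive kernel (`abel_abelInv`): if q(sinh²(r/2)) = g(r) and p = -q', integrating p against a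
positive weight gives Φ with Abel transform q. So the transform can be prescribed, while sign, size
and support of Φ_n are read off from p.

The test function g (`exists_test_function`) is even, decreasing on r ≥ 0, compactly supported, C^6,
and its cosine transform is at least c(1+|t|)^(-8). It is an average over dilations of an eightfold
convolution of the indicator of [-1, 1]: the transform of the convolution is an eighth power, hence
nonnegative, and the average over dilations removes its zeros. Monotonicity gives p ≥ 0, hence Φ_n ≥
0 on u ≥ 0.

In weight n ≠ 0 the profile is g(κ|n|r) with coefficient η/n⁴. The inverse Abel kernel grows like
exp(|n| S) on a support of radius S, so shrinking the support like 1/|n| keeps it bounded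
(`abelInv_le`, `abs_sinh_scale_le`). Then Φ_n is O(η/n²), and all Φ_n with n ≠ 0 live where Φ_0 has
a positive minimum, so a small η makes Φ_0 dominate their sum (`exists_point_pair_family`). Compact
support gives all the absolute convergence, and Φ_{-n} = Φ_n gives reality.

At a spectral pair n is even, because -1 lies in Γ₀(N), and t is real or purely imaginary
(`IsSpectralPair.real_or_imaginary`). For real t the lower bound is that of the cosine transform;
for imaginary t it follows from exp(x) ≥ 1 + x and evenness of g
(`IsSymmDecreasing.le_integral_exp`).

That t is real or imaginary requires real eigenvalues for square integrable eigenfunctions f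
(`eigenvalue_im_eq_zero`). No boundary analysis on the quotient is needed: Green's formula on the
upper half-plane shows that the eigenvalue times ⟨T_ψ f, f⟩ equals ⟨T_{Lψ} f, f⟩, with L the radial
part of the Casimir operator and ψ a bump function (`casimir_eigen_integral`). Both forms are real
since the kernels are hermitian, and the first is positive when ψ is concentrated near 0
(`re_integral_formIntegrand_pos`). -/

theorem rot_apply (θ : ℝ) : (rot θ : Matrix (Fin 2) (Fin 2) ℝ) =
    !![Real.cos θ, Real.sin θ; -Real.sin θ, Real.cos θ] := rfl

theorem rot_add (θ φ : ℝ) : rot (θ + φ) = rot θ * rot φ := by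
  ext i j
  rw [Matrix.SpecialLinearGroup.coe_mul, rot_apply, rot_apply, rot_apply]
  fin_cases i <;> fin_cases j <;> simp [Matrix.mul_apply, Fin.sum_univ_two, Real.cos_add, Real.sin_add] <;> ring

theorem rot_smul_I (θ : ℝ) : rot θ • UpperHalfPlane.I = UpperHalfPlane.I := by
  ext
  rw [UpperHalfPlane.coe_specialLinearGroup_apply, rot_apply]
  have h : (-(Real.sin θ : ℂ) * Complex.I + Real.cos θ) ≠ 0 := by
    intro h
    have h1 := congrArg Complex.re h
    have h2 := congrArg Complex.im h
    simp [-Complex.ofReal_sin, -Complex.ofReal_cos] at h1 h2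
    have := Real.sin_sq_add_cos_sq θ
    rw [h1, h2] at this
    norm_num at this
  simp [-Complex.ofReal_sin, -Complex.ofReal_cos] at h ⊢
  rw [div_eq_iff h]
  linear_combination (Real.sin θ : ℂ) * Complex.I_sq

theorem proj_iwasawa (z : ℍ) (θ : ℝ) : proj (iwasawa z θ) = z := by
  simp [proj, iwasawa, mul_smul, rot_smul_I]

theorem iwasawa_mul_rot (z : ℍ) (θ φ : ℝ) : iwasawa z θ * rot φ = iwasawa z (θ + φ) := by
  rw [iwasawa, iwasawa, rot_add, mul_assoc]

/-- The automorphy factor `c i + d`. -/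
noncomputable def lowerRow (g : SL(2, ℝ)) : ℂ := (g 1 0 : ℂ) * Complex.I + (g 1 1 : ℂ)

theorem lowerRow_ne_zero (g : SL(2, ℝ)) : lowerRow g ≠ 0 := by
  intro h
  have h1 := congrArg Complex.re h
  have h2 := congrArg Complex.im h
  simp [lowerRow] at h1 h2
  have := g.det_coe
  rw [Matrix.det_fin_two, h1, h2] at this
  norm_num at this

/-- Passing to the exponential removes the branch cut of `angle`: the phase is an explicit
continuous function of the lower row. -/
theorem exp_angle (g : SL(2, ℝ)) :
    Complex.exp (Complex.I * angle g) = (starRingEnd ℂ) (lowerRow g) / ‖lowerRow g‖ := by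
  have h := Complex.norm_mul_exp_arg_mul_I (lowerRow g)
  have h0 : (‖lowerRow g‖ : ℂ) ≠ 0 := by simpa using lowerRow_ne_zero g
  have h1 := congrArg (starRingEnd ℂ) h
  rw [map_mul, Complex.conj_ofReal, ← Complex.exp_conj, map_mul, Complex.conj_I,
    Complex.conj_ofReal] at h1
  rw [eq_div_iff h0, ← h1, mul_comm]
  congr 2
  rw [angle, ← lowerRow]
  push_cast
  ring

theorem lowerRow_iwasawa (z : ℍ) (θ : ℝ) :
    lowerRow (iwasawa z θ) = (1 / √z.im : ℝ) * Complex.exp (-(Complex.I * θ)) := by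
  rw [← mul_neg, mul_comm Complex.I, Complex.exp_mul_I]
  simp [lowerRow, iwasawa, rot_apply, Matrix.mul_apply, Fin.sum_univ_two]
  ring

theorem exp_angle_iwasawa (z : ℍ) (θ : ℝ) :
    Complex.exp (Complex.I * angle (iwasawa z θ)) = Complex.exp (Complex.I * θ) := by
  have hy : (0 : ℝ) < 1 / √z.im := by have := z.im_pos; positivity
  rw [exp_angle, lowerRow_iwasawa, norm_mul, map_mul, Complex.conj_ofReal, ← Complex.exp_conj,
    Complex.norm_exp, Complex.norm_real, Real.norm_of_nonneg hy.le]
  have : ((1 / √z.im : ℝ) : ℂ) ≠ 0 := by exact_mod_cast hy.ne'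
  have h1 : (-(Complex.I * (θ : ℂ))).re = 0 := by simp
  rw [h1, Real.exp_zero, mul_one, mul_comm, mul_div_assoc, div_self this, mul_one]
  simp

theorem exp_int_angle_iwasawa (n : ℤ) (z : ℍ) (θ : ℝ) :
    Complex.exp (Complex.I * n * angle (iwasawa z θ)) = Complex.exp (Complex.I * n * θ) := by
  have h : ∀ t : ℝ, Complex.exp (Complex.I * n * t) = Complex.exp (Complex.I * t) ^ n := by
    intro t
    rw [← Complex.exp_int_mul]
    congr 1
    ring
  rw [h, h, exp_angle_iwasawa]

theorem coe_proj (g : SL(2, ℝ)) :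
    (proj g : ℂ) = ((g 0 0 : ℂ) * Complex.I + (g 0 1 : ℂ)) / lowerRow g := by
  rw [proj, UpperHalfPlane.coe_specialLinearGroup_apply]
  simp [lowerRow]

theorem im_proj (g : SL(2, ℝ)) : (proj g).im = 1 / ‖lowerRow g‖ ^ 2 := by
  have h0 := (Complex.normSq_pos.2 (lowerRow_ne_zero g)).ne'
  have hd := g.det_coe
  rw [Matrix.det_fin_two] at hd
  rw [← Complex.normSq_eq_norm_sq, ← UpperHalfPlane.coe_im, coe_proj, Complex.div_im,
    ← sub_div]
  congr 1
  simp [lowerRow]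
  linarith

/-- Fixing i forces a = d and b = -c, and the imaginary part forces the lower row to have norm one,
so `exp_angle` reads off its cosine and sine. -/
theorem rot_angle_of_smul_I_eq {h : SL(2, ℝ)} (hh : proj h = UpperHalfPlane.I) :
    rot (angle h) = h := by
  have h1 := coe_proj h
  rw [hh, UpperHalfPlane.coe_I, eq_div_iff (lowerRow_ne_zero h), lowerRow] at h1
  have h2 := congrArg Complex.re h1
  have h3 := congrArg Complex.im h1
  simp at h2 h3
  have h4 : ‖lowerRow h‖ = 1 := by
    have := im_proj h
    rw [hh, UpperHalfPlane.I_im] at this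
    have h0 := lowerRow_ne_zero h
    field_simp at this
    nlinarith [norm_nonneg (lowerRow h)]
  have h5 := exp_angle h
  rw [h4, mul_comm, Complex.exp_mul_I] at h5
  have h6 := congrArg Complex.re h5
  have h7 := congrArg Complex.im h5
  simp [lowerRow, Complex.cos_ofReal_re, Complex.sin_ofReal_re] at h6 h7
  ext i j
  rw [rot_apply]
  fin_cases i <;> fin_cases j <;> simp [h6, h7, h2, h3]
  rw [← h2, neg_neg]

theorem exists_iwasawa_eq (g : SL(2, ℝ)) : ∃ θ, iwasawa (proj g) θ = g := by
  refine ⟨angle ((proj g).toSL2R⁻¹ * g), ?_⟩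
  rw [iwasawa, rot_angle_of_smul_I_eq, mul_inv_cancel_left]
  rw [proj, mul_smul, ← proj, inv_smul_eq_iff, UpperHalfPlane.toSL2R_smul_I]

theorem rot_eq_of_exp_eq {θ φ : ℝ} (h : Complex.exp (Complex.I * θ) = Complex.exp (Complex.I * φ)) :
    rot θ = rot φ := by
  rw [mul_comm, mul_comm Complex.I, Complex.exp_mul_I, Complex.exp_mul_I] at h
  have h6 := congrArg Complex.re h
  have h7 := congrArg Complex.im h
  simp [Complex.cos_ofReal_re, Complex.sin_ofReal_re] at h6 h7
  ext i j
  rw [rot_apply, rot_apply, h6, h7]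

theorem iwasawa_proj_angle (g : SL(2, ℝ)) : iwasawa (proj g) (angle g) = g := by
  obtain ⟨θ, hθ⟩ := exists_iwasawa_eq g
  conv_rhs => rw [← hθ]
  rw [iwasawa, iwasawa, rot_eq_of_exp_eq]
  rw [← exp_angle_iwasawa (proj g) θ, hθ]

theorem proj_mul (γ g : SL(2, ℝ)) : proj (γ * g) = γ • proj g := by
  rw [proj, proj, mul_smul]

/-- Right rotations commute with left translation, so the angle is shifted by an amount depending on
γ and z only. -/
theorem exists_mul_iwasawa (γ : SL(2, ℝ)) (z : ℍ) :
    ∃ φ : ℝ, ∀ θ, γ * iwasawa z θ = iwasawa (γ • z) (φ + θ) := by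
  obtain ⟨φ, hφ⟩ := exists_iwasawa_eq (γ * iwasawa z 0)
  refine ⟨φ, fun θ => ?_⟩
  rw [← iwasawa_mul_rot, ← zero_add θ, ← iwasawa_mul_rot, ← mul_assoc, ← hφ, proj_mul,
    proj_iwasawa, zero_add]

/-! ### The point-pair invariants as functions of `g⁻¹ h` -/

/-- The function `J` on `SL(2, ℝ)` with `w - z̄ = J (g⁻¹ h) / (j(h) conj j(g))`. -/
noncomputable def pairFactor (m : SL(2, ℝ)) : ℂ :=
  ((m 0 1 - m 1 0 : ℝ) : ℂ) + ((m 0 0 + m 1 1 : ℝ) : ℂ) * Complex.I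

/-- This exposes the invariance of point-pair kernels: apart from automorphy factors, w - z̄ depends
only on g⁻¹h. -/
theorem sub_conj_eq (g h : SL(2, ℝ)) :
    (proj h : ℂ) - (starRingEnd ℂ) (proj g : ℂ)
      = pairFactor (g⁻¹ * h) / (lowerRow h * (starRingEnd ℂ) (lowerRow g)) := by
  have h1 := lowerRow_ne_zero h
  have h2 : (starRingEnd ℂ) (lowerRow g) ≠ 0 := by simpa using lowerRow_ne_zero g
  rw [coe_proj, coe_proj, map_div₀, div_sub_div _ _ h1 h2]
  congr 1
  simp [pairFactor, lowerRow, Matrix.SpecialLinearGroup.coe_inv, Matrix.adjugate_fin_two,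
    Matrix.mul_apply, Fin.sum_univ_two]
  linear_combination ((h 1 0 : ℂ) * (g 0 0 : ℂ) - (h 0 0 : ℂ) * (g 1 0 : ℂ)) * Complex.I_sq

theorem uDist_add_one (z w : ℍ) :
    uDist z w + 1 = ‖(w : ℂ) - (starRingEnd ℂ) (z : ℂ)‖ ^ 2 / (4 * z.im * w.im) := by
  have hz := z.im_pos
  have hw := w.im_pos
  rw [uDist, ← Complex.normSq_eq_norm_sq, ← Complex.normSq_eq_norm_sq]
  simp only [Complex.normSq_apply, Complex.sub_re, Complex.sub_im, Complex.conj_re, Complex.conj_im,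
    UpperHalfPlane.coe_re, UpperHalfPlane.coe_im]
  field_simp
  ring

theorem uDist_proj (g h : SL(2, ℝ)) :
    uDist (proj g) (proj h) = ‖pairFactor (g⁻¹ * h)‖ ^ 2 / 4 - 1 := by
  rw [eq_sub_iff_add_eq, uDist_add_one, sub_conj_eq, im_proj, im_proj, norm_div, norm_mul,
    RCLike.norm_conj]
  have h1 := norm_ne_zero_iff.2 (lowerRow_ne_zero h)
  have h2 := norm_ne_zero_iff.2 (lowerRow_ne_zero g)
  field_simp

theorem uDist_nonneg (z w : ℍ) : 0 ≤ uDist z w := by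
  have hz := z.im_pos
  have hw := w.im_pos
  unfold uDist
  positivity

theorem uDist_comm (z w : ℍ) : uDist z w = uDist w z := by
  rw [uDist, uDist, norm_sub_rev]
  ring

theorem pairFactor_ne_zero (m : SL(2, ℝ)) : pairFactor m ≠ 0 := by
  intro h
  have := uDist_nonneg (proj 1) (proj m)
  rw [uDist_proj, inv_one, one_mul, h] at this
  norm_num at this

/-- The phases of the two automorphy factors in `sub_conj_eq` cancel exactly against the
exponentials of the Iwasawa angles. -/
theorem hFactor_mul_exp (n : ℤ) (g h : SL(2, ℝ)) :
    hFactor n (proj g) (proj h) * Complex.exp (Complex.I * n * ((angle g : ℂ) - (angle h : ℂ)))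
      = (Complex.I * (pairFactor (g⁻¹ * h) / ‖pairFactor (g⁻¹ * h)‖)) ^ n := by
  have h1 := lowerRow_ne_zero h
  have h2 := lowerRow_ne_zero g
  have h1' : (‖lowerRow h‖ : ℂ) ≠ 0 := by simpa using h1
  have h2' : (‖lowerRow g‖ : ℂ) ≠ 0 := by simpa using h2
  have h4 : (starRingEnd ℂ) (lowerRow g) ≠ 0 := by simpa using h2
  have h5 : (starRingEnd ℂ) (lowerRow h) ≠ 0 := by simpa using h1
  have h3 : (‖pairFactor (g⁻¹ * h)‖ : ℂ) ≠ 0 := by simpa using pairFactor_ne_zero (g⁻¹ * h)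
  have e1 : Complex.exp (Complex.I * n * ((angle g : ℂ) - (angle h : ℂ)))
      = (Complex.exp (Complex.I * angle g) / Complex.exp (Complex.I * angle h)) ^ n := by
    rw [← Complex.exp_sub, ← Complex.exp_int_mul]
    congr 1
    ring
  rw [hFactor, e1, ← div_zpow, ← mul_zpow, ← mul_zpow, exp_angle, exp_angle, sub_conj_eq]
  congr 1
  rw [norm_div, norm_mul, RCLike.norm_conj]
  push_cast
  field_simp
  have e2 : lowerRow h * (starRingEnd ℂ) (lowerRow h) = (‖lowerRow h‖ : ℂ) ^ 2 := by
    rw [Complex.mul_conj, Complex.normSq_eq_norm_sq]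
    push_cast
    rfl
  rw [← e2]
  ring

theorem weightKernel_eq (n : ℤ) (φ : ℝ → ℝ) (g h : SL(2, ℝ)) :
    weightKernel n φ g h = (φ (‖pairFactor (g⁻¹ * h)‖ ^ 2 / 4 - 1) : ℂ)
      * (Complex.I * (pairFactor (g⁻¹ * h) / ‖pairFactor (g⁻¹ * h)‖)) ^ n := by
  rw [weightKernel, mul_assoc, hFactor_mul_exp, uDist_proj]

theorem weightKernel_mul_left (n : ℤ) (φ : ℝ → ℝ) (γ g h : SL(2, ℝ)) :
    weightKernel n φ (γ * g) (γ * h) = weightKernel n φ g h := by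
  rw [weightKernel_eq, weightKernel_eq, mul_inv_rev, mul_assoc, inv_mul_cancel_left]

theorem norm_weightKernel (n : ℤ) (φ : ℝ → ℝ) (g h : SL(2, ℝ)) :
    ‖weightKernel n φ g h‖ = |φ (uDist (proj g) (proj h))| := by
  have h3 := norm_ne_zero_iff.2 (pairFactor_ne_zero (g⁻¹ * h))
  rw [weightKernel_eq, ← uDist_proj, norm_mul, norm_zpow, norm_mul, norm_div, Complex.norm_I,
    Complex.norm_real, Complex.norm_real, norm_norm, div_self h3]
  simp

theorem pairFactor_inv (m : SL(2, ℝ)) :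
    pairFactor m⁻¹ = -(starRingEnd ℂ) (pairFactor m) := by
  simp [pairFactor, Matrix.SpecialLinearGroup.coe_inv, Matrix.adjugate_fin_two]
  ring

/-- Inverting g⁻¹h replaces J by -J̄, hence iJ by its conjugate. This hermitian symmetry is what
makes the quadratic forms below real. -/
theorem weightKernel_conj (n : ℤ) (φ : ℝ → ℝ) (g h : SL(2, ℝ)) :
    (starRingEnd ℂ) (weightKernel n φ g h) = weightKernel n φ h g := by
  have : h⁻¹ * g = (g⁻¹ * h)⁻¹ := by simp
  rw [weightKernel_eq, weightKernel_eq, this, pairFactor_inv, norm_neg, RCLike.norm_conj, map_mul,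
    Complex.conj_ofReal, map_zpow₀, map_mul, map_div₀, Complex.conj_ofReal, Complex.conj_I]
  congr 2
  ring

/-- The phase has modulus one, so its inverse is its conjugate. -/
theorem weightKernel_neg (n : ℤ) (φ : ℝ → ℝ) (g h : SL(2, ℝ)) :
    weightKernel (-n) φ g h = (starRingEnd ℂ) (weightKernel n φ g h) := by
  rw [weightKernel_eq, weightKernel_eq, map_mul, Complex.conj_ofReal, map_zpow₀, zpow_neg,
    ← inv_zpow]
  congr 2
  rw [Complex.inv_def]
  have h3 := norm_ne_zero_iff.2 (pairFactor_ne_zero (g⁻¹ * h))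
  have : ‖Complex.I * (pairFactor (g⁻¹ * h) / ‖pairFactor (g⁻¹ * h)‖)‖ = 1 := by
    rw [norm_mul, norm_div, Complex.norm_I, Complex.norm_real, norm_norm, div_self h3, one_mul]
  rw [Complex.normSq_eq_norm_sq, this]
  simp

/-! ### The Haar measure -/

theorem continuous_rot : Continuous rot := by
  refine continuous_induced_rng.2 ?_
  refine continuous_matrix fun i j => ?_
  fin_cases i <;> fin_cases j <;> simp <;> fun_prop

theorem continuous_iwasawa : Continuous fun p : ℍ × ℝ => iwasawa p.1 p.2 := by
  have h1 := UpperHalfPlane.continuous_toSL2R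
  have h2 := continuous_rot
  unfold iwasawa
  fun_prop

theorem measurable_iwasawa : Measurable fun p : ℍ × ℝ => iwasawa p.1 p.2 :=
  continuous_iwasawa.measurable

theorem continuous_proj : Continuous proj := by
  unfold proj
  fun_prop

theorem measurable_proj : Measurable proj := continuous_proj.measurable

theorem continuous_coe_entry (i j : Fin 2) : Continuous fun g : SL(2, ℝ) => g i j :=
  (continuous_subtype_val (p := fun A : Matrix (Fin 2) (Fin 2) ℝ => A.det = 1)).matrix_elem i j

theorem measurable_angle : Measurable angle := by
  have h1 := (continuous_coe_entry 1 0).measurable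
  have h2 := (continuous_coe_entry 1 1).measurable
  unfold angle
  fun_prop

instance : SFinite haar := by unfold haar; infer_instance

theorem lintegral_haar {F : SL(2, ℝ) → ENNReal} (hF : Measurable F) :
    ∫⁻ g, F g ∂haar = ∫⁻ z : ℍ, ∫⁻ θ in Set.Ico 0 (2 * Real.pi), F (iwasawa z θ) := by
  rw [haar, lintegral_map hF measurable_iwasawa, lintegral_prod]
  exact (hF.comp measurable_iwasawa).aemeasurable

theorem lintegral_haar_comp_proj {F : ℍ → ENNReal} (hF : Measurable F) :
    ∫⁻ g, F (proj g) ∂haar = ENNReal.ofReal (2 * Real.pi) * ∫⁻ z : ℍ, F z := by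
  have := lintegral_haar (hF.comp measurable_proj)
  simp only [Function.comp_def] at this
  rw [this]
  simp only [proj_iwasawa, lintegral_const, Measure.restrict_apply MeasurableSet.univ,
    Set.univ_inter, Real.volume_Ico, sub_zero]
  rw [lintegral_mul_const _ hF, mul_comm]

theorem lintegral_Ico_add_of_periodic {F : ℝ → ENNReal} {T : ℝ} (hT : 0 < T)
    (hp : Function.Periodic F T) (a : ℝ) :
    ∫⁻ θ in Set.Ico 0 T, F (a + θ) = ∫⁻ θ in Set.Ico 0 T, F θ := by
  have h1 : ∫⁻ θ in Set.Ico 0 T, F (a + θ) = ∫⁻ θ in Set.Ico a (a + T), F θ := by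
    have := (measurePreserving_add_left (volume : Measure ℝ) a).setLIntegral_comp_preimage_emb
      (measurableEmbedding_addLeft a) F (Set.Ico a (a + T))
    rw [← this]
    simp
  rw [h1, restrict_Ico_eq_restrict_Ioc, restrict_Ico_eq_restrict_Ioc]
  have e1 := isAddFundamentalDomain_Ioc hT a (volume : Measure ℝ)
  have e2 := isAddFundamentalDomain_Ioc hT 0 (volume : Measure ℝ)
  rw [zero_add] at e2
  refine e1.setLIntegral_eq e2 F ?_
  rintro ⟨g, hg⟩ x
  obtain ⟨k, rfl⟩ := AddSubgroup.mem_zmultiples_iff.1 hg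
  change F (k • T + x) = F x
  rw [add_comm]
  exact hp.zsmul k x

theorem iwasawa_periodic (z : ℍ) : Function.Periodic (iwasawa z) (2 * Real.pi) := by
  intro θ
  rw [iwasawa, iwasawa]
  congr 1
  ext i j
  simp [rot_apply]

theorem lintegral_smul_upperHalfPlane (γ : SL(2, ℝ)) (F : ℍ → ENNReal) :
    ∫⁻ z : ℍ, F (γ • z) = ∫⁻ z : ℍ, F z := by
  have := (measurePreserving_smul (Matrix.SpecialLinearGroup.mapGL ℝ γ) (volume : Measure ℍ)).lintegral_comp_emb
    (measurableEmbedding_const_smul (Matrix.SpecialLinearGroup.mapGL ℝ γ)) F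
  exact this

/-- By `exists_mul_iwasawa`, left translation is the isometric action on z combined with a
translation of θ; the first preserves dx dy / y², the second is harmless by 2π-periodicity. -/
instance : haar.IsMulLeftInvariant where
  map_mul_left_eq_self γ := by
    ext s hs
    rw [Measure.map_apply (measurable_const_mul γ) hs, ← lintegral_indicator_one hs,
      ← lintegral_indicator_one (measurable_const_mul γ hs), lintegral_haar, lintegral_haar]
    · have : ∀ z : ℍ, ∫⁻ θ in Set.Ico 0 (2 * Real.pi),
          ((γ * ·) ⁻¹' s).indicator (1 : SL(2, ℝ) → ENNReal) (iwasawa z θ)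
          = ∫⁻ θ in Set.Ico 0 (2 * Real.pi), s.indicator (1 : SL(2, ℝ) → ENNReal)
            (iwasawa (γ • z) θ) := by
        intro z
        obtain ⟨φ, hφ⟩ := exists_mul_iwasawa γ z
        have hp := (iwasawa_periodic (γ • z)).comp (s.indicator (1 : SL(2, ℝ) → ENNReal))
        have := lintegral_Ico_add_of_periodic Real.two_pi_pos hp φ
        simp only [Function.comp_def] at this
        rw [← this]
        simp only [← hφ]
        rfl
      simp only [this]
      exact lintegral_smul_upperHalfPlane γ (fun z => ∫⁻ θ in Set.Ico 0 (2 * Real.pi),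
        s.indicator (1 : SL(2, ℝ) → ENNReal) (iwasawa z θ))
    · exact measurable_one.indicator hs
    · exact measurable_one.indicator (measurable_const_mul γ hs)

instance (N : ℕ) : Countable (Gamma0R N) := by
  unfold Gamma0R
  have : Countable (Matrix (Fin 2) (Fin 2) ℤ) := inferInstanceAs (Countable (Fin 2 → Fin 2 → ℤ))
  have : Countable SL(2, ℤ) := Subtype.countable
  have : Countable ((CongruenceSubgroup.Gamma0 N).map
      (Matrix.SpecialLinearGroup.map (n := Fin 2) (Int.castRingHom ℝ)) : Set SL(2, ℝ)) := by
    rw [Subgroup.coe_map]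
    exact ((Set.to_countable _).image _).to_subtype
  infer_instance

instance (N : ℕ) : SMulInvariantMeasure (Gamma0R N) SL(2, ℝ) haar where
  measure_preimage_smul c s _ := by
    change haar ((fun g => (c : SL(2, ℝ)) * g) ⁻¹' s) = haar s
    exact measure_preimage_mul haar _ _

theorem integrable_haar_iff {F : SL(2, ℝ) → ℂ} (hF : Measurable F) :
    Integrable F haar ↔ Integrable (fun p : ℍ × ℝ => F (iwasawa p.1 p.2))
      ((volume : Measure ℍ).prod (volume.restrict (Set.Ico 0 (2 * Real.pi)))) := by
  rw [haar, integrable_map_measure hF.aestronglyMeasurable measurable_iwasawa.aemeasurable]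
  rfl

theorem integral_haar {F : SL(2, ℝ) → ℂ} (hF : Measurable F) (hi : Integrable F haar) :
    ∫ g, F g ∂haar = ∫ z : ℍ, ∫ θ in Set.Ico 0 (2 * Real.pi), F (iwasawa z θ) := by
  rw [haar, integral_map measurable_iwasawa.aemeasurable hF.aestronglyMeasurable]
  rw [integrable_haar_iff hF] at hi
  exact integral_prod _ hi

theorem coords_iwasawa (f : SL(2, ℝ) → ℂ) (z : ℍ) (θ : ℝ) :
    coords f z.re z.im θ = f (iwasawa z θ) := by
  rw [coords, ← UpperHalfPlane.coe_re, ← UpperHalfPlane.coe_im, Complex.re_add_im,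
    UpperHalfPlane.ofComplex_apply]

theorem IsSmooth.continuous_iwasawa {f : SL(2, ℝ) → ℂ} (hf : IsSmooth f) :
    Continuous fun p : ℍ × ℝ => f (iwasawa p.1 p.2) := by
  have h1 := hf.continuousOn
  have h2 : Continuous fun p : ℍ × ℝ => ((p.1.re, p.1.im, p.2) : ℝ × ℝ × ℝ) := by fun_prop
  have := h1.comp_continuous h2 fun p => p.1.im_pos
  simpa only [Function.comp_def, coords_iwasawa] using this

/-- Smoothness is stated in Iwasawa coordinates, so measurability on the group is recovered through
the measurable section given by `proj` and `angle`. -/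
theorem IsSmooth.measurable {f : SL(2, ℝ) → ℂ} (hf : IsSmooth f) : Measurable f := by
  have h := hf.continuous_iwasawa.measurable.comp (measurable_proj.prodMk measurable_angle)
  simpa only [Function.comp_def, iwasawa_proj_angle] using h

theorem uDist_eq_sinh_sq (z w : ℍ) : uDist z w = Real.sinh (dist z w / 2) ^ 2 := by
  have hz := z.im_pos
  have hw := w.im_pos
  rw [UpperHalfPlane.sinh_half_dist, div_pow, mul_pow, Real.sq_sqrt (by positivity), uDist,
    Complex.dist_eq]
  ring

theorem continuous_uDist : Continuous fun p : ℍ × ℍ => uDist p.1 p.2 := by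
  simp only [uDist_eq_sinh_sq]
  fun_prop

theorem uDist_smul (γ : SL(2, ℝ)) (z w : ℍ) : uDist (γ • z) (γ • w) = uDist z w := by
  rw [uDist_eq_sinh_sq, uDist_eq_sinh_sq, dist_smul]

theorem isCompact_uDist_le (z : ℍ) (δ : ℝ) : IsCompact {w | uDist z w ≤ δ} := by
  refine (isCompact_closedBall z (2 * Real.arsinh (√δ))).of_isClosed_subset
    (isClosed_le (continuous_uDist.comp (by fun_prop : Continuous fun w => (z, w))) (by fun_prop)) ?_
  intro w hw
  simp only [Set.mem_ofPred_eq, uDist_eq_sinh_sq] at hw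
  rw [Metric.mem_closedBall, dist_comm]
  have h1 : Real.sinh (dist z w / 2) ≤ √δ := Real.le_sqrt_of_sq_le hw
  have h2 := Real.arsinh_le_arsinh.2 h1
  rw [Real.arsinh_sinh] at h2
  linarith

theorem continuous_hFactor (n : ℤ) : Continuous fun p : ℍ × ℍ => hFactor n p.1 p.2 := by
  have h0 : ∀ p : ℍ × ℍ, (p.2 : ℂ) - (starRingEnd ℂ) (p.1 : ℂ) ≠ 0 := by
    intro p h
    have := congrArg Complex.im h
    simp at this
    have h1 := p.1.im_pos
    have h2 := p.2.im_pos
    linarith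
  unfold hFactor
  have h1 : Continuous fun p : ℍ × ℍ => (p.2 : ℂ) - (starRingEnd ℂ) (p.1 : ℂ) := by
    have := Complex.continuous_conj
    fun_prop
  refine continuous_const.mul (Continuous.div (h1.zpow₀ n fun p => Or.inl (h0 p)) (Continuous.zpow₀ (by fun_prop) n fun p => Or.inl ?_) fun p => zpow_ne_zero _ ?_)
  all_goals simpa using h0 p

theorem norm_hFactor (n : ℤ) (z w : ℍ) : ‖hFactor n z w‖ = 1 := by
  have := norm_weightKernel n 1 (iwasawa z 0) (iwasawa w 0)
  rw [weightKernel, norm_mul, mul_comm Complex.I, mul_assoc, mul_comm Complex.I, ← mul_assoc] at this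
  rw [← Complex.ofReal_sub, ← Complex.ofReal_intCast, ← Complex.ofReal_mul,
    Complex.norm_exp_ofReal_mul_I, proj_iwasawa, proj_iwasawa] at this
  simpa using this

theorem measurable_weightKernel (n : ℤ) {φ : ℝ → ℝ} (hφ : Measurable φ) :
    Measurable fun p : SL(2, ℝ) × SL(2, ℝ) => weightKernel n φ p.1 p.2 := by
  have h1 : Measurable fun p : SL(2, ℝ) × SL(2, ℝ) => (proj p.1, proj p.2) :=
    (measurable_proj.comp measurable_fst).prodMk (measurable_proj.comp measurable_snd)
  have h2 := (continuous_hFactor n).measurable.comp h1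
  have h3 := hφ.comp (continuous_uDist.measurable.comp h1)
  have h4 := measurable_angle.comp (measurable_fst : Measurable (Prod.fst : SL(2, ℝ) × SL(2, ℝ) → _))
  have h5 := measurable_angle.comp (measurable_snd : Measurable (Prod.snd : SL(2, ℝ) × SL(2, ℝ) → _))
  simp only [Function.comp_def] at h2 h3 h4 h5
  unfold weightKernel
  exact ((Complex.measurable_ofReal.comp h3).mul h2).mul (by fun_prop)

/-! ### Integration over the upper half-plane in Cartesian coordinates -/

theorem map_coe_volume : Measure.map UpperHalfPlane.coe (volume : Measure ℍ)
    = (volume.restrict {z : ℂ | 0 < z.im}).withDensity fun z => ENNReal.ofReal (1 / z.im ^ 2) := by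
  have hr : Set.range UpperHalfPlane.coe = {z : ℂ | 0 < z.im} := by
    ext z
    exact ⟨by rintro ⟨w, rfl⟩; exact w.im_pos, fun h => ⟨⟨z, h⟩, rfl⟩⟩
  ext s hs
  rw [Measure.map_apply UpperHalfPlane.measurable_coe hs, UpperHalfPlane.volume_eq_lintegral,
    Set.image_preimage_eq_inter_range, withDensity_apply _ hs, Measure.restrict_restrict hs, hr]
  refine setLIntegral_congr_fun (hs.inter (measurableSet_lt measurable_const Complex.measurable_im)) ?_
  intro z hz
  have hz : 0 < z.im := hz.2
  simp only
  rw [ENNReal.ofReal, ENNReal.coe_inj]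
  ext
  rw [Real.coe_toNNReal _ (by positivity)]
  simp

theorem integral_upperHalfPlane (F : ℍ → ℂ) :
    ∫ z, F z = ∫ p in (Set.univ ×ˢ Set.Ioi 0 : Set (ℝ × ℝ)),
      ((1 / p.2 ^ 2 : ℝ) : ℂ) * F (UpperHalfPlane.ofComplex (p.1 + p.2 * Complex.I)) := by
  have h1 : ∫ z, F z = ∫ z, F (UpperHalfPlane.ofComplex z)
      ∂(Measure.map UpperHalfPlane.coe (volume : Measure ℍ)) := by
    rw [UpperHalfPlane.measurableEmbedding_coe.integral_map]
    simp only [UpperHalfPlane.ofComplex_apply]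
  rw [h1, map_coe_volume, integral_withDensity_eq_integral_toReal_smul (by fun_prop)
    (by simp)]
  have h2 := (Complex.volume_preserving_equiv_real_prod.symm).setIntegral_preimage_emb
    Complex.measurableEquivRealProd.symm.measurableEmbedding
    (fun z => (ENNReal.ofReal (1 / z.im ^ 2)).toReal • F (UpperHalfPlane.ofComplex z)) {z : ℂ | 0 < z.im}
  rw [← h2]
  have h3 : Complex.measurableEquivRealProd.symm ⁻¹' {z : ℂ | 0 < z.im}
      = Set.univ ×ˢ Set.Ioi 0 := by
    ext p
    simp
  rw [h3]
  refine setIntegral_congr_fun (MeasurableSet.univ.prod measurableSet_Ioi) ?_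
  intro p hp
  simp only [Complex.measurableEquivRealProd_symm_apply]
  rw [ENNReal.toReal_ofReal (by positivity), Complex.real_smul, Complex.mk_eq_add_mul_I]

/-! ### Green's formula -/

theorem integral_mul_deriv_of_support {a b a' b' : ℝ} {S : Set ℝ} (hS : Set.Icc a b ⊆ S) (ha : a < a') (hb : b' < b) (hab : a ≤ b)
    {u u1 v v1 : ℝ → ℂ}
    (hu : ∀ x ∈ Set.Icc a b, HasDerivAt u (u1 x) x) (hv : ∀ x ∈ Set.Icc a b, HasDerivAt v (v1 x) x)
    (cu : ContinuousOn u1 (Set.Icc a b)) (cv : ContinuousOn v1 (Set.Icc a b))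
    (h0 : ∀ x ∈ S, x ∉ Set.Icc a' b' → u x = 0) :
    ∫ x in a..b, u x * v1 x = -∫ x in a..b, u1 x * v x := by
  rw [← Set.uIcc_of_le hab] at hu hv cu cv
  rw [intervalIntegral.integral_mul_deriv_eq_deriv_mul hu hv cu.intervalIntegrable
    cv.intervalIntegrable, h0 a (hS (by simp [hab])) (fun h => by linarith [h.1]),
    h0 b (hS (by simp [hab])) (fun h => by linarith [h.2])]
  ring

theorem integral_mul_deriv2_of_support {a b a' b' : ℝ} {S : Set ℝ} (hO : IsOpen S)
    (hS : Set.Icc a b ⊆ S) (ha : a < a') (hb : b' < b) (hab : a ≤ b)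
    {u u1 u2 v v1 v2 : ℝ → ℂ}
    (hu : ∀ x ∈ Set.Icc a b, HasDerivAt u (u1 x) x) (hu1 : ∀ x ∈ Set.Icc a b, HasDerivAt u1 (u2 x) x)
    (hv : ∀ x ∈ Set.Icc a b, HasDerivAt v (v1 x) x) (hv1 : ∀ x ∈ Set.Icc a b, HasDerivAt v1 (v2 x) x)
    (cu : ContinuousOn u2 (Set.Icc a b)) (cv : ContinuousOn v2 (Set.Icc a b))
    (h0 : ∀ x ∈ S, x ∉ Set.Icc a' b' → u x = 0) :
    ∫ x in a..b, u x * v2 x = ∫ x in a..b, u2 x * v x := by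
  -- u vanishes near every point off [a', b'], hence so does its derivative; this kills the boundary
  -- terms of the second integration by parts.
  have hd : ∀ x ∈ Set.Icc a b, x ∉ Set.Icc a' b' → u1 x = 0 := by
    intro x hx hx'
    have : u =ᶠ[nhds x] fun _ => 0 := by
      filter_upwards [isClosed_Icc.isOpen_compl.mem_nhds hx', hO.mem_nhds (hS hx)] with y hy hy'
        using h0 y hy' hy
    rw [← (hu x hx).deriv, this.deriv_eq, deriv_const]
  rw [integral_mul_deriv_of_support hS ha hb hab hu hv1
    (fun x hx => (hu1 x hx).continuousAt.continuousWithinAt) cv h0]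
  rw [← Set.uIcc_of_le hab] at hu hv hu1 hv1 cu cv
  have := intervalIntegral.integral_mul_deriv_eq_deriv_mul hu1 hv cu.intervalIntegrable
    (ContinuousOn.intervalIntegrable fun x hx => (hv1 x hx).continuousAt.continuousWithinAt)
  rw [this, hd a (by simp [hab]) (fun h => by linarith [h.1]),
    hd b (by simp [hab]) (fun h => by linarith [h.2])]
  ring

/-- The open upper half-plane in Cartesian coordinates. -/
def upperSet : Set (ℝ × ℝ) := {p | 0 < p.2}

theorem isOpen_upperSet : IsOpen upperSet := isOpen_lt continuous_const continuous_snd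

/-- `V` is the derivative of `U` on the upper half-plane in the first variable. -/
def HasPartialX (U V : ℝ → ℝ → ℂ) : Prop := ∀ x y, 0 < y → HasDerivAt (fun s => U s y) (V x y) x

/-- `V` is the derivative of `U` on the upper half-plane in the second variable. -/
def HasPartialY (U V : ℝ → ℝ → ℂ) : Prop := ∀ x y, 0 < y → HasDerivAt (fun s => U x s) (V x y) y

theorem exists_hasPartial {U : ℝ → ℝ → ℂ}
    (hU : ContDiffOn ℝ ∞ (fun p : ℝ × ℝ => U p.1 p.2) upperSet) :
    (∃ V : ℝ → ℝ → ℂ, ContDiffOn ℝ ∞ (fun p : ℝ × ℝ => V p.1 p.2) upperSet ∧ HasPartialX U V) ∧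
    (∃ V : ℝ → ℝ → ℂ, ContDiffOn ℝ ∞ (fun p : ℝ × ℝ => V p.1 p.2) upperSet ∧ HasPartialY U V) := by
  have hd : ∀ p ∈ upperSet, HasFDerivAt (fun p : ℝ × ℝ => U p.1 p.2)
      (fderiv ℝ (fun p : ℝ × ℝ => U p.1 p.2) p) p := fun p hp =>
    ((hU.contDiffAt (isOpen_upperSet.mem_nhds hp)).differentiableAt (by simp)).hasFDerivAt
  have hc := hU.fderiv_of_isOpen (m := ∞) isOpen_upperSet (by simp)
  refine ⟨⟨fun x y => fderiv ℝ (fun p : ℝ × ℝ => U p.1 p.2) (x, y) (1, 0), ?_, ?_⟩,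
    ⟨fun x y => fderiv ℝ (fun p : ℝ × ℝ => U p.1 p.2) (x, y) (0, 1), ?_, ?_⟩⟩
  · exact hc.clm_apply contDiffOn_const
  · intro x y hy
    have h2 : HasDerivAt (fun s : ℝ => (s, y)) ((1 : ℝ), (0 : ℝ)) x :=
      (hasDerivAt_id x).prodMk (hasDerivAt_const x y)
    exact (hd (x, y) hy).comp_hasDerivAt x h2
  · exact hc.clm_apply contDiffOn_const
  · intro x y hy
    have h2 : HasDerivAt (fun s : ℝ => (x, s)) ((0 : ℝ), (1 : ℝ)) y :=
      (hasDerivAt_const y x).prodMk (hasDerivAt_id y)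
    exact (hd (x, y) hy).comp_hasDerivAt y h2

/-- Continuity on the upper half-plane. -/
def ContUpper (U : ℝ → ℝ → ℂ) : Prop := ContinuousOn (fun p : ℝ × ℝ => U p.1 p.2) upperSet

theorem ContUpper.mul {U V : ℝ → ℝ → ℂ} (hU : ContUpper U) (hV : ContUpper V) :
    ContUpper fun x y => U x y * V x y := ContinuousOn.mul hU hV

theorem ContUpper.curryX {U : ℝ → ℝ → ℂ} (hU : ContUpper U) {y : ℝ} (hy : 0 < y) (s : Set ℝ) :
    ContinuousOn (fun x => U x y) s :=
  ContinuousOn.comp (g := fun p : ℝ × ℝ => U p.1 p.2) hU (by fun_prop : ContinuousOn (fun x : ℝ => (x, y)) s) fun _ _ => hy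

theorem ContUpper.curryY {U : ℝ → ℝ → ℂ} (hU : ContUpper U) (x : ℝ) {s : Set ℝ}
    (hs : s ⊆ Set.Ioi 0) : ContinuousOn (fun y => U x y) s :=
  ContinuousOn.comp (g := fun p : ℝ × ℝ => U p.1 p.2) hU (by fun_prop : ContinuousOn (fun y : ℝ => (x, y)) s) fun _ h => hs h

/-- The double integral over a box. -/
noncomputable def boxIntegral (X a b : ℝ) (U : ℝ → ℝ → ℂ) : ℂ := ∫ p in Set.Icc (-X) X ×ˢ Set.Icc a b, U p.1 p.2

theorem ContUpper.integrableOn {U : ℝ → ℝ → ℂ} (hU : ContUpper U) {X a b : ℝ} (ha : 0 < a) :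
    IntegrableOn (fun p : ℝ × ℝ => U p.1 p.2) (Set.Icc (-X) X ×ˢ Set.Icc a b) := by
  refine ContinuousOn.integrableOn_compact (isCompact_Icc.prod isCompact_Icc) (ContinuousOn.mono hU ?_)
  rintro ⟨x, y⟩ ⟨-, hy⟩
  exact ha.trans_le hy.1

theorem boxIntegral_eq_xy {U : ℝ → ℝ → ℂ} (hU : ContUpper U) {X a b : ℝ} (ha : 0 < a) (hab : a ≤ b)
    (hX : 0 ≤ X) : boxIntegral X a b U = ∫ x in (-X)..X, ∫ y in a..b, U x y := by
  rw [boxIntegral, Measure.volume_eq_prod, setIntegral_prod _ (hU.integrableOn ha),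
    intervalIntegral.integral_of_le (by linarith), ← integral_Icc_eq_integral_Ioc]
  simp only [intervalIntegral.integral_of_le hab, ← integral_Icc_eq_integral_Ioc]

theorem boxIntegral_eq_yx {U : ℝ → ℝ → ℂ} (hU : ContUpper U) {X a b : ℝ} (ha : 0 < a) (hab : a ≤ b)
    (hX : 0 ≤ X) : boxIntegral X a b U = ∫ y in a..b, ∫ x in (-X)..X, U x y := by
  rw [boxIntegral_eq_xy hU ha hab hX, intervalIntegral.integral_of_le (by linarith),
    intervalIntegral.integral_of_le hab]
  simp only [intervalIntegral.integral_of_le hab, intervalIntegral.integral_of_le (by linarith : -X ≤ X)]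
  refine integral_integral_swap ?_
  have := hU.integrableOn ha (X := X) (b := b)
  rw [Measure.prod_restrict, ← Measure.volume_eq_prod]
  exact this.mono_set (Set.prod_mono Set.Ioc_subset_Icc_self Set.Ioc_subset_Icc_self)

theorem boxIntegral_mul_partialX {U U1 V V1 : ℝ → ℝ → ℂ} {X X' a b : ℝ} (hX : X' < X) (hX0 : 0 ≤ X)
    (ha : 0 < a) (hab : a ≤ b) (hU : HasPartialX U U1) (hV : HasPartialX V V1)
    (c0 : ContUpper U) (c1 : ContUpper U1) (d0 : ContUpper V) (d1 : ContUpper V1)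
    (h0 : ∀ x y, 0 < y → x ∉ Set.Icc (-X') X' → U x y = 0) :
    boxIntegral X a b (fun x y => U x y * V1 x y)
      = -boxIntegral X a b (fun x y => U1 x y * V x y) := by
  rw [boxIntegral_eq_yx (c0.mul d1) ha hab hX0, boxIntegral_eq_yx (c1.mul d0) ha hab hX0,
    ← intervalIntegral.integral_neg]
  refine intervalIntegral.integral_congr fun y hy => ?_
  rw [Set.uIcc_of_le hab] at hy
  have hy := ha.trans_le hy.1
  exact integral_mul_deriv_of_support (Set.subset_univ _) (by linarith : -X < -X') hX (by linarith)
    (fun x _ => hU x y hy) (fun x _ => hV x y hy) (c1.curryX hy _) (d1.curryX hy _)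
    (fun x _ hx => h0 x y hy hx)

theorem boxIntegral_mul_partialXX {U U1 U2 V V1 V2 : ℝ → ℝ → ℂ} {X X' a b : ℝ} (hX : X' < X)
    (hX0 : 0 ≤ X) (ha : 0 < a) (hab : a ≤ b) (hU : HasPartialX U U1) (hU1 : HasPartialX U1 U2)
    (hV : HasPartialX V V1) (hV1 : HasPartialX V1 V2)
    (c0 : ContUpper U) (c2 : ContUpper U2) (d0 : ContUpper V) (d2 : ContUpper V2)
    (h0 : ∀ x y, 0 < y → x ∉ Set.Icc (-X') X' → U x y = 0) :
    boxIntegral X a b (fun x y => U x y * V2 x y)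
      = boxIntegral X a b (fun x y => U2 x y * V x y) := by
  rw [boxIntegral_eq_yx (c0.mul d2) ha hab hX0, boxIntegral_eq_yx (c2.mul d0) ha hab hX0]
  refine intervalIntegral.integral_congr fun y hy => ?_
  rw [Set.uIcc_of_le hab] at hy
  have hy := ha.trans_le hy.1
  exact integral_mul_deriv2_of_support isOpen_univ (Set.subset_univ _) (by linarith : -X < -X') hX (by linarith)
    (fun x _ => hU x y hy) (fun x _ => hU1 x y hy) (fun x _ => hV x y hy) (fun x _ => hV1 x y hy)
    (c2.curryX hy _) (d2.curryX hy _) (fun x _ hx => h0 x y hy hx)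

theorem boxIntegral_mul_partialYY {U U1 U2 V V1 V2 : ℝ → ℝ → ℂ} {X a a' b b' : ℝ} (haa : a < a')
    (hbb : b' < b) (hX0 : 0 ≤ X) (ha : 0 < a) (hab : a ≤ b) (hU : HasPartialY U U1)
    (hU1 : HasPartialY U1 U2) (hV : HasPartialY V V1) (hV1 : HasPartialY V1 V2)
    (c0 : ContUpper U) (c2 : ContUpper U2) (d0 : ContUpper V) (d2 : ContUpper V2)
    (h0 : ∀ x y, 0 < y → y ∉ Set.Icc a' b' → U x y = 0) :
    boxIntegral X a b (fun x y => U x y * V2 x y)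
      = boxIntegral X a b (fun x y => U2 x y * V x y) := by
  rw [boxIntegral_eq_xy (c0.mul d2) ha hab hX0, boxIntegral_eq_xy (c2.mul d0) ha hab hX0]
  refine intervalIntegral.integral_congr fun x hx => ?_
  have hs : Set.Icc a b ⊆ Set.Ioi 0 := fun y hy => ha.trans_le hy.1
  exact integral_mul_deriv2_of_support isOpen_Ioi hs haa hbb hab
    (fun y hy => hU x y (hs hy)) (fun y hy => hU1 x y (hs hy)) (fun y hy => hV x y (hs hy))
    (fun y hy => hV1 x y (hs hy)) (c2.curryY x hs) (d2.curryY x hs) (fun y hy hy' => h0 x y hy hy')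

/-! ### The radial part of the Casimir operator on point-pair invariants -/

/-- `u(i, x + i y)`. -/
noncomputable def uCart (x y : ℝ) : ℝ := (x ^ 2 + (y - 1) ^ 2) / (4 * y)

/-- `H_2(i, x + i y)`. -/
noncomputable def phaseCart (x y : ℝ) : ℂ :=
  -(x + Complex.I * (y + 1)) / (x - Complex.I * (y + 1))

theorem cart_ne_zero (x : ℝ) {y : ℝ} (hy : 0 < y) :
    (x : ℂ) + Complex.I * (y + 1) ≠ 0 ∧ (x : ℂ) - Complex.I * (y + 1) ≠ 0 := by
  constructor <;>
  · intro h
    have := congrArg Complex.im h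
    simp at this
    linarith

theorem uDist_I (z : ℍ) : uDist UpperHalfPlane.I z = uCart z.re z.im := by
  rw [uDist, uCart, ← Complex.normSq_eq_norm_sq, Complex.normSq_apply]
  simp
  ring

/-- In even weight the modulus enters only through its square, so the phase is a power of a rational
function of x and y, which can be differentiated explicitly. -/
theorem hFactor_I (m : ℤ) (z : ℍ) : hFactor (2 * m) UpperHalfPlane.I z = phaseCart z.re z.im ^ m := by
  obtain ⟨h1, h2⟩ := cart_ne_zero z.re z.im_pos
  rw [hFactor, ← div_zpow, ← mul_zpow, zpow_mul]
  congr 1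
  have e1 : (z : ℂ) - (starRingEnd ℂ) (UpperHalfPlane.I : ℂ) = z.re + Complex.I * (z.im + 1) := by
    apply Complex.ext <;> simp
  rw [e1, phaseCart, zpow_ofNat, mul_pow, div_pow, Complex.I_sq]
  have e2 : ((‖(z.re : ℂ) + Complex.I * (z.im + 1)‖ : ℝ) : ℂ) ^ 2
      = (z.re + Complex.I * (z.im + 1)) * (z.re - Complex.I * (z.im + 1)) := by
    rw [← Complex.ofReal_pow, ← Complex.normSq_eq_norm_sq, ← Complex.mul_conj]
    congr 1
    apply Complex.ext <;> simp
  rw [e2]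
  field_simp

/-- The derivative of the phase is carried as a logarithmic derivative α, so that H factors out of
every derivative of the kernel. -/
theorem hasDerivAt_radial_mul {ψ ψ1 u u1 : ℝ → ℝ} {H α : ℝ → ℂ} {s : ℝ}
    (hψ : ∀ t, HasDerivAt ψ (ψ1 t) t) (hu : HasDerivAt u (u1 s) s)
    (hH : HasDerivAt H (α s * H s) s) :
    HasDerivAt (fun s => (ψ (u s) : ℂ) * H s)
      (((ψ1 (u s) * u1 s : ℝ) + (ψ (u s) : ℂ) * α s) * H s) s := by
  have h1 := (((hψ (u s)).comp s hu).ofReal_comp).mul hH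
  refine h1.congr_deriv ?_
  simp only [Function.comp_apply]
  ring

theorem hasDerivAt_radial_mul_deriv {ψ ψ1 ψ2 u u1 u2 : ℝ → ℝ} {H α α1 : ℝ → ℂ} {s : ℝ}
    (hψ : ∀ t, HasDerivAt ψ (ψ1 t) t) (hψ1 : ∀ t, HasDerivAt ψ1 (ψ2 t) t)
    (hu : HasDerivAt u (u1 s) s) (hu1 : HasDerivAt u1 (u2 s) s)
    (hH : HasDerivAt H (α s * H s) s) (hα : HasDerivAt α (α1 s) s) :
    HasDerivAt (fun s => ((ψ1 (u s) * u1 s : ℝ) + (ψ (u s) : ℂ) * α s) * H s)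
      (((ψ2 (u s) * u1 s ^ 2 + ψ1 (u s) * u2 s : ℝ) + 2 * (ψ1 (u s) * u1 s : ℝ) * α s
        + ψ (u s) * (α1 s + α s ^ 2)) * H s) s := by
  have h1 := (((((hψ1 (u s)).comp s hu).mul hu1).ofReal_comp).add
    ((((hψ (u s)).comp s hu).ofReal_comp).mul hα)).mul hH
  refine h1.congr_deriv ?_
  simp only [Function.comp_apply, Pi.mul_apply, Pi.add_apply]
  push_cast
  ring

theorem hasDerivAt_uCart_x (x : ℝ) {y : ℝ} (hy : 0 < y) :
    HasDerivAt (fun s => uCart s y) (x / (2 * y)) x := by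
  unfold uCart
  have := (((hasDerivAt_id x).pow 2).add_const ((y - 1) ^ 2)).div_const (4 * y)
  refine this.congr_deriv ?_
  simp
  field_simp
  ring

theorem hasDerivAt_uCart_y (x : ℝ) {y : ℝ} (hy : 0 < y) :
    HasDerivAt (fun s => uCart x s) ((y ^ 2 - 1 - x ^ 2) / (4 * y ^ 2)) y := by
  unfold uCart
  have := ((((hasDerivAt_id y).sub_const 1).pow 2).const_add (x ^ 2)).div
    ((hasDerivAt_id y).const_mul 4) (by simp; linarith)
  refine this.congr_deriv ?_
  simp
  field_simp
  ring

theorem hasDerivAt_uCart_yy (x : ℝ) {y : ℝ} (hy : 0 < y) :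
    HasDerivAt (fun s => (s ^ 2 - 1 - x ^ 2) / (4 * s ^ 2)) ((1 + x ^ 2) / (2 * y ^ 3)) y := by
  have := ((((hasDerivAt_id y).pow 2).sub_const 1).sub_const (x ^ 2)).div
    (((hasDerivAt_id y).pow 2).const_mul 4) (by simp; linarith)
  refine this.congr_deriv ?_
  simp
  field_simp
  ring

/-- `|x + i (y + 1)|²`. -/
noncomputable def cartNormSq (x y : ℝ) : ℂ := (x : ℂ) ^ 2 + (y + 1) ^ 2

theorem cartNormSq_eq (x y : ℝ) : cartNormSq x y
    = ((x : ℂ) + Complex.I * (y + 1)) * ((x : ℂ) - Complex.I * (y + 1)) := by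
  rw [cartNormSq]
  linear_combination (y + 1 : ℂ) ^ 2 * Complex.I_sq

theorem cartNormSq_ne_zero (x : ℝ) {y : ℝ} (hy : 0 < y) : cartNormSq x y ≠ 0 := by
  rw [cartNormSq_eq]
  exact mul_ne_zero (cart_ne_zero x hy).1 (cart_ne_zero x hy).2

theorem phaseCart_ne_zero (x : ℝ) {y : ℝ} (hy : 0 < y) : phaseCart x y ≠ 0 :=
  div_ne_zero (neg_ne_zero.2 (cart_ne_zero x hy).1) (cart_ne_zero x hy).2

theorem hasDerivAt_phaseCart_x (x : ℝ) {y : ℝ} (hy : 0 < y) :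
    HasDerivAt (fun s => phaseCart s y)
      (-2 * Complex.I * (y + 1) / cartNormSq x y * phaseCart x y) x := by
  obtain ⟨h1, h2⟩ := cart_ne_zero x hy
  unfold phaseCart
  have hx : HasDerivAt (fun s : ℝ => (s : ℂ)) 1 x := (hasDerivAt_id x).ofReal_comp
  have := (hx.add_const (Complex.I * (y + 1))).neg.div (hx.sub_const (Complex.I * (y + 1))) h2
  refine this.congr_deriv ?_
  rw [cartNormSq_eq]
  simp only [Pi.neg_apply]
  field_simp
  ring

theorem hasDerivAt_phaseCart_y (x : ℝ) {y : ℝ} (hy : 0 < y) :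
    HasDerivAt (fun s => phaseCart x s)
      (2 * Complex.I * x / cartNormSq x y * phaseCart x y) y := by
  obtain ⟨h1, h2⟩ := cart_ne_zero x hy
  unfold phaseCart
  have hx : HasDerivAt (fun s : ℝ => Complex.I * ((s : ℂ) + 1)) (Complex.I * 1) y :=
    (((hasDerivAt_id y).ofReal_comp).add_const 1).const_mul _
  have := (hx.const_add (x : ℂ)).neg.div (hx.const_sub (x : ℂ)) h2
  refine this.congr_deriv ?_
  rw [cartNormSq_eq]
  simp only [Pi.neg_apply]
  field_simp
  ring

theorem HasDerivAt.zpow_log {H : ℝ → ℂ} {α : ℂ} {s : ℝ} (m : ℤ) (h0 : H s ≠ 0)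
    (hH : HasDerivAt H (α * H s) s) : HasDerivAt (fun s => H s ^ m) (m * α * H s ^ m) s := by
  have := (hasDerivAt_zpow m (H s) (Or.inl h0)).comp s hH
  refine this.congr_deriv ?_
  rw [zpow_sub_one₀ h0]
  field_simp

theorem hasDerivAt_logDeriv_x (m : ℤ) (x : ℝ) {y : ℝ} (hy : 0 < y) :
    HasDerivAt (fun s : ℝ => (m : ℂ) * (-2 * Complex.I * (y + 1) / cartNormSq s y))
      (m * (4 * Complex.I * (y + 1) * x / cartNormSq x y ^ 2)) x := by
  have hx : HasDerivAt (fun s : ℝ => (s : ℂ)) 1 x := (hasDerivAt_id x).ofReal_comp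
  have h0 := cartNormSq_ne_zero x hy
  have h1 : HasDerivAt (fun s : ℝ => cartNormSq s y) (2 * x) x := by
    unfold cartNormSq
    have := (hx.pow 2).add_const ((y + 1 : ℂ) ^ 2)
    refine this.congr_deriv ?_
    simp
  have := ((hasDerivAt_const x (-2 * Complex.I * (y + 1 : ℂ))).div h1 h0).const_mul (m : ℂ)
  refine this.congr_deriv ?_
  field_simp
  ring

theorem hasDerivAt_logDeriv_y (m : ℤ) (x : ℝ) {y : ℝ} (hy : 0 < y) :
    HasDerivAt (fun s : ℝ => (m : ℂ) * (2 * Complex.I * x / cartNormSq x s))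
      (m * (-4 * Complex.I * (y + 1) * x / cartNormSq x y ^ 2)) y := by
  have hx : HasDerivAt (fun s : ℝ => (s : ℂ) + 1) 1 y := ((hasDerivAt_id y).ofReal_comp).add_const 1
  have h0 := cartNormSq_ne_zero x hy
  have h1 : HasDerivAt (fun s : ℝ => cartNormSq x s) (2 * (y + 1)) y := by
    unfold cartNormSq
    have := (hx.pow 2).const_add ((x : ℂ) ^ 2)
    refine this.congr_deriv ?_
    simp
  have := ((hasDerivAt_const y (2 * Complex.I * (x : ℂ))).div h1 h0).const_mul (m : ℂ)
  refine this.congr_deriv ?_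
  field_simp
  ring

theorem continuousOn_uCart : ContinuousOn (fun p : ℝ × ℝ => uCart p.1 p.2) upperSet := by
  unfold uCart
  refine ContinuousOn.div (by fun_prop) (by fun_prop) fun p hp => ?_
  have : 0 < p.2 := hp
  positivity

theorem contUpper_phaseCart (m : ℤ) : ContUpper fun x y => phaseCart x y ^ m := by
  unfold ContUpper
  refine ContinuousOn.zpow₀ ?_ m fun p hp => Or.inl (phaseCart_ne_zero p.1 hp)
  unfold phaseCart
  exact ContinuousOn.div (by fun_prop) (by fun_prop) fun p hp => (cart_ne_zero p.1 hp).2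

theorem contUpper_div_cartNormSq {U : ℝ → ℝ → ℂ} (hU : ContUpper U) (k : ℕ) :
    ContUpper fun x y => U x y / cartNormSq x y ^ k := by
  refine ContinuousOn.div hU ?_ fun p hp => pow_ne_zero _ (cartNormSq_ne_zero p.1 hp)
  unfold cartNormSq
  fun_prop

/-- The operator by which the Casimir operator acts on the radial function of a weight-`2m`
point-pair invariant, given the function and its first two derivatives. -/
noncomputable def radialCasimir (m : ℤ) (ψ ψ1 ψ2 : ℝ → ℝ) (u : ℝ) : ℝ :=
  -(u * (u + 1) * ψ2 u + (2 * u + 1) * ψ1 u + m ^ 2 * ψ u / (u + 1))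

/-- Weight-`2m` functions on the upper half-plane which are eigenfunctions of the Casimir operator,
in Cartesian coordinates. -/
structure IsCartEigenfunction (m : ℤ) (lam : ℂ) (G : ℝ → ℝ → ℂ) : Prop where
  smooth : ContDiffOn ℝ ∞ (fun p : ℝ × ℝ => G p.1 p.2) upperSet
  eigen : ∃ G1 G11 G2 G22 : ℝ → ℝ → ℂ, ContUpper G1 ∧ ContUpper G11 ∧ ContUpper G22 ∧
    HasPartialX G G1 ∧ HasPartialX G1 G11 ∧ HasPartialY G G2 ∧ HasPartialY G2 G22 ∧
    ∀ x y : ℝ, 0 < y →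
      -(y : ℂ) ^ 2 * (G11 x y + G22 x y) + y * (Complex.I * (2 * m) * G1 x y) = lam * G x y

/-- Integration by parts moves the operator from G to the kernel ψ(u)H^m, whose support lies
strictly inside the box, and a pointwise identity evaluates the result. The first-order term changes
sign when moved. -/
theorem green_radial {m : ℤ} {lam : ℂ} {G : ℝ → ℝ → ℂ} (hG : IsCartEigenfunction m lam G)
    {ψ ψ1 ψ2 : ℝ → ℝ} (hψ : ∀ t, HasDerivAt ψ (ψ1 t) t) (hψ1 : ∀ t, HasDerivAt ψ1 (ψ2 t) t)
    (hψ2 : Continuous ψ2) {X X' a a' b b' : ℝ} (hX : X' < X) (hX0 : 0 ≤ X) (ha : 0 < a) (hab : a ≤ b)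
    (haa : a < a') (hbb : b' < b)
    (h0x : ∀ x y, 0 < y → x ∉ Set.Icc (-X') X' → ψ (uCart x y) = 0)
    (h0y : ∀ x y, 0 < y → y ∉ Set.Icc a' b' → ψ (uCart x y) = 0) :
    lam * boxIntegral X a b (fun x y => (ψ (uCart x y) * phaseCart x y ^ m) * G x y / y ^ 2)
      = boxIntegral X a b (fun x y =>
        (radialCasimir m ψ ψ1 ψ2 (uCart x y) * phaseCart x y ^ m) * G x y / y ^ 2) := by
  obtain ⟨G1, G11, G2, G22, dG1, dG11, dG22, pG1, pG11, pG2, pG22, heig⟩ := hG.eigen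
  have cψ : Continuous ψ := continuous_iff_continuousAt.2 fun t => (hψ t).continuousAt
  have cψ1 : Continuous ψ1 := continuous_iff_continuousAt.2 fun t => (hψ1 t).continuousAt
  have cu : ∀ {χ : ℝ → ℝ}, Continuous χ → ContinuousOn (fun p : ℝ × ℝ => χ (uCart p.1 p.2)) upperSet :=
    fun hχ => hχ.comp_continuousOn continuousOn_uCart
  have cH := contUpper_phaseCart m
  set αx : ℝ → ℝ → ℂ := fun x y => (m : ℂ) * (-2 * Complex.I * (y + 1) / cartNormSq x y) with hαx
  set αy : ℝ → ℝ → ℂ := fun x y => (m : ℂ) * (2 * Complex.I * x / cartNormSq x y) with hαy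
  set K : ℝ → ℝ → ℂ := fun x y => ψ (uCart x y) * phaseCart x y ^ m with hK
  set Kx : ℝ → ℝ → ℂ := fun x y => ((ψ1 (uCart x y) * (x / (2 * y)) : ℝ)
    + (ψ (uCart x y) : ℂ) * αx x y) * phaseCart x y ^ m with hKx
  set Kxx : ℝ → ℝ → ℂ := fun x y => ((ψ2 (uCart x y) * (x / (2 * y)) ^ 2
    + ψ1 (uCart x y) * (1 / (2 * y)) : ℝ) + 2 * (ψ1 (uCart x y) * (x / (2 * y)) : ℝ) * αx x y
    + ψ (uCart x y) * (m * (4 * Complex.I * (y + 1) * x / cartNormSq x y ^ 2) + αx x y ^ 2))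
      * phaseCart x y ^ m with hKxx
  set Ky : ℝ → ℝ → ℂ := fun x y => ((ψ1 (uCart x y) * ((y ^ 2 - 1 - x ^ 2) / (4 * y ^ 2)) : ℝ)
    + (ψ (uCart x y) : ℂ) * αy x y) * phaseCart x y ^ m with hKy
  set Kyy : ℝ → ℝ → ℂ := fun x y => ((ψ2 (uCart x y) * ((y ^ 2 - 1 - x ^ 2) / (4 * y ^ 2)) ^ 2
    + ψ1 (uCart x y) * ((1 + x ^ 2) / (2 * y ^ 3)) : ℝ)
    + 2 * (ψ1 (uCart x y) * ((y ^ 2 - 1 - x ^ 2) / (4 * y ^ 2)) : ℝ) * αy x y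
    + ψ (uCart x y) * (m * (-4 * Complex.I * (y + 1) * x / cartNormSq x y ^ 2) + αy x y ^ 2))
      * phaseCart x y ^ m with hKyy
  have lx : ∀ x y : ℝ, 0 < y →
      HasDerivAt (fun s => phaseCart s y ^ m) (αx x y * phaseCart x y ^ m) x := fun x y hy =>
    HasDerivAt.zpow_log m (phaseCart_ne_zero x hy) (hasDerivAt_phaseCart_x x hy)
  have ly : ∀ x y : ℝ, 0 < y →
      HasDerivAt (fun s => phaseCart x s ^ m) (αy x y * phaseCart x y ^ m) y := fun x y hy =>
    HasDerivAt.zpow_log m (phaseCart_ne_zero x hy) (hasDerivAt_phaseCart_y x hy)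
  have pKx : HasPartialX K Kx := fun x y hy =>
    hasDerivAt_radial_mul (u := fun s => uCart s y) (u1 := fun s => s / (2 * y))
      (α := fun s => αx s y) hψ (hasDerivAt_uCart_x x hy) (lx x y hy)
  have pKxx : HasPartialX Kx Kxx := fun x y hy =>
    hasDerivAt_radial_mul_deriv (u := fun s => uCart s y) (u1 := fun s => s / (2 * y))
      (u2 := fun _ => 1 / (2 * y)) (α := fun s => αx s y)
      (α1 := fun x => m * (4 * Complex.I * (y + 1) * x / cartNormSq x y ^ 2)) hψ hψ1
      (hasDerivAt_uCart_x x hy) ((hasDerivAt_id x).div_const (2 * y)) (lx x y hy)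
      (hasDerivAt_logDeriv_x m x hy)
  have pKy : HasPartialY K Ky := fun x y hy =>
    hasDerivAt_radial_mul (u := fun s => uCart x s) (u1 := fun s => (s ^ 2 - 1 - x ^ 2) / (4 * s ^ 2))
      (α := fun s => αy x s) hψ (hasDerivAt_uCart_y x hy) (ly x y hy)
  have pKyy : HasPartialY Ky Kyy := fun x y hy =>
    hasDerivAt_radial_mul_deriv (u := fun s => uCart x s)
      (u1 := fun s => (s ^ 2 - 1 - x ^ 2) / (4 * s ^ 2))
      (u2 := fun s => (1 + x ^ 2) / (2 * s ^ 3)) (α := fun s => αy x s)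
      (α1 := fun y => m * (-4 * Complex.I * (y + 1) * x / cartNormSq x y ^ 2)) hψ hψ1
      (hasDerivAt_uCart_y x hy) (hasDerivAt_uCart_yy x hy) (ly x y hy)
      (hasDerivAt_logDeriv_y m x hy)
  have cdiv : ∀ {U : ℝ → ℝ → ℂ} (k : ℕ), ContUpper U → ContUpper fun x y => U x y / y ^ k :=
    fun k hU => ContinuousOn.div hU (by fun_prop) fun p hp => by
      have : (0 : ℝ) < p.2 := hp
      exact pow_ne_zero _ (by exact_mod_cast this.ne')
  have cαx : ContUpper αx := by
    have := contUpper_div_cartNormSq (U := fun x y => -2 * Complex.I * (y + 1)) (by unfold ContUpper; fun_prop) 1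
    simp only [pow_one] at this
    exact continuousOn_const.mul this
  have cαy : ContUpper αy := by
    have := contUpper_div_cartNormSq (U := fun x y => 2 * Complex.I * x) (by unfold ContUpper; fun_prop) 1
    simp only [pow_one] at this
    exact continuousOn_const.mul this
  have c0 := cu cψ
  have c1 := cu cψ1
  have c2 := cu hψ2
  have cy : ∀ p ∈ upperSet, (4 * p.2 ^ 2) ≠ 0 := fun p hp => by
    have : (0 : ℝ) < p.2 := hp
    positivity
  have cy' : ∀ p ∈ upperSet, (2 * p.2) ≠ 0 := fun p hp => by
    have : (0 : ℝ) < p.2 := hp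
    positivity
  have cy'' : ∀ p ∈ upperSet, (2 * p.2 ^ 3) ≠ 0 := fun p hp => by
    have : (0 : ℝ) < p.2 := hp
    positivity
  have cux : ContinuousOn (fun p : ℝ × ℝ => p.1 / (2 * p.2)) upperSet :=
    ContinuousOn.div (by fun_prop) (by fun_prop) cy'
  have cuxx : ContinuousOn (fun p : ℝ × ℝ => 1 / (2 * p.2)) upperSet :=
    ContinuousOn.div (by fun_prop) (by fun_prop) cy'
  have cuy : ContinuousOn (fun p : ℝ × ℝ => (p.2 ^ 2 - 1 - p.1 ^ 2) / (4 * p.2 ^ 2)) upperSet :=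
    ContinuousOn.div (by fun_prop) (by fun_prop) cy
  have cuyy : ContinuousOn (fun p : ℝ × ℝ => (1 + p.1 ^ 2) / (2 * p.2 ^ 3)) upperSet :=
    ContinuousOn.div (by fun_prop) (by fun_prop) cy''
  have cof : ∀ {f : ℝ × ℝ → ℝ}, ContinuousOn f upperSet → ContinuousOn (fun p => (f p : ℂ)) upperSet :=
    fun hf => Complex.continuous_ofReal.comp_continuousOn hf
  have cK : ContUpper K := (cof c0).mul cH
  have cKx : ContUpper Kx := ((cof (c1.mul cux)).add ((cof c0).mul cαx)).mul cH
  have cKxx : ContUpper Kxx :=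
    (((cof ((c2.mul (cux.pow 2)).add (c1.mul cuxx))).add
      ((continuousOn_const.mul (cof (c1.mul cux))).mul cαx)).add ((cof c0).mul
        ((continuousOn_const.mul (contUpper_div_cartNormSq
          (U := fun x y => 4 * Complex.I * (y + 1) * x) (by unfold ContUpper; fun_prop) 2)).add (cαx.pow 2)))).mul cH
  have cKyy : ContUpper Kyy :=
    (((cof ((c2.mul (cuy.pow 2)).add (c1.mul cuyy))).add
      ((continuousOn_const.mul (cof (c1.mul cuy))).mul cαy)).add ((cof c0).mul
        ((continuousOn_const.mul (contUpper_div_cartNormSq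
          (U := fun x y => -4 * Complex.I * (y + 1) * x) (by unfold ContUpper; fun_prop) 2)).add (cαy.pow 2)))).mul cH
  have z1 : ∀ x y, 0 < y → x ∉ Set.Icc (-X') X' → K x y = 0 := fun x y hy hx => by
    simp only [hK, h0x x y hy hx, Complex.ofReal_zero, zero_mul]
  have z2 : ∀ x y, 0 < y → y ∉ Set.Icc a' b' → K x y = 0 := fun x y hy hx => by
    simp only [hK, h0y x y hy hx, Complex.ofReal_zero, zero_mul]
  have dG : ContUpper G := hG.smooth.continuousOn
  have e1 := boxIntegral_mul_partialXX (a := a) (b := b) hX hX0 ha hab pKx pKxx pG1 pG11 cK cKxx dG dG11 z1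
  have e2 := boxIntegral_mul_partialYY (X := X) haa hbb hX0 ha hab pKy pKyy pG2 pG22 cK cKyy dG dG22 z2
  have pKx' : HasPartialX (fun x y => K x y / y ^ 1) (fun x y => Kx x y / y ^ 1) := fun x y hy =>
    (pKx x y hy).div_const _
  have e3 := boxIntegral_mul_partialX (a := a) (b := b) hX hX0 ha hab pKx' pG1 (cdiv 1 cK) (cdiv 1 cKx) dG dG1
    (fun x y hy hx => by simp only [z1 x y hy hx, zero_div])
  have hbox : MeasurableSet (Set.Icc (-X) X ×ˢ Set.Icc a b) := measurableSet_Icc.prod measurableSet_Icc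
  have L : lam * boxIntegral X a b (fun x y => K x y * G x y / y ^ 2)
      = -boxIntegral X a b (fun x y => K x y * G11 x y) - boxIntegral X a b (fun x y => K x y * G22 x y)
        + Complex.I * (2 * m) * boxIntegral X a b (fun x y => K x y / y ^ 1 * G1 x y) := by
    unfold boxIntegral
    rw [← integral_const_mul, ← integral_const_mul, ← integral_neg, ← integral_sub, ← integral_add]
    · refine setIntegral_congr_fun hbox fun p hp => ?_
      have hy : 0 < p.2 := ha.trans_le hp.2.1
      have hy' : (p.2 : ℂ) ≠ 0 := by exact_mod_cast hy.ne'
      have := heig p.1 p.2 hy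
      simp only
      field_simp
      linear_combination (-K p.1 p.2) * this
    · exact ((cK.mul dG11).integrableOn ha).neg.sub ((cK.mul dG22).integrableOn ha)
    · exact (((cdiv 1 cK).mul dG1).integrableOn ha).const_mul _
    · exact ((cK.mul dG11).integrableOn ha).neg
    · exact ((cK.mul dG22).integrableOn ha)
  rw [L, e1, e2, e3]
  unfold boxIntegral
  rw [← integral_neg, ← integral_neg, ← integral_const_mul, ← integral_sub, ← integral_add]
  · refine setIntegral_congr_fun hbox fun p hp => ?_
    have hy : 0 < p.2 := ha.trans_le hp.2.1
    have hy' : (p.2 : ℂ) ≠ 0 := by exact_mod_cast hy.ne'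
    have hR := cartNormSq_ne_zero p.1 hy
    -- With R = |x + i(y+1)|² one has u + 1 = R/(4y). The identity then splits into the coefficients
    -- of ψ'', ψ' and ψ.
    have key : Kxx p.1 p.2 + Kyy p.1 p.2 + Complex.I * (2 * m) * (Kx p.1 p.2 / p.2)
        = -(radialCasimir m ψ ψ1 ψ2 (uCart p.1 p.2) * phaseCart p.1 p.2 ^ m) / p.2 ^ 2 := by
      have hRd : cartNormSq p.1 p.2 = (p.1 : ℂ) ^ 2 + (p.2 + 1) ^ 2 := rfl
      have hu : (uCart p.1 p.2 : ℂ) = cartNormSq p.1 p.2 / (4 * p.2) - 1 := by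
        rw [uCart, cartNormSq]
        push_cast
        field_simp
        ring
      have hv : ((uCart p.1 p.2 : ℂ) + 1) = cartNormSq p.1 p.2 / (4 * p.2) := by
        rw [hu]
        ring
      simp only [hKxx, hKyy, hKx, hαx, hαy, radialCasimir]
      push_cast
      rw [hv, hu]
      generalize (p.1 : ℂ) = x at *
      generalize (p.2 : ℂ) = y at *
      generalize phaseCart p.1 p.2 ^ m = P at *
      generalize cartNormSq p.1 p.2 = R at *
      generalize (ψ (uCart p.1 p.2) : ℂ) = q at *
      generalize (ψ1 (uCart p.1 p.2) : ℂ) = q1 at *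
      generalize (ψ2 (uCart p.1 p.2) : ℂ) = q2 at *
      -- This is |∇u|² = u(u+1)/y².
      have k2 : (x / (2 * y)) ^ 2 + ((y ^ 2 - 1 - x ^ 2) / (4 * y ^ 2)) ^ 2
          = (R / (4 * y) - 1) * (R / (4 * y)) / y ^ 2 := by
        field_simp
        rw [hRd]
        ring
      have k1 : 1 / (2 * y) + (1 + x ^ 2) / (2 * y ^ 3)
          + 2 * (x / (2 * y)) * (m * (-2 * Complex.I * (y + 1) / R))
          + 2 * ((y ^ 2 - 1 - x ^ 2) / (4 * y ^ 2)) * (m * (2 * Complex.I * x / R))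
          + Complex.I * (2 * m) * (x / (2 * y) / y)
          = (2 * (R / (4 * y) - 1) + 1) / y ^ 2 := by
        field_simp
        rw [hRd]
        ring
      have k0 : (m : ℂ) * (4 * Complex.I * (y + 1) * x / R ^ 2)
          + (m * (-2 * Complex.I * (y + 1) / R)) ^ 2
          + (m * (-4 * Complex.I * (y + 1) * x / R ^ 2) + (m * (2 * Complex.I * x / R)) ^ 2)
          + Complex.I * (2 * m) * (m * (-2 * Complex.I * (y + 1) / R) / y)
          = m ^ 2 / (R / (4 * y)) / y ^ 2 := by
        field_simp
        rw [hRd]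
        ring_nf
        simp only [Complex.I_sq]
        ring
      linear_combination P * q2 * k2 + P * q1 * k1 + P * q * k0
    simp only
    linear_combination (-G p.1 p.2) * key
  · exact ((cKxx.mul dG).integrableOn ha).neg.sub ((cKyy.mul dG).integrableOn ha)
  · exact ((((cdiv 1 cKx).mul dG).integrableOn ha).neg).const_mul _
  · exact ((cKxx.mul dG).integrableOn ha).neg
  · exact ((cKyy.mul dG).integrableOn ha)

/-! ### Point-pair invariants acting on eigenfunctions -/

theorem toSL2R_I : UpperHalfPlane.I.toSL2R = 1 := by
  ext i j
  fin_cases i <;> fin_cases j <;> simp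

theorem iwasawa_zero (z : ℍ) : iwasawa z 0 = z.toSL2R := by
  have : rot 0 = 1 := by
    ext i j
    fin_cases i <;> fin_cases j <;> simp [rot_apply]
  rw [iwasawa, this, mul_one]

theorem exp_int_angle_toSL2R (n : ℤ) (z : ℍ) :
    Complex.exp (Complex.I * n * angle z.toSL2R) = 1 := by
  rw [← iwasawa_zero, exp_int_angle_iwasawa]
  simp

theorem weightKernel_iwasawa_right (n : ℤ) (φ : ℝ → ℝ) (g : SL(2, ℝ)) (z : ℍ) (θ : ℝ) :
    weightKernel n φ g (iwasawa z θ) = (φ (uDist (proj g) z) : ℂ) * hFactor n (proj g) z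
      * Complex.exp (Complex.I * n * angle g) * Complex.exp (-(Complex.I * n * θ)) := by
  rw [weightKernel, proj_iwasawa, mul_sub, sub_eq_add_neg, Complex.exp_add, ← mul_assoc]
  congr 1
  rw [Complex.exp_neg, exp_int_angle_iwasawa, ← Complex.exp_neg]

theorem weightKernel_eq_exp_mul (n : ℤ) (φ : ℝ → ℝ) (g h : SL(2, ℝ)) :
    weightKernel n φ g h
      = Complex.exp (Complex.I * n * angle g) * weightKernel n φ (proj g).toSL2R h := by
  have h1 : proj (proj g).toSL2R = proj g := by rw [proj, UpperHalfPlane.toSL2R_smul_I]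
  rw [weightKernel, weightKernel, h1, mul_sub, mul_sub, Complex.exp_sub, Complex.exp_sub,
    exp_int_angle_toSL2R]
  ring

theorem IsPureWeight.apply_iwasawa {n : ℤ} {f : SL(2, ℝ) → ℂ} (hf : IsPureWeight n f) (z : ℍ) (θ : ℝ) :
    f (iwasawa z θ) = Complex.exp (Complex.I * n * θ) * f z.toSL2R := by
  rw [← hf, iwasawa]

/-- A pure-weight function is f on the section z ↦ n(x)a(y) times an integer power of the phase, and
by `exp_angle` the phase is continuous although `angle` is not. -/
theorem IsPureWeight.continuous {n : ℤ} {f : SL(2, ℝ) → ℂ} (hf : IsPureWeight n f)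
    (hs : IsSmooth f) : Continuous f := by
  have h1 : f = fun g => ((starRingEnd ℂ) (lowerRow g) / ‖lowerRow g‖) ^ n * f (iwasawa (proj g) 0) := by
    ext g
    rw [iwasawa_zero, ← exp_angle, ← Complex.exp_int_mul]
    conv_lhs => rw [← iwasawa_proj_angle g, hf.apply_iwasawa]
    congr 2
    ring
  have h2 : Continuous lowerRow := by
    have := continuous_coe_entry 1 0
    have := continuous_coe_entry 1 1
    unfold lowerRow
    fun_prop
  have h3 : Continuous fun g => f (iwasawa (proj g) 0) :=
    hs.continuous_iwasawa.comp (f := fun g => (proj g, (0 : ℝ))) (continuous_proj.prodMk continuous_const)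
  have h4 := Complex.continuous_conj
  rw [h1]
  refine (Continuous.zpow₀ (Continuous.div (by fun_prop) (by fun_prop) fun g => ?_) n
    fun g => Or.inl (div_ne_zero ?_ ?_)).mul h3
  all_goals simpa using lowerRow_ne_zero g

theorem lintegral_indicator_ball_lt_top {f : SL(2, ℝ) → ℂ} (hm : Measurable f)
    (hf : Continuous fun p : ℍ × ℝ => f (iwasawa p.1 p.2)) (z : ℍ) (δ : ℝ) :
    ∫⁻ h, {h | uDist z (proj h) ≤ δ}.indicator (fun h => ‖f h‖ₑ) h ∂haar < ⊤ := by
  have hc := isCompact_uDist_le z δ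
  obtain ⟨C, hC⟩ := (hc.prod (isCompact_Icc (a := (0 : ℝ)) (b := 2 * Real.pi))).exists_bound_of_continuousOn
    hf.continuousOn
  have hms : MeasurableSet {h | uDist z (proj h) ≤ δ} :=
    measurable_proj hc.isClosed.measurableSet
  rw [lintegral_haar (hm.enorm.indicator hms)]
  have hle : ∀ w : ℍ, ∫⁻ θ in Set.Ico 0 (2 * Real.pi),
      {h | uDist z (proj h) ≤ δ}.indicator (fun h => ‖f h‖ₑ) (iwasawa w θ)
      ≤ {w | uDist z w ≤ δ}.indicator (fun _ => ENNReal.ofReal C * ENNReal.ofReal (2 * Real.pi)) w := by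
    intro w
    by_cases hw : uDist z w ≤ δ
    · rw [Set.indicator_of_mem (show w ∈ {w | uDist z w ≤ δ} from hw)]
      calc _ ≤ ∫⁻ θ in Set.Ico 0 (2 * Real.pi), ENNReal.ofReal C := by
            refine setLIntegral_mono measurable_const fun θ hθ => ?_
            rw [Set.indicator_of_mem (by simpa [proj_iwasawa] using hw)]
            rw [← ofReal_norm]
            exact ENNReal.ofReal_le_ofReal (hC (w, θ) ⟨hw, Set.Ico_subset_Icc_self hθ⟩)
        _ = _ := by
            rw [setLIntegral_const, Real.volume_Ico, sub_zero]
    · rw [Set.indicator_of_notMem (show w ∉ {w | uDist z w ≤ δ} from hw)]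
      simp [Set.indicator, proj_iwasawa, hw]
  refine (lintegral_mono hle).trans_lt ?_
  rw [lintegral_indicator_const hc.isClosed.measurableSet]
  exact ENNReal.mul_lt_top (by finiteness) hc.measure_lt_top

theorem integrable_weightKernel_mul {n : ℤ} {ψ : ℝ → ℝ} {C δ : ℝ} (hψ : Measurable ψ)
    (hC : ∀ u, 0 ≤ u → |ψ u| ≤ C) (hδ : ∀ u, δ < u → ψ u = 0) {f : SL(2, ℝ) → ℂ} (hm : Measurable f)
    (hf : Continuous fun p : ℍ × ℝ => f (iwasawa p.1 p.2)) (g : SL(2, ℝ)) :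
    Integrable (fun h => weightKernel n ψ g h * f h) haar := by
  refine ⟨(((measurable_weightKernel n hψ).comp measurable_prodMk_left).mul hm).aestronglyMeasurable, ?_⟩
  rw [hasFiniteIntegral_iff_enorm]
  calc _ ≤ ∫⁻ h, ENNReal.ofReal C *
        {h | uDist (proj g) (proj h) ≤ δ}.indicator (fun h => ‖f h‖ₑ) h ∂haar := by
        refine lintegral_mono fun h => ?_
        rw [enorm_mul, ← ofReal_norm (weightKernel n ψ g h), norm_weightKernel]
        by_cases hw : uDist (proj g) (proj h) ≤ δ
        · rw [Set.indicator_of_mem (show h ∈ {h | uDist (proj g) (proj h) ≤ δ} from hw)]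
          gcongr
          exact hC _ (uDist_nonneg _ _)
        · rw [hδ _ (not_le.1 hw)]
          simp
    _ < ⊤ := by
        rw [lintegral_const_mul' _ _ ENNReal.ofReal_ne_top]
        exact ENNReal.mul_lt_top (by finiteness) (lintegral_indicator_ball_lt_top hm hf _ _)

/-- The inequality (y-1)² ≤ 4δy says y + 1/y ≤ 2 + 4δ, and x² ≤ 4δy then bounds x. -/
theorem uCart_le_imp {x y δ : ℝ} (hy : 0 < y) (hδ : 0 ≤ δ) (h : uCart x y ≤ δ) :
    x ∈ Set.Icc (-(2 + 4 * δ)) (2 + 4 * δ) ∧ y ∈ Set.Icc (1 / (2 + 4 * δ)) (2 + 4 * δ) := by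
  rw [uCart, div_le_iff₀ (by positivity)] at h
  have hD : 0 < 2 + 4 * δ := by positivity
  have hy2 : y ≤ 2 + 4 * δ := by
    by_contra hc
    push Not at hc
    nlinarith [sq_nonneg x]
  refine ⟨?_, ?_, hy2⟩
  · rw [Set.mem_Icc, ← abs_le]
    apply abs_le_of_sq_le_sq _ hD.le
    nlinarith [sq_nonneg (y - 1), mul_le_mul_of_nonneg_left hy2 hδ]
  · rw [div_le_iff₀ hD]
    nlinarith [sq_nonneg x, sq_nonneg y]

/-- The box is built with 3 + 4δ instead of the 2 + 4δ of `uCart_le_imp`, so that the support stays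
strictly inside it. -/
theorem integral_radial_eq_boxIntegral (m : ℤ) {ψ : ℝ → ℝ} {δ : ℝ} (hδ0 : 0 ≤ δ)
    (hδ : ∀ u, δ < u → ψ u = 0) (F : ℍ → ℂ) :
    ∫ z : ℍ, (ψ (uDist UpperHalfPlane.I z) : ℂ) * hFactor (2 * m) UpperHalfPlane.I z * F z
      = boxIntegral (3 + 4 * δ) (1 / (3 + 4 * δ)) (3 + 4 * δ) (fun x y =>
        (ψ (uCart x y) * phaseCart x y ^ m) * F (UpperHalfPlane.ofComplex (x + y * Complex.I)) / y ^ 2) := by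
  rw [integral_upperHalfPlane, boxIntegral]
  have hsub : Set.Icc (-(3 + 4 * δ)) (3 + 4 * δ) ×ˢ Set.Icc (1 / (3 + 4 * δ)) (3 + 4 * δ)
      ⊆ (Set.univ ×ˢ Set.Ioi 0 : Set (ℝ × ℝ)) := by
    rintro p ⟨-, hp⟩
    refine ⟨Set.mem_univ _, lt_of_lt_of_le ?_ hp.1⟩
    positivity
  have hcoe : ∀ p : ℝ × ℝ, 0 < p.2 →
      (UpperHalfPlane.ofComplex (p.1 + p.2 * Complex.I)).re = p.1 ∧
      (UpperHalfPlane.ofComplex (p.1 + p.2 * Complex.I)).im = p.2 := by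
    intro p hp
    rw [← UpperHalfPlane.coe_re, ← UpperHalfPlane.coe_im,
      UpperHalfPlane.ofComplex_apply_of_im_pos (by simpa using hp)]
    simp
  refine (setIntegral_eq_of_subset_of_forall_sdiff_eq_zero (MeasurableSet.univ.prod measurableSet_Ioi)
    hsub ?_).trans ?_
  · rintro p ⟨hp, hp'⟩
    obtain ⟨h1, h2⟩ := hcoe p hp.2
    simp only [uDist_I, h1, h2]
    rw [hδ]
    · simp
    · by_contra hc
      obtain ⟨h3, h4⟩ := uCart_le_imp hp.2 hδ0 (not_lt.1 hc)
      refine hp' ⟨⟨by linarith [h3.1], by linarith [h3.2]⟩, ⟨le_trans ?_ h4.1, by linarith [h4.2]⟩⟩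
      exact one_div_le_one_div_of_le (by positivity) (by linarith)
  · refine setIntegral_congr_fun (measurableSet_Icc.prod measurableSet_Icc) fun p hp => ?_
    obtain ⟨h1, h2⟩ := hcoe p (hsub hp).2
    simp only [uDist_I, hFactor_I, h1, h2]
    push_cast
    ring

theorem integral_weightKernel_one_mul {m : ℤ} {ψ : ℝ → ℝ} {C δ : ℝ} (hψ : Measurable ψ)
    (hC : ∀ u, 0 ≤ u → |ψ u| ≤ C) (hδ : ∀ u, δ < u → ψ u = 0) {f : SL(2, ℝ) → ℂ} (hm : Measurable f)
    (hf : Continuous fun p : ℍ × ℝ => f (iwasawa p.1 p.2)) (hw : IsPureWeight (2 * m) f) :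
    ∫ h, weightKernel (2 * m) ψ 1 h * f h ∂haar = 2 * Real.pi * ∫ z : ℍ,
      (ψ (uDist UpperHalfPlane.I z) : ℂ) * hFactor (2 * m) UpperHalfPlane.I z * f z.toSL2R := by
  have hmeas : Measurable fun h => weightKernel (2 * m) ψ 1 h * f h :=
    ((measurable_weightKernel _ hψ).comp measurable_prodMk_left).mul hm
  rw [integral_haar hmeas (integrable_weightKernel_mul hψ hC hδ hm hf 1),
    ← integral_const_mul]
  congr 1
  ext z
  have : ∀ θ : ℝ, weightKernel (2 * m) ψ 1 (iwasawa z θ) * f (iwasawa z θ)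
      = (ψ (uDist UpperHalfPlane.I z) : ℂ) * hFactor (2 * m) UpperHalfPlane.I z * f z.toSL2R := by
    intro θ
    rw [weightKernel_iwasawa_right, hw.apply_iwasawa, ← toSL2R_I, exp_int_angle_toSL2R, proj,
      UpperHalfPlane.toSL2R_smul_I]
    rw [Complex.exp_neg]
    have := Complex.exp_ne_zero (Complex.I * ((2 * m : ℤ) : ℂ) * θ)
    field_simp
  simp only [this, setIntegral_const, Measure.real, Real.volume_Ico, sub_zero]
  rw [ENNReal.toReal_ofReal Real.two_pi_pos.le, Complex.real_smul]
  push_cast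
  ring

theorem HasPartialX.comp_affine {U V : ℝ → ℝ → ℂ} (h : HasPartialX U V) (z : ℍ) :
    HasPartialX (fun x y => U (z.re + z.im * x) (z.im * y))
      (fun x y => z.im * V (z.re + z.im * x) (z.im * y)) := by
  intro x y hy
  have h1 := h (z.re + z.im * x) (z.im * y) (mul_pos z.im_pos hy)
  have h2 : HasDerivAt (fun s : ℝ => z.re + z.im * s) z.im x := by
    simpa using ((hasDerivAt_id x).const_mul z.im).const_add z.re
  exact h1.scomp x h2

theorem HasPartialY.comp_affine {U V : ℝ → ℝ → ℂ} (h : HasPartialY U V) (z : ℍ) :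
    HasPartialY (fun x y => U (z.re + z.im * x) (z.im * y))
      (fun x y => z.im * V (z.re + z.im * x) (z.im * y)) := by
  intro x y hy
  have h1 := h (z.re + z.im * x) (z.im * y) (mul_pos z.im_pos hy)
  have h2 : HasDerivAt (fun s : ℝ => z.im * s) z.im y := by
    simpa using (hasDerivAt_id y).const_mul z.im
  exact h1.scomp y h2

theorem mapsTo_affine (z : ℍ) :
    Set.MapsTo (fun p : ℝ × ℝ => (z.re + z.im * p.1, z.im * p.2)) upperSet upperSet :=
  fun _ hp => mul_pos z.im_pos hp

theorem ContUpper.comp_affine {U : ℝ → ℝ → ℂ} (h : ContUpper U) (z : ℍ) (c : ℂ) :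
    ContUpper fun x y => c * U (z.re + z.im * x) (z.im * y) :=
  continuousOn_const.mul (ContinuousOn.comp (g := fun p : ℝ × ℝ => U p.1 p.2) h
    (by fun_prop) (mapsTo_affine z))

/-- Left translation by n(x)a(y) is an affine map of the coordinates, and each derivative in the
operator is matched by a power of y. This is the only invariance of the Casimir operator that is
needed. -/
theorem IsCartEigenfunction.comp_affine {m : ℤ} {lam : ℂ} {G : ℝ → ℝ → ℂ}
    (hG : IsCartEigenfunction m lam G) (z : ℍ) :
    IsCartEigenfunction m lam fun x y => G (z.re + z.im * x) (z.im * y) := by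
  obtain ⟨G1, G11, G2, G22, d1, d11, d22, p1, p11, p2, p22, heig⟩ := hG.eigen
  refine ⟨hG.smooth.comp (t := upperSet) (f := fun p : ℝ × ℝ => (z.re + z.im * p.1, z.im * p.2))
    (by fun_prop) (mapsTo_affine z), fun x y => z.im * G1 (z.re + z.im * x) (z.im * y),
    fun x y => z.im * (z.im * G11 (z.re + z.im * x) (z.im * y)),
    fun x y => z.im * G2 (z.re + z.im * x) (z.im * y),
    fun x y => z.im * (z.im * G22 (z.re + z.im * x) (z.im * y)), d1.comp_affine z _, ?_, ?_,
    p1.comp_affine z, ?_, p2.comp_affine z, ?_, ?_⟩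
  · simpa only [mul_assoc] using d11.comp_affine z (z.im * z.im)
  · simpa only [mul_assoc] using d22.comp_affine z (z.im * z.im)
  · exact fun x y hy => (p11.comp_affine z x y hy).const_mul _
  · exact fun x y hy => (p22.comp_affine z x y hy).const_mul _
  · intro x y hy
    have := heig (z.re + z.im * x) (z.im * y) (mul_pos z.im_pos hy)
    push_cast at this
    linear_combination this

theorem isCartEigenfunction_of_casimir {m : ℤ} {lam : ℂ} {f : SL(2, ℝ) → ℂ} (hs : IsSmooth f)
    (hw : IsPureWeight (2 * m) f)
    (he : ∀ x y θ : ℝ, 0 < y → casimir f x y θ = lam * coords f x y θ) :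
    IsCartEigenfunction m lam fun x y => coords f x y 0 := by
  have hsm : ContDiffOn ℝ ∞ (fun p : ℝ × ℝ => coords f p.1 p.2 0) upperSet :=
    ContDiffOn.comp (g := fun p : ℝ × ℝ × ℝ => coords f p.1 p.2.1 p.2.2)
      (f := fun p : ℝ × ℝ => (p.1, p.2, (0 : ℝ))) (s := upperSet) (t := {p : ℝ × ℝ × ℝ | 0 < p.2.1}) hs
      (by fun_prop) fun p hp => hp
  obtain ⟨⟨G1, s1, p1⟩, ⟨G2, s2, p2⟩⟩ := exists_hasPartial (U := fun x y => coords f x y 0) hsm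
  obtain ⟨⟨G11, s11, p11⟩, -⟩ := exists_hasPartial s1
  obtain ⟨-, ⟨G22, s22, p22⟩⟩ := exists_hasPartial s2
  refine ⟨hsm, G1, G11, G2, G22, s1.continuousOn, s11.continuousOn, s22.continuousOn, p1, p11, p2,
    p22, fun x y hy => ?_⟩
  rw [← he x y 0 hy, casimir]
  have e1 : iteratedDeriv 2 (fun s => coords f s y 0) x = G11 x y := by
    rw [iteratedDeriv_succ, iteratedDeriv_one]
    have : deriv (fun s => coords f s y 0) = fun s => G1 s y := funext fun s => (p1 s y hy).deriv
    rw [this, (p11 x y hy).deriv]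
  have e2 : iteratedDeriv 2 (fun s => coords f x s 0) y = G22 x y := by
    rw [iteratedDeriv_succ, iteratedDeriv_one]
    have : deriv (fun s => coords f x s 0) =ᶠ[nhds y] fun s => G2 x s := by
      filter_upwards [lt_mem_nhds hy] with s hs using (p2 x s hs).deriv
    rw [this.deriv_eq, (p22 x y hy).deriv]
  -- On weight 2m the operator ∂_θ is multiplication by 2im, which turns the mixed term into a
  -- first-order one.
  have e3 : ∀ s, deriv (fun φ => coords f s y φ) 0 = Complex.I * (2 * m) * coords f s y 0 := by
    intro s
    have h1 : (fun φ : ℝ => coords f s y φ)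
        = fun φ : ℝ => Complex.exp (Complex.I * (2 * m) * φ) * coords f s y 0 := by
      ext φ
      rw [coords, coords, hw.apply_iwasawa, hw.apply_iwasawa _ 0]
      simp
    have h2 : HasDerivAt (fun φ : ℝ => Complex.I * (2 * m) * (φ : ℂ)) (Complex.I * (2 * m) * 1) 0 :=
      ((hasDerivAt_id (0 : ℝ)).ofReal_comp).const_mul _
    rw [h1, (h2.cexp.mul_const _).deriv]
    simp
  rw [e1, e2]
  simp only [e3]
  rw [((p1 x y hy).const_mul (Complex.I * (2 * m))).deriv]

theorem toSL2R_mul_toSL2R (z w : ℍ) : ∃ v : ℍ, z.toSL2R * w.toSL2R = v.toSL2R ∧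
    (v : ℂ) = (z.re + z.im * w.re : ℝ) + (z.im * w.im : ℝ) * Complex.I := by
  have hz := z.im_pos
  have hw := w.im_pos
  refine ⟨⟨(z.re + z.im * w.re : ℝ) + (z.im * w.im : ℝ) * Complex.I, by simp; positivity⟩, ?_, rfl⟩
  have h1 := Real.sqrt_pos.2 hz
  have h2 := Real.sqrt_pos.2 hw
  have h3 := Real.sq_sqrt hz.le
  ext i j
  rw [Matrix.SpecialLinearGroup.coe_mul, UpperHalfPlane.coe_toSL2R, UpperHalfPlane.coe_toSL2R,
    UpperHalfPlane.coe_toSL2R]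
  have e1 : (⟨(z.re + z.im * w.re : ℝ) + (z.im * w.im : ℝ) * Complex.I, by simp; positivity⟩ : ℍ).im
    = z.im * w.im := by
    rw [← UpperHalfPlane.coe_im]
    simp
  have e2 : (⟨(z.re + z.im * w.re : ℝ) + (z.im * w.im : ℝ) * Complex.I, by simp; positivity⟩ : ℍ).re
    = z.re + z.im * w.re := by
    rw [← UpperHalfPlane.coe_re]
    simp
  rw [e1, e2, Real.sqrt_mul hz.le]
  fin_cases i <;> fin_cases j <;> simp [Matrix.mul_apply, Fin.sum_univ_two]
  · field_simp
    rw [h3]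
    ring
  · field_simp

/-- A point-pair invariant intertwines the Casimir operator with its radial part. -/
theorem casimir_eigen_integral {m : ℤ} {lam : ℂ} {f : SL(2, ℝ) → ℂ} (hs : IsSmooth f)
    (hw : IsPureWeight (2 * m) f)
    (he : ∀ x y θ : ℝ, 0 < y → casimir f x y θ = lam * coords f x y θ)
    {ψ ψ1 ψ2 : ℝ → ℝ} (hψ : ∀ t, HasDerivAt ψ (ψ1 t) t) (hψ1 : ∀ t, HasDerivAt ψ1 (ψ2 t) t)
    {C C' δ : ℝ} (hψ2 : Continuous ψ2) (hδ0 : 0 ≤ δ) (hδ : ∀ u, δ < u → ψ u = 0)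
    (hδ' : ∀ u, δ < u → radialCasimir m ψ ψ1 ψ2 u = 0)
    (hC : ∀ u, 0 ≤ u → |ψ u| ≤ C) (hC' : ∀ u, 0 ≤ u → |radialCasimir m ψ ψ1 ψ2 u| ≤ C')
    (hm' : Measurable (radialCasimir m ψ ψ1 ψ2)) (g : SL(2, ℝ)) :
    lam * ∫ h, weightKernel (2 * m) ψ g h * f h ∂haar
      = ∫ h, weightKernel (2 * m) (radialCasimir m ψ ψ1 ψ2) g h * f h ∂haar := by
  have cψ : Continuous ψ := continuous_iff_continuousAt.2 fun t => (hψ t).continuousAt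
  have hc := hw.continuous hs
  -- Translating by γ moves the base point to the identity; the remaining rotation part of g
  -- contributes a constant phase common to both sides.
  set γ := (proj g).toSL2R with hγ
  have hc' : Continuous fun h => f (γ * h) := hc.comp (continuous_const_mul γ)
  have hw' : IsPureWeight (2 * m) fun h => f (γ * h) := fun h θ => by
    simp only [← mul_assoc γ, hw (γ * h) θ]
  have red : ∀ χ : ℝ → ℝ, ∫ h, weightKernel (2 * m) χ g h * f h ∂haar
      = Complex.exp (Complex.I * ((2 * m : ℤ) : ℂ) * angle g)
        * ∫ h, weightKernel (2 * m) χ 1 h * f (γ * h) ∂haar := by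
    intro χ
    rw [← integral_mul_left_eq_self _ γ, ← integral_const_mul]
    congr 1
    ext h
    have := weightKernel_mul_left (2 * m) χ γ 1 h
    rw [mul_one] at this
    rw [weightKernel_eq_exp_mul, ← hγ, this, mul_assoc]
  rw [red, red, mul_left_comm]
  congr 1
  rw [integral_weightKernel_one_mul cψ.measurable hC hδ hc'.measurable (hc'.comp continuous_iwasawa) hw',
    integral_weightKernel_one_mul hm' hC' hδ' hc'.measurable
      (hc'.comp continuous_iwasawa) hw', mul_left_comm]
  congr 1
  rw [integral_radial_eq_boxIntegral m hδ0 hδ, integral_radial_eq_boxIntegral m hδ0 hδ']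
  have hG := (isCartEigenfunction_of_casimir hs hw he).comp_affine (proj g)
  have h2 : 0 < 2 + 4 * δ := by positivity
  have h3 : 0 < 3 + 4 * δ := by positivity
  have hlt : 1 / (3 + 4 * δ) < 1 / (2 + 4 * δ) := one_div_lt_one_div_of_lt h2 (by linarith)
  have hle : 1 / (3 + 4 * δ) ≤ 3 + 4 * δ := by
    rw [div_le_iff₀ h3]
    nlinarith
  have key := green_radial hG hψ hψ1 hψ2 (X := 3 + 4 * δ) (X' := 2 + 4 * δ) (a := 1 / (3 + 4 * δ))
    (a' := 1 / (2 + 4 * δ)) (b := 3 + 4 * δ) (b' := 2 + 4 * δ) (by linarith) h3.le (by positivity)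
    hle hlt (by linarith)
    (fun x y hy hx => hδ _ (not_le.1 fun h => hx (uCart_le_imp hy hδ0 h).1))
    (fun x y hy hx => hδ _ (not_le.1 fun h => hx (uCart_le_imp hy hδ0 h).2))
  have hF : ∀ x y : ℝ, 0 < y → f (γ * (UpperHalfPlane.ofComplex (x + y * Complex.I)).toSL2R)
      = coords f ((proj g).re + (proj g).im * x) ((proj g).im * y) 0 := by
    intro x y hy
    obtain ⟨v, hv, hv'⟩ := toSL2R_mul_toSL2R (proj g) (UpperHalfPlane.ofComplex (x + y * Complex.I))
    rw [hγ, hv, coords, iwasawa_zero]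
    congr 2
    rw [← UpperHalfPlane.coe_re, ← UpperHalfPlane.coe_im (UpperHalfPlane.ofComplex _),
      UpperHalfPlane.ofComplex_apply_of_im_pos (by simpa using hy)] at hv'
    rw [← UpperHalfPlane.ofComplex_apply v, hv']
    simp
  have hcong : ∀ χ : ℝ → ℝ, boxIntegral (3 + 4 * δ) (1 / (3 + 4 * δ)) (3 + 4 * δ) (fun x y =>
        (χ (uCart x y) * phaseCart x y ^ m)
          * f (γ * (UpperHalfPlane.ofComplex (x + y * Complex.I)).toSL2R) / y ^ 2)
      = boxIntegral (3 + 4 * δ) (1 / (3 + 4 * δ)) (3 + 4 * δ) (fun x y =>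
        (χ (uCart x y) * phaseCart x y ^ m)
          * coords f ((proj g).re + (proj g).im * x) ((proj g).im * y) 0 / y ^ 2) := by
    intro χ
    refine setIntegral_congr_fun (measurableSet_Icc.prod measurableSet_Icc) fun p hp => ?_
    have hy : 0 < p.2 := lt_of_lt_of_le (by positivity) hp.2.1
    simp only [hF p.1 p.2 hy]
  rw [hcong, hcong]
  exact key

section

/-! ### Self-adjointness on the quotient -/

theorem volume_pos_of_isOpen {U : Set ℍ} (hU : IsOpen U) (hne : U.Nonempty) : 0 < volume U := by
  rw [pos_iff_ne_zero]
  intro h0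
  rw [UpperHalfPlane.volume_eq_lintegral] at h0
  have hO : IsOpen (UpperHalfPlane.coe '' U) := UpperHalfPlane.isOpenEmbedding_coe.isOpenMap _ hU
  have hm : Measurable fun z : ℂ => (((1 / ‖z.im‖₊) ^ 2 : NNReal) : ENNReal) := by fun_prop
  rw [lintegral_eq_zero_iff hm, Filter.EventuallyEq, ae_restrict_iff' hO.measurableSet] at h0
  have h1 : volume (UpperHalfPlane.coe '' U) = 0 := by
    refine measure_mono_null ?_ h0
    rintro _ ⟨z, hz, rfl⟩ h
    have := h ⟨z, hz, rfl⟩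
    simp [z.im_ne_zero] at this
  exact (hO.measure_pos volume (hne.image _)).ne' h1

theorem haar_preimage_proj {U : Set ℍ} (hU : MeasurableSet U) :
    haar (proj ⁻¹' U) = ENNReal.ofReal (2 * Real.pi) * volume U := by
  have := lintegral_haar_comp_proj (measurable_one.indicator hU (f := (1 : ℍ → ENNReal)))
  rw [lintegral_indicator_one hU] at this
  rw [← this, ← lintegral_indicator_one (measurable_proj hU)]
  rfl

theorem haar_preimage_proj_pos {U : Set ℍ} (hU : IsOpen U) (hne : U.Nonempty) :
    0 < haar (proj ⁻¹' U) := by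
  rw [haar_preimage_proj hU.measurableSet]
  exact ENNReal.mul_pos (by simp [Real.pi_pos]) (volume_pos_of_isOpen hU hne).ne'

instance (N : ℕ) : MeasurableConstSMul (Gamma0R N) (SL(2, ℝ) × SL(2, ℝ)) where
  measurable_const_smul c :=
    ((measurable_const_mul (c : SL(2, ℝ))).comp measurable_fst).prodMk
      ((measurable_const_mul (c : SL(2, ℝ))).comp measurable_snd)

instance (N : ℕ) : SMulInvariantMeasure (Gamma0R N) (SL(2, ℝ) × SL(2, ℝ)) (haar.prod haar) := by
  refine ⟨fun c s hs => ?_⟩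
  have h1 : MeasurePreserving (fun g : SL(2, ℝ) => (c : SL(2, ℝ)) * g) haar haar :=
    measurePreserving_mul_left haar _
  exact (h1.prod h1).measure_preimage hs.nullMeasurableSet

section Quotient

variable {N : ℕ} {D : Set SL(2, ℝ)}

/-- For the diagonal action on G × G, with G = SL₂(ℝ), both D × G and G × D are fundamental domains.
Invariant functions have equal integrals over the two, which permits exchanging the variables. -/
theorem isFundamentalDomain_fst (hD : IsFundamentalDomain (Gamma0R N) D haar) :
    IsFundamentalDomain (Gamma0R N) (Prod.fst ⁻¹' D) (haar.prod haar) :=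
  hD.preimage_of_equiv Measure.quasiMeasurePreserving_fst Function.bijective_id fun _ _ => rfl

theorem isFundamentalDomain_snd (hD : IsFundamentalDomain (Gamma0R N) D haar) :
    IsFundamentalDomain (Gamma0R N) (Prod.snd ⁻¹' D) (haar.prod haar) :=
  hD.preimage_of_equiv Measure.quasiMeasurePreserving_snd Function.bijective_id fun _ _ => rfl

theorem restrict_fst_preimage (D : Set SL(2, ℝ)) :
    (haar.prod haar).restrict (Prod.fst ⁻¹' D) = (haar.restrict D).prod haar := by
  rw [← Set.prod_univ, ← Measure.prod_restrict, Measure.restrict_univ]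

/-- Invariance under the diagonal action of `Γ₀(N)`. -/
def IsDiagInvariant {E : Type*} (N : ℕ) (P : SL(2, ℝ) × SL(2, ℝ) → E) : Prop :=
  ∀ γ ∈ Gamma0R N, ∀ g h, P (γ * g, γ * h) = P (g, h)

variable {E : Type*} [NormedAddCommGroup E]

theorem integrable_swap_of_invariant (hD : IsFundamentalDomain (Gamma0R N) D haar)
    {P : SL(2, ℝ) × SL(2, ℝ) → E} (hP : IsDiagInvariant N P)
    (hi : Integrable P ((haar.restrict D).prod haar)) :
    Integrable (fun p => P p.swap) ((haar.restrict D).prod haar) := by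
  have h1 : IntegrableOn P (Prod.snd ⁻¹' D) (haar.prod haar) := by
    rw [(isFundamentalDomain_snd hD).integrableOn_iff (isFundamentalDomain_fst hD)
      fun γ p => hP γ γ.2 p.1 p.2, IntegrableOn, restrict_fst_preimage]
    exact hi
  have h2 : MeasurePreserving Prod.swap (haar.prod haar) (haar.prod haar) :=
    Measure.measurePreserving_swap
  have := (h2.integrableOn_comp_preimage MeasurableEquiv.prodComm.measurableEmbedding).2 h1
  rw [← restrict_fst_preimage]
  exact this

theorem integral_swap_of_invariant [NormedSpace ℝ E] (hD : IsFundamentalDomain (Gamma0R N) D haar)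
    {P : SL(2, ℝ) × SL(2, ℝ) → E} (hP : IsDiagInvariant N P) :
    ∫ p, P p.swap ∂((haar.restrict D).prod haar) = ∫ p, P p ∂((haar.restrict D).prod haar) := by
  have h2 : MeasurePreserving Prod.swap (haar.prod haar) (haar.prod haar) :=
    Measure.measurePreserving_swap
  have h3 := h2.setIntegral_preimage_emb MeasurableEquiv.prodComm.measurableEmbedding P (Prod.snd ⁻¹' D)
  rw [← restrict_fst_preimage]
  have h4 := (isFundamentalDomain_snd hD).setIntegral_eq (isFundamentalDomain_fst hD) (f := P)
    fun γ p => hP γ γ.2 p.1 p.2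
  rw [← h4, ← h3]
  rfl

end Quotient

/-- The mass of a radial function, `∫ ψ(u(1, h)) dχ(h)`. -/
noncomputable def radialMass (ψ : ℝ → ℝ) : ℝ := ∫ h, ψ (uDist (proj 1) (proj h)) ∂haar

theorem uDist_proj_mul (γ g h : SL(2, ℝ)) :
    uDist (proj (γ * g)) (proj (γ * h)) = uDist (proj g) (proj h) := by
  rw [proj_mul, proj_mul, uDist_smul]

theorem measurable_uDist_proj : Measurable fun p : SL(2, ℝ) × SL(2, ℝ) => uDist (proj p.1) (proj p.2) :=
  continuous_uDist.measurable.comp (f := fun p : SL(2, ℝ) × SL(2, ℝ) => (proj p.1, proj p.2))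
    ((measurable_proj.comp measurable_fst).prodMk (measurable_proj.comp measurable_snd))

theorem integral_radial (ψ : ℝ → ℝ) (g : SL(2, ℝ)) :
    ∫ h, ψ (uDist (proj g) (proj h)) ∂haar = radialMass ψ := by
  rw [← integral_mul_left_eq_self _ g, radialMass]
  congr 1
  ext h
  rw [← uDist_proj_mul g 1 h, mul_one]

/-- A bounded measurable radial function of bounded support. -/
structure IsRadialTest (ψ : ℝ → ℝ) (δ : ℝ) : Prop where
  measurable : Measurable ψ
  bounded : ∃ C, ∀ u, 0 ≤ u → |ψ u| ≤ C
  support : ∀ u, δ < u → ψ u = 0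

theorem IsRadialTest.abs {ψ : ℝ → ℝ} {δ : ℝ} (h : IsRadialTest ψ δ) :
    IsRadialTest (fun u => |ψ u|) δ where
  measurable := by have := h.measurable; fun_prop
  bounded := by simpa using h.bounded
  support u hu := by simp [h.support u hu]

theorem IsRadialTest.integrable {ψ : ℝ → ℝ} {δ : ℝ} (h : IsRadialTest ψ δ) (g : SL(2, ℝ)) :
    Integrable (fun k => ψ (uDist (proj g) (proj k))) haar := by
  obtain ⟨C, hC⟩ := h.bounded
  have h1 := integrable_weightKernel_mul (n := 0) h.measurable hC h.support (f := fun _ => 1)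
    measurable_const continuous_const g
  have h2 := h1.norm
  refine h2.mono' ((h.measurable.comp (measurable_uDist_proj.comp measurable_prodMk_left)).aestronglyMeasurable) ?_
  filter_upwards with k
  rw [mul_one, norm_weightKernel]
  rfl

theorem IsRadialTest.integrable_prod {ψ : ℝ → ℝ} {δ : ℝ} (h : IsRadialTest ψ δ) {D : Set SL(2, ℝ)}
    {a : SL(2, ℝ) → ℝ} (ha : IntegrableOn a D haar) :
    Integrable (fun p : SL(2, ℝ) × SL(2, ℝ) => ψ (uDist (proj p.1) (proj p.2)) * a p.1)
      ((haar.restrict D).prod haar) := by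
  have hm : AEStronglyMeasurable (fun p : SL(2, ℝ) × SL(2, ℝ) =>
      ψ (uDist (proj p.1) (proj p.2)) * a p.1) ((haar.restrict D).prod haar) :=
    (h.measurable.comp measurable_uDist_proj).aestronglyMeasurable.mul ha.aestronglyMeasurable.comp_fst
  rw [integrable_prod_iff hm]
  refine ⟨Filter.Eventually.of_forall fun g => (h.integrable g).mul_const (a g), ?_⟩
  have : ∀ g, ∫ k, ‖ψ (uDist (proj g) (proj k)) * a g‖ ∂haar = radialMass (fun u => |ψ u|) * ‖a g‖ := by
    intro g
    simp only [norm_mul, Real.norm_eq_abs]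
    rw [integral_mul_const, integral_radial (fun u => |ψ u|)]
  simp only [this]
  exact ha.norm.const_mul _

theorem IsRadialTest.integral_prod {ψ : ℝ → ℝ} {δ : ℝ} (h : IsRadialTest ψ δ) {D : Set SL(2, ℝ)}
    {a : SL(2, ℝ) → ℝ} (ha : IntegrableOn a D haar) :
    ∫ p : SL(2, ℝ) × SL(2, ℝ), ψ (uDist (proj p.1) (proj p.2)) * a p.1 ∂((haar.restrict D).prod haar)
      = radialMass ψ * ∫ g in D, a g ∂haar := by
  rw [MeasureTheory.integral_prod _ (h.integrable_prod ha), ← integral_const_mul]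
  simp only [integral_mul_const, integral_radial]

/-- The integrand of the quadratic form `⟨T f, f⟩` of a point-pair invariant. -/
noncomputable def formIntegrand (n : ℤ) (ψ : ℝ → ℝ) (f : SL(2, ℝ) → ℂ) (p : SL(2, ℝ) × SL(2, ℝ)) : ℂ :=
  weightKernel n ψ p.1 p.2 * f p.2 * (starRingEnd ℂ) (f p.1)

theorem formIntegrand_invariant {N : ℕ} (n : ℤ) (ψ : ℝ → ℝ) {f : SL(2, ℝ) → ℂ}
    (hf : ∀ γ ∈ Gamma0R N, ∀ g, f (γ * g) = f g) : IsDiagInvariant N (formIntegrand n ψ f) := by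
  intro γ hγ g h
  simp only [formIntegrand, weightKernel_mul_left, hf γ hγ]

theorem formIntegrand_swap (n : ℤ) (ψ : ℝ → ℝ) (f : SL(2, ℝ) → ℂ) (p : SL(2, ℝ) × SL(2, ℝ)) :
    formIntegrand n ψ f p.swap = (starRingEnd ℂ) (formIntegrand n ψ f p) := by
  simp only [formIntegrand, map_mul, weightKernel_conj, Prod.fst_swap, Prod.snd_swap,
    Complex.conj_conj]
  ring

/-- Exchanging the variables conjugates the integrand, by hermitian symmetry, and preserves the
integral, by invariance. -/
theorem im_integral_formIntegrand {N : ℕ} {D : Set SL(2, ℝ)}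
    (hD : IsFundamentalDomain (Gamma0R N) D haar) (n : ℤ) (ψ : ℝ → ℝ) {f : SL(2, ℝ) → ℂ}
    (hf : ∀ γ ∈ Gamma0R N, ∀ g, f (γ * g) = f g) :
    (∫ p, formIntegrand n ψ f p ∂((haar.restrict D).prod haar)).im = 0 := by
  have h := integral_swap_of_invariant hD (formIntegrand_invariant n ψ hf)
  simp only [formIntegrand_swap] at h
  rw [integral_conj] at h
  exact Complex.conj_eq_iff_im.1 h

section Form

variable {N : ℕ} {D : Set SL(2, ℝ)} {f : SL(2, ℝ) → ℂ} {ψ : ℝ → ℝ} {δ : ℝ}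

theorem radial_mul_sq_invariant (ψ : ℝ → ℝ) (hf : ∀ γ ∈ Gamma0R N, ∀ g, f (γ * g) = f g) :
    IsDiagInvariant N fun p => ψ (uDist (proj p.1) (proj p.2)) * ‖f p.1‖ ^ 2 := by
  intro γ hγ g h
  simp only [hf γ hγ, uDist_proj_mul]

theorem integrable_radial_mul_sq_snd (hD : IsFundamentalDomain (Gamma0R N) D haar)
    (hf : ∀ γ ∈ Gamma0R N, ∀ g, f (γ * g) = f g) (h2 : IntegrableOn (fun g => ‖f g‖ ^ 2) D haar)
    (hψ : IsRadialTest ψ δ) :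
    Integrable (fun p : SL(2, ℝ) × SL(2, ℝ) => ψ (uDist (proj p.1) (proj p.2)) * ‖f p.2‖ ^ 2)
      ((haar.restrict D).prod haar) := by
  have := integrable_swap_of_invariant hD (radial_mul_sq_invariant ψ hf) (hψ.integrable_prod h2)
  simpa only [Prod.fst_swap, Prod.snd_swap, uDist_comm] using this

theorem integral_radial_mul_sq_snd (hD : IsFundamentalDomain (Gamma0R N) D haar)
    (hf : ∀ γ ∈ Gamma0R N, ∀ g, f (γ * g) = f g) (h2 : IntegrableOn (fun g => ‖f g‖ ^ 2) D haar)
    (hψ : IsRadialTest ψ δ) :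
    ∫ p : SL(2, ℝ) × SL(2, ℝ), ψ (uDist (proj p.1) (proj p.2)) * ‖f p.2‖ ^ 2
      ∂((haar.restrict D).prod haar) = radialMass ψ * ∫ g in D, ‖f g‖ ^ 2 ∂haar := by
  rw [← hψ.integral_prod h2, ← integral_swap_of_invariant hD (radial_mul_sq_invariant ψ hf)]
  congr 1
  ext p
  rw [Prod.fst_swap, Prod.snd_swap, uDist_comm]

/-- The product of ‖f(g)‖ and ‖f(h)‖ is at most the sum of their squares; each square is integrable
against |ψ|, the second after exchanging the variables. -/
theorem integrable_formIntegrand (hD : IsFundamentalDomain (Gamma0R N) D haar)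
    (hf : ∀ γ ∈ Gamma0R N, ∀ g, f (γ * g) = f g) (hm : Measurable f)
    (h2 : IntegrableOn (fun g => ‖f g‖ ^ 2) D haar) (hψ : IsRadialTest ψ δ) (n : ℤ) :
    Integrable (formIntegrand n ψ f) ((haar.restrict D).prod haar) := by
  have i1 := hψ.abs.integrable_prod h2
  have i2 := integrable_radial_mul_sq_snd hD hf h2 hψ.abs
  refine (i1.add i2).mono' ?_ ?_
  · exact (((measurable_weightKernel n hψ.measurable).mul (hm.comp measurable_snd)).mul
      (Complex.continuous_conj.measurable.comp (hm.comp measurable_fst))).aestronglyMeasurable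
  · filter_upwards with p
    rw [formIntegrand, norm_mul, norm_mul, norm_weightKernel, RCLike.norm_conj, Pi.add_apply,
      ← mul_add, mul_assoc]
    refine mul_le_mul_of_nonneg_left ?_ (abs_nonneg _)
    nlinarith [sq_nonneg (‖f p.1‖ - ‖f p.2‖), sq_nonneg (‖f p.1‖ + ‖f p.2‖)]

end Form

end

section

/-! ### Square integrable eigenfunctions have real eigenvalue -/

theorem hFactor_self (m : ℤ) (z : ℍ) : hFactor (2 * m) z z = 1 := by
  have h0 : ((2 * z.im : ℝ) : ℂ) ≠ 0 := by
    have := z.im_pos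
    exact_mod_cast (by positivity : (2 * z.im : ℝ) ≠ 0)
  have e1 : (z : ℂ) - (starRingEnd ℂ) (z : ℂ) = (2 * z.im : ℝ) * Complex.I := by
    apply Complex.ext <;> simp
    ring
  have e2 : ‖(z : ℂ) - (starRingEnd ℂ) (z : ℂ)‖ = 2 * z.im := by
    rw [e1, norm_mul, Complex.norm_I, mul_one, Complex.norm_real, Real.norm_of_nonneg]
    have := z.im_pos
    positivity
  rw [hFactor, ← div_zpow, ← mul_zpow, e2, e1, mul_div_right_comm, div_self h0, one_mul,
    Complex.I_mul_I, zpow_mul]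
  norm_num

theorem radialMass_pos {ψ : ℝ → ℝ} {δ r : ℝ} (h : IsRadialTest ψ δ) (h0 : ∀ u, 0 ≤ ψ u) (hr : 0 < r)
    (hpos : ∀ u, 0 ≤ u → u < r → 0 < ψ u) : 0 < radialMass ψ := by
  rw [radialMass, integral_pos_iff_support_of_nonneg (fun _ => h0 _) (h.integrable 1)]
  have hU : IsOpen {w | uDist (proj 1) w < r} :=
    isOpen_lt (continuous_uDist.comp (by fun_prop : Continuous fun w => (proj 1, w))) continuous_const
  refine (haar_preimage_proj_pos hU ⟨proj 1, ?_⟩).trans_le (measure_mono fun g hg => ?_)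
  · simpa [uDist] using hr
  · exact (hpos _ (uDist_nonneg _ _) hg).ne'

theorem exists_uDist_lt_imp_dist_lt {r : ℝ} (hr : 0 < r) :
    ∃ δ > 0, ∀ z w : ℍ, uDist z w ≤ δ → dist z w < r := by
  refine ⟨Real.sinh (r / 4) ^ 2, by have := Real.sinh_pos_iff.2 (by linarith : 0 < r / 4); positivity,
    fun z w h => ?_⟩
  rw [uDist_eq_sinh_sq] at h
  have h1 : 0 ≤ Real.sinh (dist z w / 2) := Real.sinh_nonneg_iff.2 (by positivity)
  have h2 : 0 ≤ Real.sinh (r / 4) := Real.sinh_nonneg_iff.2 (by positivity)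
  have h3 := Real.sinh_le_sinh.1 ((pow_le_pow_iff_left₀ h1 h2 two_ne_zero).1 h)
  linarith

theorem weightKernel_mul_eq {m : ℤ} {f : SL(2, ℝ) → ℂ} (hw : IsPureWeight (2 * m) f) (ψ : ℝ → ℝ)
    (g h : SL(2, ℝ)) : formIntegrand (2 * m) ψ f (g, h) = ψ (uDist (proj g) (proj h))
      * (hFactor (2 * m) (proj g) (proj h) * f (proj h).toSL2R * (starRingEnd ℂ) (f (proj g).toSL2R)) := by
  rw [formIntegrand, weightKernel]
  have h1 : ∀ k, f k = Complex.exp (Complex.I * ((2 * m : ℤ) : ℂ) * angle k) * f (proj k).toSL2R := by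
    intro k
    conv_lhs => rw [← iwasawa_proj_angle k, hw.apply_iwasawa]
  simp only
  rw [h1 h, h1 g, map_mul, ← Complex.exp_conj]
  have e : ∀ a b : ℂ, Complex.exp (Complex.I * ((2 * m : ℤ) : ℂ) * (a - b))
      * Complex.exp (Complex.I * ((2 * m : ℤ) : ℂ) * b) * Complex.exp (-(Complex.I * ((2 * m : ℤ) : ℂ) * a)) = 1 := by
    intro a b
    rw [← Complex.exp_add, ← Complex.exp_add, ← Complex.exp_zero]
    congr 1
    ring
  have e2 : (starRingEnd ℂ) (Complex.I * ((2 * m : ℤ) : ℂ) * (angle g : ℂ))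
      = -(Complex.I * ((2 * m : ℤ) : ℂ) * angle g) := by
    rw [map_mul, map_mul, Complex.conj_I, Complex.conj_ofReal, map_intCast]
    ring
  rw [e2]
  linear_combination (ψ (uDist (proj g) (proj h)) * (hFactor (2 * m) (proj g) (proj h)
    * f (proj h).toSL2R * (starRingEnd ℂ) (f (proj g).toSL2R))) * e (angle g) (angle h)

theorem norm_toSL2R_proj {n : ℤ} {f : SL(2, ℝ) → ℂ} (hw : IsPureWeight n f) (g : SL(2, ℝ)) :
    ‖f (proj g).toSL2R‖ = ‖f g‖ := by
  conv_rhs => rw [← iwasawa_proj_angle g, hw.apply_iwasawa]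
  rw [norm_mul, mul_comm Complex.I, mul_right_comm, ← Complex.ofReal_intCast, ← Complex.ofReal_mul,
    Complex.norm_exp_ofReal_mul_I, one_mul]

/-- Uniform closeness of the phase-shifted values of a weight-`2m` function on a compact set. -/
theorem exists_uniform_close {m : ℤ} {F : ℍ → ℂ} (hF : Continuous F) (R : ℝ) {ε : ℝ} (hε : 0 < ε) :
    ∃ δ > 0, ∀ z w : ℍ, dist z UpperHalfPlane.I ≤ R → uDist z w ≤ δ →
      ‖hFactor (2 * m) z w * F w - F z‖ < ε := by
  have hc : Continuous fun p : ℍ × ℍ => hFactor (2 * m) p.1 p.2 * F p.2 := by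
    have := continuous_hFactor (2 * m)
    fun_prop
  have hK := (isCompact_closedBall UpperHalfPlane.I (R + 1)).prod
    (isCompact_closedBall UpperHalfPlane.I (R + 1))
  have hu := hK.uniformContinuousOn_of_continuous hc.continuousOn
  obtain ⟨r, hr, H⟩ := Metric.uniformContinuousOn_iff.1 hu ε hε
  obtain ⟨δ, hδ, hδ'⟩ := exists_uDist_lt_imp_dist_lt (lt_min hr one_pos)
  refine ⟨δ, hδ, fun z w hz hzw => ?_⟩
  have h1 := hδ' z w hzw
  have h2 := lt_min_iff.1 h1
  have hz' : z ∈ Metric.closedBall UpperHalfPlane.I (R + 1) := by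
    rw [Metric.mem_closedBall]; linarith
  have hw' : w ∈ Metric.closedBall UpperHalfPlane.I (R + 1) := by
    rw [Metric.mem_closedBall]
    have := dist_triangle_left w UpperHalfPlane.I z
    linarith
  have := H (z, w) ⟨hz', hw'⟩ (z, z) ⟨hz', hz'⟩ (by
    rw [Prod.dist_eq, dist_self, max_eq_right dist_nonneg, dist_comm]
    exact h2.1)
  rw [dist_eq_norm] at this
  simpa only [hFactor_self, one_mul] using this

variable {N : ℕ} {D : Set SL(2, ℝ)}

/-- If the integral vanished, the Γ₀(N)-invariant set where f ≠ 0 would meet D in a null set and so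
be null. But it is the preimage under `proj` of a nonempty open set. -/
theorem integral_sq_pos (hD : IsFundamentalDomain (Gamma0R N) D haar) {n : ℤ} {f : SL(2, ℝ) → ℂ}
    (hf : ∀ γ ∈ Gamma0R N, ∀ g, f (γ * g) = f g) (hc : Continuous f) (hw : IsPureWeight n f)
    (hne : f ≠ 0) (h2 : IntegrableOn (fun g => ‖f g‖ ^ 2) D haar) :
    0 < ∫ g in D, ‖f g‖ ^ 2 ∂haar := by
  rw [integral_pos_iff_support_of_nonneg (fun _ => by positivity) h2]
  have hs : Function.support (fun g => ‖f g‖ ^ 2) = {g | f g ≠ 0} := by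
    ext g
    simp
  rw [hs, pos_iff_ne_zero]
  intro h0
  have hO : IsOpen {g | f g ≠ 0} := isOpen_ne_fun hc continuous_const
  rw [Measure.restrict_apply hO.measurableSet] at h0
  have h1 := hD.measure_zero_of_invariant {g | f g ≠ 0} (fun γ => by
    ext g
    rw [Set.mem_smul_set_iff_inv_smul_mem]
    change f ((γ : SL(2, ℝ))⁻¹ * g) ≠ 0 ↔ f g ≠ 0
    rw [hf _ (inv_mem γ.2)]) h0
  obtain ⟨g, hg⟩ := Function.ne_iff.1 hne
  have hU : IsOpen {z : ℍ | f z.toSL2R ≠ 0} :=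
    isOpen_ne_fun (hc.comp UpperHalfPlane.continuous_toSL2R) continuous_const
  refine (haar_preimage_proj_pos hU ⟨proj g, ?_⟩).ne' ?_
  · change f (proj g).toSL2R ≠ 0
    rw [← norm_ne_zero_iff, norm_toSL2R_proj hw]
    simpa using hg
  · convert h1 using 2
    ext k
    change f (proj k).toSL2R ≠ 0 ↔ f k ≠ 0
    rw [← norm_ne_zero_iff, norm_toSL2R_proj hw, norm_ne_zero_iff]

/-- A nonnegative kernel concentrated near the diagonal acts almost as multiplication by its mass.
Uniform continuity is available only on a compact part of D, and the rest, carrying little of the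
norm, is estimated crudely. -/
theorem re_integral_formIntegrand_pos (hD : IsFundamentalDomain (Gamma0R N) D haar) {m : ℤ}
    {f : SL(2, ℝ) → ℂ} (hf : ∀ γ ∈ Gamma0R N, ∀ g, f (γ * g) = f g) (hc : Continuous f)
    (hw : IsPureWeight (2 * m) f) (hne : f ≠ 0) (h2 : IntegrableOn (fun g => ‖f g‖ ^ 2) D haar) :
    ∃ δ > 0, ∀ ψ : ℝ → ℝ, IsRadialTest ψ δ → (∀ u, 0 ≤ ψ u) → 0 < radialMass ψ →
      0 < (∫ p, formIntegrand (2 * m) ψ f p ∂((haar.restrict D).prod haar)).re := by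
  set A := ∫ g in D, ‖f g‖ ^ 2 ∂haar with hA
  have hA0 : 0 < A := integral_sq_pos hD hf hc hw hne h2
  -- a compact part of `D` carrying almost all the mass
  set Q : ℕ → Set SL(2, ℝ) := fun k => {g | dist (proj g) UpperHalfPlane.I ≤ k} with hQ
  have hQm : ∀ k, MeasurableSet (Q k) := fun k =>
    (isClosed_le (continuous_proj.dist continuous_const) continuous_const).measurableSet
  have hlim : Filter.Tendsto (fun k => ∫ g in Q k, ‖f g‖ ^ 2 ∂(haar.restrict D)) Filter.atTop
      (nhds (∫ g in ⋃ k, Q k, ‖f g‖ ^ 2 ∂(haar.restrict D))) := by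
    refine tendsto_setIntegral_of_monotone hQm (fun i j hij g hg => ?_) h2.integrable.integrableOn
    have hij' : (i : ℝ) ≤ j := by exact_mod_cast hij
    exact (show dist (proj g) UpperHalfPlane.I ≤ (i : ℝ) from hg).trans hij'
  have hU : ⋃ k, Q k = Set.univ := by
    ext g
    simpa [hQ] using exists_nat_ge (dist (proj g) UpperHalfPlane.I)
  rw [hU, Measure.restrict_univ, ← hA] at hlim
  obtain ⟨k, hk⟩ := (hlim.eventually (lt_mem_nhds (by linarith : A - A / 64 < A))).exists
  have hvol : haar (Q k) < ⊤ := by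
    have : Q k = proj ⁻¹' Metric.closedBall UpperHalfPlane.I k := rfl
    rw [this, haar_preimage_proj Metric.isClosed_closedBall.measurableSet]
    exact ENNReal.mul_lt_top (by finiteness) (isCompact_closedBall _ _).measure_lt_top
  have hvol' : haar.restrict D (Q k) < ⊤ := (Measure.restrict_le_self _).trans_lt hvol
  set V := (haar.restrict D).real (Q k) with hV
  have hV0 : 0 ≤ V := measureReal_nonneg
  obtain ⟨ε, hε, hεV⟩ : ∃ ε > 0, ε ^ 2 * V ≤ A / 8 := by
    refine ⟨Real.sqrt (A / (8 * (V + 1))), Real.sqrt_pos.2 (by positivity), ?_⟩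
    rw [Real.sq_sqrt (by positivity), div_mul_eq_mul_div, div_le_div_iff₀ (by positivity) (by positivity)]
    nlinarith
  obtain ⟨δ, hδ, H⟩ := exists_uniform_close (m := m) (F := fun z => f z.toSL2R)
    (hc.comp UpperHalfPlane.continuous_toSL2R) k hε
  refine ⟨δ, hδ, fun ψ hψ hψ0 hmass => ?_⟩
  -- the lower bound for the integrand
  set a : SL(2, ℝ) → ℝ := (Q k).indicator (fun g => ‖f g‖ ^ 2 / 2 - ε ^ 2 / 2)
    - (Q k)ᶜ.indicator (fun g => 4 * ‖f g‖ ^ 2) with ha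
  have i1 : Integrable ((Q k).indicator (fun g => ‖f g‖ ^ 2 / 2 - ε ^ 2 / 2)) (haar.restrict D) := by
    rw [integrable_indicator_iff (hQm k)]
    exact (h2.integrable.integrableOn.div_const _).sub (integrableOn_const hvol'.ne)
  have i2 : Integrable ((Q k)ᶜ.indicator (fun g => 4 * ‖f g‖ ^ 2)) (haar.restrict D) :=
    (h2.integrable.const_mul _).indicator (hQm k).compl
  have hai : IntegrableOn a D haar := i1.sub i2
  -- Main term at least 63A/128, minus A/16 from ε²V/2, minus 4·A/64 from the complement: 47A/128
  -- remains, more than A/4. The later loss of A/16 is still affordable.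
  have hint : A * (1 / 4) ≤ ∫ g in D, a g ∂haar := by
    have e1 : ∫ g in D, a g ∂haar = ((∫ g in Q k, ‖f g‖ ^ 2 ∂(haar.restrict D)) / 2 - V * (ε ^ 2 / 2))
        - 4 * ∫ g in (Q k)ᶜ, ‖f g‖ ^ 2 ∂(haar.restrict D) := by
      rw [ha]
      simp only [Pi.sub_apply]
      rw [integral_sub i1 i2, integral_indicator (hQm k), integral_indicator (hQm k).compl,
        integral_sub (h2.integrable.integrableOn.div_const _) (integrableOn_const hvol'.ne),
        integral_div, integral_const_mul, setIntegral_const, smul_eq_mul]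
    have e2 := integral_add_compl (hQm k) h2.integrable
    rw [← hA] at e2
    rw [e1]
    nlinarith
  have hi1 := hψ.integrable_prod hai
  have hi2 := integrable_radial_mul_sq_snd hD hf h2 hψ
  have hform := integrable_formIntegrand hD hf hc.measurable h2 hψ (2 * m)
  have key : ∀ p : SL(2, ℝ) × SL(2, ℝ), ψ (uDist (proj p.1) (proj p.2)) * a p.1
      - 1 / 16 * (ψ (uDist (proj p.1) (proj p.2)) * ‖f p.2‖ ^ 2) ≤ (formIntegrand (2 * m) ψ f p).re := by
    rintro ⟨g, h⟩
    rw [weightKernel_mul_eq hw, Complex.re_ofReal_mul, mul_left_comm, ← mul_sub]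
    by_cases hu : uDist (proj g) (proj h) ≤ δ
    · refine mul_le_mul_of_nonneg_left ?_ (hψ0 _)
      simp only
      set x := f (proj g).toSL2R with hx
      set y := f (proj h).toSL2R with hy
      have hx' : ‖f g‖ = ‖x‖ := (norm_toSL2R_proj hw g).symm
      have hy' : ‖f h‖ = ‖y‖ := (norm_toSL2R_proj hw h).symm
      by_cases hg : g ∈ Q k
      · have h3 := H (proj g) (proj h) hg hu
        rw [ha, Pi.sub_apply, Set.indicator_of_mem hg, Set.indicator_of_notMem (by simpa using hg),
          sub_zero, hx', hy']
        have e : hFactor (2 * m) (proj g) (proj h) * y * (starRingEnd ℂ) x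
            = (hFactor (2 * m) (proj g) (proj h) * y - x) * (starRingEnd ℂ) x + (‖x‖ ^ 2 : ℝ) := by
          rw [sub_mul, Complex.mul_conj, Complex.normSq_eq_norm_sq]
          ring
        rw [e, Complex.add_re, Complex.ofReal_re]
        have h4 := Complex.abs_re_le_norm ((hFactor (2 * m) (proj g) (proj h) * y - x) * (starRingEnd ℂ) x)
        rw [norm_mul, RCLike.norm_conj] at h4
        have h5 := (abs_le.1 h4).1
        have h6 := mul_le_mul_of_nonneg_right h3.le (norm_nonneg x)
        -- Near the diagonal the real part is at least ‖x‖² - ε‖x‖, and ε‖x‖ ≤ ‖x‖²/2 + ε²/2.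
        nlinarith [sq_nonneg (‖x‖ - ε), sq_nonneg ‖y‖]
      · rw [ha, Pi.sub_apply, Set.indicator_of_notMem hg, Set.indicator_of_mem (by simpa using hg),
          zero_sub, hx', hy']
        have h4 := Complex.abs_re_le_norm (hFactor (2 * m) (proj g) (proj h) * y * (starRingEnd ℂ) x)
        rw [norm_mul, norm_mul, norm_hFactor, RCLike.norm_conj, one_mul] at h4
        have h5 := (abs_le.1 h4).1
        -- The square encodes ‖x‖‖y‖ ≤ 4‖x‖² + ‖y‖²/16, weighted so that the integral over h costs
        -- only A/16 times the mass.
        nlinarith [sq_nonneg (‖y‖ / 4 - 2 * ‖x‖)]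
    · rw [hψ.support _ (not_le.1 hu)]
      simp
  have hmono := integral_mono (hi1.sub (hi2.const_mul (1 / 16))) hform.re key
  have e3 : ∫ p, (formIntegrand (2 * m) ψ f p).re ∂((haar.restrict D).prod haar)
      = (∫ p, formIntegrand (2 * m) ψ f p ∂((haar.restrict D).prod haar)).re :=
    integral_re hform
  have e4 : ∫ p : SL(2, ℝ) × SL(2, ℝ), ((ψ (uDist (proj p.1) (proj p.2)) * a p.1)
      - 1 / 16 * (ψ (uDist (proj p.1) (proj p.2)) * ‖f p.2‖ ^ 2)) ∂((haar.restrict D).prod haar)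
      = radialMass ψ * (∫ g in D, a g ∂haar) - 1 / 16 * (radialMass ψ * A) := by
    rw [integral_sub hi1 (hi2.const_mul _), integral_const_mul, hψ.integral_prod hai,
      integral_radial_mul_sq_snd hD hf h2 hψ]
  have hle : radialMass ψ * (∫ g in D, a g ∂haar) - 1 / 16 * (radialMass ψ * A)
      ≤ (∫ p, formIntegrand (2 * m) ψ f p ∂((haar.restrict D).prod haar)).re := by
    rw [← e3, ← e4]
    exact hmono
  have : 0 < radialMass ψ * A := mul_pos hmass hA0
  have h7 := mul_le_mul_of_nonneg_left hint hmass.le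
  nlinarith

/-- The eigenvalue of a nonzero square integrable Casimir eigenfunction of even weight is real. -/
theorem eigenvalue_im_eq_zero {m : ℤ} {lam : ℂ} {f : SL(2, ℝ) → ℂ} (hf : IsCasimirEigenfunction N lam f)
    (hw : IsPureWeight (2 * m) f) (hne : f ≠ 0) (hsq : IsSquareIntegrable N f) : lam.im = 0 := by
  obtain ⟨D, hD, hL⟩ := hsq
  have hc := hw.continuous hf.smooth
  have h2 : IntegrableOn (fun g => ‖f g‖ ^ 2) D haar := hL.integrable_norm_pow (by norm_num)
  obtain ⟨δ, hδ, H⟩ := re_integral_formIntegrand_pos hD hf.invariant hc hw hne h2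
  set r := min δ (1 / 2) with hr
  have hr0 : 0 < r := lt_min hδ (by norm_num)
  let b : ContDiffBump (0 : ℝ) := ⟨r / 2, r, by linarith, by linarith⟩
  have hb : ContDiff ℝ ∞ b := b.contDiff
  have hd1 : ∀ t, HasDerivAt b (deriv b t) t := fun t =>
    (hb.differentiable (by simp) t).hasDerivAt
  have hb1 : ContDiff ℝ ∞ (deriv b) := ((contDiff_infty_iff_deriv (𝕜 := ℝ)).1 hb).2
  have hd2 : ∀ t, HasDerivAt (deriv b) (deriv (deriv b) t) t := fun t =>
    (hb1.differentiable (by simp) t).hasDerivAt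
  have hb2 : ContDiff ℝ ∞ (deriv (deriv b)) := ((contDiff_infty_iff_deriv (𝕜 := ℝ)).1 hb1).2
  have z0 : ∀ u, r < u → b u = 0 := fun u hu => b.zero_of_le_dist (by
    rw [Real.dist_eq, sub_zero]; exact hu.le.trans (le_abs_self u))
  have z1 : ∀ u, r < u → deriv b u = 0 := fun u hu => by
    have : b =ᶠ[nhds u] fun _ => 0 := by
      filter_upwards [lt_mem_nhds hu] with v hv using z0 v hv
    rw [this.deriv_eq, deriv_const]
  have z2 : ∀ u, r < u → deriv (deriv b) u = 0 := fun u hu => by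
    have : deriv b =ᶠ[nhds u] fun _ => 0 := by
      filter_upwards [lt_mem_nhds hu] with v hv using z1 v hv
    rw [this.deriv_eq, deriv_const]
  have t1 : IsRadialTest b r := ⟨hb.continuous.measurable, ⟨1, fun u _ => by
    rw [abs_of_nonneg b.nonneg]; exact b.le_one⟩, z0⟩
  set L := radialCasimir m b (deriv b) (deriv (deriv b)) with hL'
  have hLz : ∀ u, r < u → L u = 0 := fun u hu => by
    rw [hL', radialCasimir, z0 u hu, z1 u hu, z2 u hu]
    simp
  have hLm : Measurable L := by
    have m0 := hb.continuous.measurable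
    have m1 := hb1.continuous.measurable
    have m2 := hb2.continuous.measurable
    rw [hL']
    unfold radialCasimir
    fun_prop
  have t2 : IsRadialTest L r := by
    refine ⟨hLm, ?_, hLz⟩
    have hcont : ContinuousOn L (Set.Icc 0 r) := by
      have c0 := hb.continuous
      have c1 := hb1.continuous
      have c2 := hb2.continuous
      rw [hL']
      unfold radialCasimir
      refine ContinuousOn.neg (ContinuousOn.add (by fun_prop) (ContinuousOn.div (by fun_prop)
        (by fun_prop) fun u hu => ?_))
      linarith [hu.1]
    obtain ⟨C, hC⟩ := isCompact_Icc.exists_bound_of_continuousOn hcont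
    refine ⟨max C 0, fun u hu => ?_⟩
    by_cases hur : u ≤ r
    · exact (hC u ⟨hu, hur⟩).trans (le_max_left _ _)
    · rw [hLz u (not_le.1 hur), abs_zero]
      exact le_max_right _ _
  obtain ⟨C, hC⟩ := t1.bounded
  obtain ⟨C', hC'⟩ := t2.bounded
  have hmass : 0 < radialMass b := radialMass_pos t1 (fun u => b.nonneg) hr0 fun u hu hur =>
    b.pos_of_mem_ball (by rw [Metric.mem_ball, Real.dist_eq, sub_zero, abs_of_nonneg hu]; exact hur)
  have hpos := H b ⟨t1.measurable, t1.bounded, fun u hu => z0 u ((min_le_left _ _).trans_lt hu)⟩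
    (fun u => b.nonneg) hmass
  have im1 := im_integral_formIntegrand hD (2 * m) b hf.invariant
  have im2 := im_integral_formIntegrand hD (2 * m) L hf.invariant
  have f1 := integrable_formIntegrand hD hf.invariant hc.measurable h2 t1 (2 * m)
  have f2 := integrable_formIntegrand hD hf.invariant hc.measurable h2 t2 (2 * m)
  -- Applying the intertwining relation for each g and pairing with f gives an identity between two
  -- real numbers with factor `lam`; the one on the left is positive, so `lam` is real.
  have key : lam * ∫ p, formIntegrand (2 * m) b f p ∂((haar.restrict D).prod haar)
      = ∫ p, formIntegrand (2 * m) L f p ∂((haar.restrict D).prod haar) := by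
    rw [integral_prod _ f1, integral_prod _ f2, ← integral_const_mul]
    congr 1
    ext g
    simp only [formIntegrand]
    rw [integral_mul_const, integral_mul_const, ← mul_assoc,
      casimir_eigen_integral hf.smooth hw hf.eigen hd1 hd2 hb2.continuous hr0.le z0 hLz hC hC' hLm g]
  have := congrArg Complex.im key
  rw [Complex.mul_im, im1, im2, mul_zero, zero_add] at this
  exact (mul_eq_zero.1 this).resolve_right hpos.ne'

end

section

/-! ### Spectral pairs -/

theorem neg_one_mem_Gamma0R (N : ℕ) : (-1 : SL(2, ℝ)) ∈ Gamma0R N := by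
  refine ⟨-1, ?_, ?_⟩
  · simp [CongruenceSubgroup.Gamma0_mem]
  · ext i j
    fin_cases i <;> fin_cases j <;> simp

theorem rot_pi : rot Real.pi = -1 := by
  ext i j
  fin_cases i <;> fin_cases j <;> simp [rot_apply]

/-- The rotation by π equals -1, which lies in Γ₀(N), so weight n and invariance together force
exp(iπn) = 1. -/
theorem IsSpectralPair.even {N : ℕ} {t : ℂ} {n : ℤ} (h : IsSpectralPair N t n) : Even n := by
  obtain ⟨f, hne, hf, hw, -⟩ := h
  obtain ⟨g, hg⟩ := Function.ne_iff.1 hne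
  have h1 := hw g Real.pi
  rw [rot_pi, mul_neg_one, ← neg_one_mul, hf.invariant _ (neg_one_mem_Gamma0R N)] at h1
  have h2 : Complex.exp (Complex.I * n * Real.pi) = 1 :=
    (mul_right_cancel₀ hg (by rw [one_mul]; exact h1)).symm
  rw [show Complex.I * n * (Real.pi : ℂ) = n * (Real.pi * Complex.I) by ring, Complex.exp_int_mul,
    Complex.exp_pi_mul_I] at h2
  by_contra hodd
  rw [Int.not_even_iff_odd] at hodd
  rw [hodd.neg_one_zpow] at h2
  norm_num at h2

/-- The imaginary part of 1/4 + t² is 2 Re t Im t, and it vanishes in the square integrable case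
because the eigenvalue is real. -/
theorem IsSpectralPair.real_or_imaginary {N : ℕ} {t : ℂ} {n : ℤ} (h : IsSpectralPair N t n) :
    t.im = 0 ∨ t.re = 0 := by
  obtain ⟨m, hm⟩ := h.even
  obtain ⟨f, hne, hf, hw, hsq | ht⟩ := h
  · rw [hm, ← two_mul] at hw
    have := eigenvalue_im_eq_zero hf hw hne hsq
    rw [Complex.add_im, pow_two, Complex.mul_im] at this
    norm_num at this
    have h2 : t.re * t.im = 0 := by linarith
    exact (mul_eq_zero.1 h2).symm
  · exact Or.inl ht

/-! ### Families of radial functions -/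

/-- A uniformly compactly supported, uniformly absolutely summable family of radial functions. -/
structure IsTestFamily (Φ : ℤ → ℝ → ℝ) (δ B : ℝ) : Prop where
  measurable : ∀ n, Measurable (Φ n)
  support : ∀ n u, δ < u → Φ n u = 0
  summable : ∀ u, 0 ≤ u → Summable fun n => |Φ n u|
  bound : ∀ u, 0 ≤ u → ∑' n, |Φ n u| ≤ B

variable {Φ : ℤ → ℝ → ℝ} {δ B : ℝ}

theorem IsTestFamily.abs_le (h : IsTestFamily Φ δ B) (n : ℤ) (u : ℝ) (hu : 0 ≤ u) : |Φ n u| ≤ B :=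
  ((h.summable u hu).le_tsum n fun _ _ => abs_nonneg _).trans (h.bound u hu)

theorem IsTestFamily.summable_norm (h : IsTestFamily Φ δ B) (g k : SL(2, ℝ)) :
    Summable fun n => ‖weightKernel n (Φ n) g k‖ := by
  simp only [norm_weightKernel]
  exact h.summable _ (uDist_nonneg _ _)

/-- The uniform bound and the common support reduce the claim to integrability of f over one compact
ball, so no growth condition on f is needed. -/
theorem IsTestFamily.lintegral_lt_top (h : IsTestFamily Φ δ B) {f : SL(2, ℝ) → ℂ} (hm : Measurable f)
    (hf : Continuous fun p : ℍ × ℝ => f (iwasawa p.1 p.2)) (g : SL(2, ℝ)) :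
    ∫⁻ k, ∑' n : ℤ, ‖weightKernel n (Φ n) g k * f k‖ₑ ∂haar < ⊤ := by
  calc _ ≤ ∫⁻ k, ENNReal.ofReal B *
        {k | uDist (proj g) (proj k) ≤ δ}.indicator (fun k => ‖f k‖ₑ) k ∂haar := by
        refine lintegral_mono fun k => ?_
        simp only [enorm_mul]
        rw [ENNReal.tsum_mul_right]
        simp only [← ofReal_norm (weightKernel _ _ g k), norm_weightKernel]
        by_cases hw : uDist (proj g) (proj k) ≤ δ
        · rw [Set.indicator_of_mem (show k ∈ {k | uDist (proj g) (proj k) ≤ δ} from hw),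
            ← ENNReal.ofReal_tsum_of_nonneg (fun _ => abs_nonneg _) (h.summable _ (uDist_nonneg _ _))]
          gcongr
          exact h.bound _ (uDist_nonneg _ _)
        · simp [h.support _ _ (not_le.1 hw)]
    _ < ⊤ := by
        rw [lintegral_const_mul' _ _ ENNReal.ofReal_ne_top]
        exact ENNReal.mul_lt_top (by finiteness) (lintegral_indicator_ball_lt_top hm hf _ _)

theorem IsTestFamily.hasAbsoluteConvergence (h : IsTestFamily Φ δ B) : HasAbsoluteConvergence Φ :=
  fun _ _ _ _ hf g => h.lintegral_lt_top hf.smooth.measurable hf.smooth.continuous_iwasawa g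

theorem IsTestFamily.measurable_term (h : IsTestFamily Φ δ B) {f : SL(2, ℝ) → ℂ} (hm : Measurable f)
    (g : SL(2, ℝ)) (n : ℤ) : Measurable fun k => weightKernel n (Φ n) g k * f k :=
  ((measurable_weightKernel n (h.measurable n)).comp measurable_prodMk_left).mul hm

theorem IsTestFamily.kernel_mul (h : IsTestFamily Φ δ B) (f : SL(2, ℝ) → ℂ) (g k : SL(2, ℝ)) :
    HasSum (fun n => weightKernel n (Φ n) g k * f k) (kernel Φ g k * f k) :=
  ((h.summable_norm g k).of_norm.hasSum).mul_right _

theorem IsTestFamily.integrable_kernel_mul (h : IsTestFamily Φ δ B) {f : SL(2, ℝ) → ℂ}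
    (hm : Measurable f) (hf : Continuous fun p : ℍ × ℝ => f (iwasawa p.1 p.2)) (g : SL(2, ℝ)) :
    Integrable (fun k => kernel Φ g k * f k) haar := by
  refine ⟨aestronglyMeasurable_of_tendsto_ae Filter.atTop
    (f := fun (s : Finset ℤ) k => ∑ n ∈ s, weightKernel n (Φ n) g k * f k) (fun s => ?_) ?_, ?_⟩
  · exact (Finset.measurable_sum s fun n _ => h.measurable_term hm g n).aestronglyMeasurable
  · exact Filter.Eventually.of_forall fun k => h.kernel_mul f g k
  · rw [hasFiniteIntegral_iff_enorm]
    refine (lintegral_mono fun k => ?_).trans_lt (h.lintegral_lt_top hm hf g)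
    simp only
    rw [← (h.kernel_mul f g k).tsum_eq]
    exact enorm_tsum_le_tsum_enorm

theorem IsTestFamily.integral_kernel_mul (h : IsTestFamily Φ δ B) {f : SL(2, ℝ) → ℂ}
    (hm : Measurable f) (hf : Continuous fun p : ℍ × ℝ => f (iwasawa p.1 p.2)) (g : SL(2, ℝ)) :
    ∫ k, kernel Φ g k * f k ∂haar = ∑' n, ∫ k, weightKernel n (Φ n) g k * f k ∂haar := by
  rw [← integral_tsum (fun n => (h.measurable_term hm g n).aestronglyMeasurable)]
  · congr 1
    ext k
    exact (h.kernel_mul f g k).tsum_eq.symm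
  · rw [← lintegral_tsum fun n => (h.measurable_term hm g n).enorm.aemeasurable]
    exact (h.lintegral_lt_top hm hf g).ne

theorem integral_exp_int_mul {k : ℤ} (hk : k ≠ 0) :
    ∫ θ in Set.Ico 0 (2 * Real.pi), Complex.exp (Complex.I * k * (θ : ℝ)) = 0 := by
  rw [integral_Ico_eq_integral_Ioc, ← intervalIntegral.integral_of_le Real.two_pi_pos.le]
  have hk' : Complex.I * (k : ℂ) ≠ 0 := mul_ne_zero Complex.I_ne_zero (by exact_mod_cast hk)
  rw [integral_exp_mul_complex hk']
  have : Complex.exp (Complex.I * k * ((2 * Real.pi : ℝ) : ℂ)) = 1 := by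
    rw [show Complex.I * k * ((2 * Real.pi : ℝ) : ℂ) = k * (2 * Real.pi * Complex.I) by
      push_cast; ring]
    exact Complex.exp_int_mul_two_pi_mul_I k
  rw [this]
  simp

/-- Orthogonality of the characters exp(ikθ): only the component of the kernel with the weight of f
survives, so ρ(t, n) sees Φ_n alone. -/
theorem IsTestFamily.integral_other_weight (h : IsTestFamily Φ δ B) {f : SL(2, ℝ) → ℂ}
    (hm : Measurable f) (hf : Continuous fun p : ℍ × ℝ => f (iwasawa p.1 p.2)) {n k : ℤ}
    (hw : IsPureWeight n f) (hk : k ≠ n) :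
    ∫ g, weightKernel k (Φ k) 1 g * f g ∂haar = 0 := by
  rw [integral_haar (h.measurable_term hm 1 k)
    (integrable_weightKernel_mul (h.measurable k) (h.abs_le k) (h.support k) hm hf 1)]
  have : ∀ z : ℍ, ∫ θ in Set.Ico 0 (2 * Real.pi),
      weightKernel k (Φ k) 1 (iwasawa z θ) * f (iwasawa z θ) = 0 := by
    intro z
    have e : ∀ θ : ℝ, weightKernel k (Φ k) 1 (iwasawa z θ) * f (iwasawa z θ)
        = ((Φ k (uDist (proj 1) z) : ℂ) * hFactor k (proj 1) z
      * Complex.exp (Complex.I * k * angle 1) * f z.toSL2R)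
        * Complex.exp (Complex.I * ((n - k : ℤ) : ℂ) * θ) := by
      intro θ
      rw [weightKernel_iwasawa_right, hw.apply_iwasawa]
      have : Complex.exp (Complex.I * ((n - k : ℤ) : ℂ) * θ)
          = Complex.exp (-(Complex.I * k * θ)) * Complex.exp (Complex.I * n * θ) := by
        rw [← Complex.exp_add]
        congr 1
        push_cast
        ring
      rw [this]
      ring
    simp only [e]
    rw [integral_const_mul, integral_exp_int_mul (sub_ne_zero.2 hk.symm), mul_zero]
  simp [this]

/-- The plane wave `y(h)^(1/2 + i t) exp (i n θ(h))`. -/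
noncomputable def planeWave (t : ℂ) (n : ℤ) (h : SL(2, ℝ)) : ℂ :=
  ((proj h).im : ℂ) ^ (1 / 2 + Complex.I * t) * Complex.exp (Complex.I * n * (angle h : ℂ))

theorem planeWave_iwasawa (t : ℂ) (n : ℤ) (z : ℍ) (θ : ℝ) : planeWave t n (iwasawa z θ)
    = (z.im : ℂ) ^ (1 / 2 + Complex.I * t) * Complex.exp (Complex.I * n * θ) := by
  rw [planeWave, proj_iwasawa, exp_int_angle_iwasawa]

theorem planeWave_toSL2R (t : ℂ) (n : ℤ) (z : ℍ) : planeWave t n z.toSL2R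
    = (z.im : ℂ) ^ (1 / 2 + Complex.I * t) := by
  rw [← iwasawa_zero, planeWave_iwasawa]
  simp

theorem isPureWeight_planeWave (t : ℂ) (n : ℤ) : IsPureWeight n (planeWave t n) := by
  intro g θ
  rw [← iwasawa_proj_angle g, iwasawa_mul_rot, planeWave_iwasawa, planeWave_iwasawa]
  push_cast
  rw [mul_add, Complex.exp_add]
  ring

theorem measurable_planeWave (t : ℂ) (n : ℤ) : Measurable (planeWave t n) := by
  have h1 : Measurable fun h : SL(2, ℝ) => (proj h).im :=
    UpperHalfPlane.continuous_im.measurable.comp measurable_proj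
  have h2 := measurable_angle
  unfold planeWave
  fun_prop

theorem continuous_planeWave (t : ℂ) (n : ℤ) :
    Continuous fun p : ℍ × ℝ => planeWave t n (iwasawa p.1 p.2) := by
  simp only [planeWave_iwasawa]
  have h1 : Continuous fun p : ℍ × ℝ => (p.1.im : ℂ) := by
    have := UpperHalfPlane.continuous_im
    fun_prop
  exact (h1.cpow continuous_const fun p => Complex.ofReal_mem_slitPlane.2 p.1.im_pos).mul
    (by fun_prop)

theorem IsTestFamily.integrable_transform (h : IsTestFamily Φ δ B) (t : ℂ) (n : ℤ) :
    Integrable (transformIntegrand (kernel Φ) t n) haar := by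
  have := h.integrable_kernel_mul (measurable_planeWave t n) (continuous_planeWave t n) 1
  simp only [planeWave, ← mul_assoc] at this
  exact this

theorem IsTestFamily.integral_transform (h : IsTestFamily Φ δ B) (t : ℂ) (n : ℤ) :
    ∫ g, transformIntegrand (kernel Φ) t n g ∂haar
      = ∫ g, weightKernel n (Φ n) 1 g * planeWave t n g ∂haar := by
  have := h.integral_kernel_mul (measurable_planeWave t n) (continuous_planeWave t n) 1
  rw [tsum_eq_single n fun k hk => h.integral_other_weight (measurable_planeWave t n)
    (continuous_planeWave t n) (isPureWeight_planeWave t n) hk] at this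
  rw [← this]
  simp only [planeWave, transformIntegrand, ← mul_assoc]

theorem IsTestFamily.integral_transform_even (h : IsTestFamily Φ δ B) (t : ℂ) (m : ℤ) :
    ∫ g, transformIntegrand (kernel Φ) t (2 * m) g ∂haar
      = 2 * Real.pi * ∫ z : ℍ, (Φ (2 * m) (uDist UpperHalfPlane.I z) : ℂ)
        * hFactor (2 * m) UpperHalfPlane.I z * (z.im : ℂ) ^ (1 / 2 + Complex.I * t) := by
  rw [h.integral_transform, integral_weightKernel_one_mul (h.measurable _) (h.abs_le _) (h.support _)
    (measurable_planeWave t _) (continuous_planeWave t _) (isPureWeight_planeWave t _)]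
  simp only [planeWave_toSL2R]

end

/-! ### The Abel transform -/

/-- The weight-`2m` Abel transform of a radial function. -/
noncomputable def abel (m : ℤ) (ψ : ℝ → ℝ) (w : ℝ) : ℂ :=
  ∫ v : ℝ, (ψ (w + v ^ 2) : ℂ)
    * (((√(1 + w) : ℝ) - Complex.I * v) / ((√(1 + w) : ℝ) + Complex.I * v)) ^ m

theorem integral_Ioi_eq_integral_exp (h : ℝ → ℂ) :
    ∫ y in Set.Ioi 0, h y = ∫ r : ℝ, (Real.exp r : ℂ) * h (Real.exp r) := by
  have := integral_image_eq_integral_abs_deriv_smul (s := Set.univ) MeasurableSet.univ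
    (fun r _ => (Real.hasDerivAt_exp r).hasDerivWithinAt) Real.exp_injective.injOn h
  rw [Set.image_univ, Real.range_exp, Measure.restrict_univ] at this
  rw [this]
  simp only [abs_of_pos (Real.exp_pos _), Complex.real_smul]

/-- In the horocyclic variables y = exp r, x = 2 exp(r/2) v, the point-pair quantity separates;
integrating over v is then the Abel transform. -/
theorem uCart_exp (r v : ℝ) :
    uCart (2 * Real.exp (r / 2) * v) (Real.exp r) = Real.sinh (r / 2) ^ 2 + v ^ 2 := by
  have h : Real.exp r = Real.exp (r / 2) ^ 2 := by
    rw [← Real.exp_nat_mul]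
    congr 1
    push_cast
    ring
  rw [uCart, h, Real.sinh_eq, Real.exp_neg]
  have := Real.exp_pos (r / 2)
  field_simp
  ring

theorem sqrt_one_add_sinh_sq (x : ℝ) : √(1 + Real.sinh x ^ 2) = Real.cosh x := by
  rw [add_comm, ← Real.cosh_sq, Real.sqrt_sq (Real.cosh_pos x).le]

theorem add_I_mul_ne_zero {c : ℝ} (hc : 0 < c) (v : ℝ) : (c : ℂ) + Complex.I * v ≠ 0 := by
  intro h
  have := congrArg Complex.re h
  simp at this
  linarith

theorem phaseCart_exp (r v : ℝ) : phaseCart (2 * Real.exp (r / 2) * v) (Real.exp r)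
    = ((Real.cosh (r / 2) : ℝ) - Complex.I * v) / ((Real.cosh (r / 2) : ℝ) + Complex.I * v) := by
  have h : Real.exp r + 1 = 2 * Real.exp (r / 2) * Real.cosh (r / 2) := by
    have h : Real.exp r = Real.exp (r / 2) ^ 2 := by
      rw [← Real.exp_nat_mul]
      congr 1
      push_cast
      ring
    rw [h, Real.cosh_eq, Real.exp_neg]
    have := Real.exp_pos (r / 2)
    field_simp
  have h0 := add_I_mul_ne_zero (Real.cosh_pos (r / 2)) v
  have he : (Real.exp (r / 2) : ℂ) ≠ 0 := by exact_mod_cast (Real.exp_pos (r / 2)).ne'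
  have hc : ((Real.exp r : ℝ) : ℂ) + 1 = 2 * (Real.exp (r / 2) : ℝ) * (Real.cosh (r / 2) : ℝ) := by
    exact_mod_cast h
  have hd := (cart_ne_zero (2 * Real.exp (r / 2) * v) (Real.exp_pos r)).2
  rw [phaseCart, div_eq_div_iff hd h0, hc]
  push_cast
  linear_combination (-4 * Complex.exp (r / 2) * Complex.cosh (r / 2) * v) * Complex.I_sq

/-- The Selberg transform factors as the Abel transform along horocycles followed by the Fourier
transform in r = log y. -/
theorem integral_radial_eq_abel (m : ℤ) {ψ : ℝ → ℝ} {δ : ℝ} (hδ0 : 0 ≤ δ)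
    (hc : ContinuousOn ψ (Set.Ici 0)) (hδ : ∀ u, δ < u → ψ u = 0) (t : ℂ) :
    ∫ z : ℍ, (ψ (uDist UpperHalfPlane.I z) : ℂ) * hFactor (2 * m) UpperHalfPlane.I z
        * (z.im : ℂ) ^ (1 / 2 + Complex.I * t)
      = 2 * ∫ r : ℝ, Complex.exp (Complex.I * t * r) * abel m ψ (Real.sinh (r / 2) ^ 2) := by
  rw [integral_radial_eq_boxIntegral m hδ0 hδ
    (fun z => (z.im : ℂ) ^ (1 / 2 + Complex.I * t))]
  set X := 3 + 4 * δ with hX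
  have hX0 : 0 < X := by positivity
  have hX1 : 1 / X ≤ X := by
    rw [div_le_iff₀ hX0]
    nlinarith
  set U : ℝ → ℝ → ℂ := fun x y =>
    (ψ (uCart x y) * phaseCart x y ^ m) * (y : ℂ) ^ (1 / 2 + Complex.I * t) / y ^ 2 with hU
  have e1 : boxIntegral X (1 / X) X (fun x y => (ψ (uCart x y) * phaseCart x y ^ m)
      * ((UpperHalfPlane.ofComplex (x + y * Complex.I)).im : ℂ) ^ (1 / 2 + Complex.I * t) / y ^ 2)
      = boxIntegral X (1 / X) X U := by
    refine setIntegral_congr_fun (measurableSet_Icc.prod measurableSet_Icc) fun p hp => ?_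
    have hy : 0 < p.2 := lt_of_lt_of_le (by positivity) hp.2.1
    have : (UpperHalfPlane.ofComplex (p.1 + p.2 * Complex.I)).im = p.2 := by
      rw [← UpperHalfPlane.coe_im, UpperHalfPlane.ofComplex_apply_of_im_pos (by simpa using hy)]
      simp
    simp only [this, hU]
  have hy0 : ∀ p ∈ upperSet, (0 : ℝ) < p.2 := fun p hp => hp
  have cU : ContUpper U := by
    refine ContinuousOn.div (ContinuousOn.mul (ContinuousOn.mul ?_ (contUpper_phaseCart m)) ?_)
      (by fun_prop) fun p hp => pow_ne_zero _ (by exact_mod_cast (hy0 p hp).ne')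
    · refine Complex.continuous_ofReal.comp_continuousOn (hc.comp continuousOn_uCart fun p hp => ?_)
      have := hy0 p hp
      change 0 ≤ uCart p.1 p.2
      rw [uCart]
      positivity
    · exact ContinuousOn.cpow (by fun_prop) continuousOn_const fun p hp =>
        Complex.ofReal_mem_slitPlane.2 (hy0 p hp)
  have zU : ∀ x y, 0 < y → (x ∉ Set.Icc (-(2 + 4 * δ)) (2 + 4 * δ)
      ∨ y ∉ Set.Icc (1 / (2 + 4 * δ)) (2 + 4 * δ)) → U x y = 0 := by
    intro x y hy hxy
    have : δ < uCart x y := by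
      by_contra h
      obtain ⟨h1, h2⟩ := uCart_le_imp hy hδ0 (not_lt.1 h)
      tauto
    simp only [hU, hδ _ this, Complex.ofReal_zero, zero_mul, zero_div]
  rw [e1, boxIntegral_eq_yx cU (by positivity) hX1 hX0.le]
  have e2 : ∀ y, 0 < y → ∫ x in (-X)..X, U x y = ∫ x, U x y := by
    intro y hy
    refine intervalIntegral.integral_eq_integral_of_support_subset fun x hx => ?_
    have : x ∈ Set.Icc (-(2 + 4 * δ)) (2 + 4 * δ) := by
      by_contra h
      exact hx (zU x y hy (Or.inl h))
    exact ⟨by linarith [this.1], by linarith [this.2]⟩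
  have e3 : ∫ y in (1 / X)..X, ∫ x in (-X)..X, U x y = ∫ y in Set.Ioi 0, ∫ x, U x y := by
    rw [intervalIntegral.integral_of_le hX1]
    have hsub : Set.Ioc (1 / X) X ⊆ Set.Ioi 0 := fun y hy => lt_trans (by positivity) hy.1
    rw [setIntegral_congr_fun measurableSet_Ioc fun y hy => e2 y (hsub hy)]
    refine (setIntegral_eq_of_subset_of_forall_sdiff_eq_zero measurableSet_Ioi hsub ?_).symm
    rintro y ⟨hy, hy'⟩
    have : ∀ x, U x y = 0 := fun x => zU x y hy (Or.inr fun h => hy' ⟨lt_of_lt_of_le ?_ h.1, by linarith [h.2]⟩)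
    · simp [this]
    · exact one_div_lt_one_div_of_lt (by positivity) (by linarith)
  rw [e3, integral_Ioi_eq_integral_exp, ← integral_const_mul]
  congr 1
  ext r
  have hE : 0 < 2 * Real.exp (r / 2) := by positivity
  -- The Jacobians e^r and 2e^(r/2), the factor e^(r/2) from y^(1/2+it) and the density e^(-2r)
  -- combine to the constant 2.
  have e4 : ∫ x, U x (Real.exp r)
      = (2 * Real.exp (r / 2) : ℝ) * ∫ v, U (2 * Real.exp (r / 2) * v) (Real.exp r) := by
    rw [Measure.integral_comp_mul_left (fun x => U x (Real.exp r)), abs_of_pos (by positivity),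
      Complex.real_smul, ← mul_assoc, ← Complex.ofReal_mul, mul_inv_cancel₀ hE.ne',
      Complex.ofReal_one, one_mul]
  rw [e4, abel, ← integral_const_mul, ← integral_const_mul, ← integral_const_mul, ← integral_const_mul]
  congr 1
  ext v
  simp only [hU, uCart_exp, phaseCart_exp, sqrt_one_add_sinh_sq]
  have h1 : ((Real.exp r : ℝ) : ℂ) ^ (1 / 2 + Complex.I * t)
      = (Real.exp (r / 2) : ℂ) * Complex.exp (Complex.I * t * r) := by
    rw [Complex.cpow_def_of_ne_zero (by exact_mod_cast (Real.exp_pos r).ne'), ← Complex.ofReal_log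
      (Real.exp_pos r).le, Real.log_exp, Complex.ofReal_exp, ← Complex.exp_add]
    congr 1
    push_cast
    ring
  have h2 : ((Real.exp r : ℝ) : ℂ) = (Real.exp (r / 2) : ℂ) ^ 2 := by
    rw [Complex.ofReal_exp, Complex.ofReal_exp, ← Complex.exp_nat_mul]
    congr 1
    push_cast
    ring
  have he : (Real.exp (r / 2) : ℂ) ≠ 0 := by exact_mod_cast (Real.exp_pos (r / 2)).ne'
  rw [h1, h2]
  push_cast
  field_simp

/-! ### Inversion of the Abel transform -/

theorem integral_unit_circle {F : ℂ → ℂ} (hF : DiffContOnCl ℂ F (Metric.ball 0 1)) :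
    ∫ α in (-Real.pi)..Real.pi, F (Complex.exp (-(Complex.I * α))) = 2 * Real.pi * F 0 := by
  have h := DiffContOnCl.circleAverage (f := F) (c := 0) (R := 1) (by simpa using hF)
  rw [Real.circleAverage_def] at h
  have h1 : ∫ α in (-Real.pi)..Real.pi, F (Complex.exp (-(Complex.I * α)))
      = ∫ α in (-Real.pi)..Real.pi, F (circleMap 0 1 α) := by
    have := intervalIntegral.integral_comp_neg (a := -Real.pi) (b := Real.pi)
      (fun α => F (circleMap 0 1 α))
    rw [neg_neg] at this
    rw [← this]
    simp [circleMap, mul_comm]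
  have h2 : ∫ α in (-Real.pi)..Real.pi, F (circleMap 0 1 α)
      = ∫ α in (0 : ℝ)..(2 * Real.pi), F (circleMap 0 1 α) := by
    have hp : Function.Periodic (fun α => F (circleMap 0 1 α)) (2 * Real.pi) :=
      (periodic_circleMap 0 1).comp F
    have := hp.intervalIntegral_add_eq (-Real.pi) 0
    rw [zero_add] at this
    rw [← this]
    congr 1
    ring
  rw [h1, h2, ← h, Complex.real_smul, ← mul_assoc]
  push_cast
  rw [mul_inv_cancel₀ (by simp), one_mul]

/-- The phase on a circle of radius R is the boundary value, at ζ = exp(-iα), of a Möbius function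
whose zero and pole lie outside the closed disc, since |R/(X+c)| < 1. -/
theorem phase_eq_mobius {c R X : ℝ} (hc : 0 < c) (hX0 : 0 < X) (hX : X ^ 2 = c ^ 2 + R ^ 2) (α : ℝ) :
    ((X : ℂ) - (R * Real.sin α : ℝ)) / (c + Complex.I * (R * Real.cos α : ℝ))
      = (1 - Complex.I * (R / (X + c) : ℝ) * Complex.exp (-(Complex.I * α)))
        / (1 + Complex.I * (R / (X + c) : ℝ) * Complex.exp (-(Complex.I * α))) := by
  have hs : (X : ℂ) + c ≠ 0 := by exact_mod_cast (by positivity : X + c ≠ 0)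
  have e : Complex.exp (-(Complex.I * α)) = Complex.cos α - Complex.I * Complex.sin α := by
    rw [show -(Complex.I * (α : ℂ)) = (-α : ℂ) * Complex.I by ring, Complex.exp_mul_I]
    simp
    ring
  have hn : ∀ a b : ℂ, (a - Complex.I * (R / (X + c) : ℝ) * b) = (a * (X + c) - Complex.I * R * b) / (X + c) := by
    intro a b
    push_cast
    field_simp
  have hn' : ∀ a b : ℂ, (a + Complex.I * (R / (X + c) : ℝ) * b) = (a * (X + c) + Complex.I * R * b) / (X + c) := by
    intro a b
    push_cast
    field_simp
  rw [e, hn, hn', div_div_div_cancel_right₀ hs]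
  have h1 := add_I_mul_ne_zero hc (R * Real.cos α)
  have h2 : (1 : ℂ) * (X + c) + Complex.I * R * (Complex.cos α - Complex.I * Complex.sin α) ≠ 0 := by
    intro h
    have h' := congrArg Complex.re h
    rw [← Complex.ofReal_cos, ← Complex.ofReal_sin] at h'
    simp only [one_mul, Complex.add_re, Complex.ofReal_re, Complex.mul_re, Complex.I_re, Complex.I_im, Complex.ofReal_im, Complex.sub_re, Complex.mul_im, Complex.sub_im, Complex.zero_re] at h'
    have hR : |R * Real.sin α| ≤ |R| := by
      rw [abs_mul]
      exact mul_le_of_le_one_right (abs_nonneg _) (Real.abs_sin_le_one α)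
    have : |R| < X := abs_lt_of_sq_lt_sq (by nlinarith) hX0.le
    have := neg_abs_le (R * Real.sin α)
    nlinarith
  rw [div_eq_div_iff h1 h2]
  have hXc : (X : ℂ) ^ 2 = c ^ 2 + R ^ 2 := by exact_mod_cast hX
  have hsc := Complex.sin_sq_add_cos_sq α
  push_cast
  linear_combination hXc - R ^ 2 * hsc + (- R ^ 2 * Complex.sin α * Complex.I * Complex.cos α + R ^ 2 * Complex.cos α ^2 - R * Complex.sin α * X -R * c * Complex.sin α
    + R ^ 2 * Complex.sin α ^ 2) * Complex.I_sq

/-- Every integer power of that Möbius function is holomorphic on the disc with value 1 at the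
centre, so the mean value property makes the integral independent of k. This is why inversion works
in all weights. -/
theorem integral_phase {c R : ℝ} (hc : 0 < c) (k : ℤ) :
    ∫ α in (-Real.pi)..Real.pi, (((√(c ^ 2 + R ^ 2) : ℝ) - (R * Real.sin α : ℝ))
      / (c + Complex.I * (R * Real.cos α : ℝ)) : ℂ) ^ k = 2 * Real.pi := by
  have hX0 : 0 < √(c ^ 2 + R ^ 2) := Real.sqrt_pos.2 (by positivity)
  have hX : √(c ^ 2 + R ^ 2) ^ 2 = c ^ 2 + R ^ 2 := Real.sq_sqrt (by positivity)
  set X := √(c ^ 2 + R ^ 2)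
  simp only [phase_eq_mobius hc hX0 hX]
  set p := R / (X + c) with hp
  have hp1 : |p| < 1 := by
    rw [hp, abs_div, abs_of_pos (by positivity : 0 < X + c), div_lt_one (by positivity)]
    have : |R| < X := abs_lt_of_sq_lt_sq (by nlinarith) hX0.le
    linarith
  have hne : ∀ ζ ∈ Metric.closedBall (0 : ℂ) 1, ∀ σ : ℂ, ‖σ‖ = 1 → 1 + σ * (p : ℂ) * ζ ≠ 0 := by
    intro ζ hζ σ hσ h
    have h1 : ‖σ * (p : ℂ) * ζ‖ = 1 := by
      rw [← norm_neg, show -(σ * (p : ℂ) * ζ) = 1 by linear_combination -h, norm_one]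
    rw [norm_mul, norm_mul, hσ, one_mul, Complex.norm_real, Real.norm_eq_abs] at h1
    have h2 : ‖ζ‖ ≤ 1 := by simpa using hζ
    nlinarith [abs_nonneg p, norm_nonneg ζ]
  have hn1 : ∀ ζ ∈ Metric.closedBall (0 : ℂ) 1, 1 - Complex.I * (p : ℂ) * ζ ≠ 0 := by
    intro ζ hζ
    have := hne ζ hζ (-Complex.I) (by simp)
    intro h
    exact this (by rw [← h]; ring)
  have hn2 : ∀ ζ ∈ Metric.closedBall (0 : ℂ) 1, 1 + Complex.I * (p : ℂ) * ζ ≠ 0 :=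
    fun ζ hζ => hne ζ hζ Complex.I (by simp)
  have hF : DiffContOnCl ℂ (fun ζ : ℂ =>
      ((1 - Complex.I * (p : ℂ) * ζ) / (1 + Complex.I * (p : ℂ) * ζ)) ^ k) (Metric.ball 0 1) := by
    apply DifferentiableOn.diffContOnCl
    rw [closure_ball 0 one_ne_zero]
    intro ζ hζ
    refine DifferentiableAt.differentiableWithinAt ?_
    have : DifferentiableAt ℂ (fun ζ : ℂ =>
      ((1 - Complex.I * (p : ℂ) * ζ) / (1 + Complex.I * (p : ℂ) * ζ))) ζ :=
      DifferentiableAt.div (by fun_prop) (by fun_prop) (hn2 ζ hζ)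
    exact this.zpow (Or.inl (div_ne_zero (hn1 ζ hζ) (hn2 ζ hζ)))
  rw [integral_unit_circle hF]
  simp

/-- The weight-`n` inverse Abel transform. -/
noncomputable def abelInv (n : ℤ) (p : ℝ → ℝ) (u : ℝ) : ℝ :=
  Real.pi⁻¹ * ∫ s : ℝ, p (u + s ^ 2) * ((√(1 + u + s ^ 2) - s) / √(1 + u)) ^ n

theorem sqrt_sub_pos {u : ℝ} (hu : 0 < 1 + u) (s : ℝ) : 0 < √(1 + u + s ^ 2) - s := by
  have : |s| < √(1 + u + s ^ 2) := by
    rw [← Real.sqrt_sq_eq_abs]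
    exact Real.sqrt_lt_sqrt (sq_nonneg s) (by linarith)
  linarith [le_abs_self s]

/-- The composition is a plane integral. In polar coordinates the angular integral of the phase is
2π by `integral_phase`, and the remaining radial integral of 2R p(w + R²) is q(w) by the fundamental
theorem of calculus. -/
theorem abel_abelInv {p q : ℝ → ℝ} {δ : ℝ} (hδ0 : 0 ≤ δ) (hp : Continuous p)
    (hq : ∀ x, HasDerivAt q (-p x) x) (hpδ : ∀ u, δ < u → p u = 0) (hqδ : ∀ u, δ < u → q u = 0)
    (m : ℤ) {w : ℝ} (hw : 0 ≤ w) : abel m (abelInv (2 * m) p) w = q w := by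
  have hw1 : 0 < 1 + w := by linarith
  set c := √(1 + w) with hc
  have hc0 : 0 < c := Real.sqrt_pos.2 hw1
  have hc2 : c ^ 2 = 1 + w := Real.sq_sqrt hw1.le
  set F : ℝ × ℝ → ℂ := fun x => (p (w + x.1 ^ 2 + x.2 ^ 2) : ℂ)
    * (((√(1 + w + x.1 ^ 2 + x.2 ^ 2) : ℝ) - x.2) / (c + Complex.I * x.1)) ^ (2 * m) with hF
  have hbase : ∀ x : ℝ × ℝ, ((((√(1 + w + x.1 ^ 2 + x.2 ^ 2) : ℝ) : ℂ) - x.2)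
      / (c + Complex.I * x.1)) ≠ 0 := fun x => by
    refine div_ne_zero ?_ (add_I_mul_ne_zero hc0 x.1)
    have := sqrt_sub_pos (u := w + x.1 ^ 2) (by positivity) x.2
    rw [← add_assoc] at this
    exact_mod_cast this.ne'
  have cF : Continuous F := by
    refine Continuous.mul (by fun_prop) (Continuous.zpow₀ ?_ _ fun x => Or.inl (hbase x))
    exact Continuous.div (by fun_prop) (by fun_prop) fun x => add_I_mul_ne_zero hc0 x.1
  have zF : ∀ x : ℝ × ℝ, δ < x.1 ^ 2 + x.2 ^ 2 → F x = 0 := by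
    intro x hx
    simp only [hF, hpδ _ (by linarith : δ < w + x.1 ^ 2 + x.2 ^ 2), Complex.ofReal_zero, zero_mul]
  have hbox : ∀ {y : ℝ}, y ∉ Set.Icc (-(1 + δ)) (1 + δ) → δ < y ^ 2 := by
    intro y hy
    rw [Set.mem_Icc, ← abs_le, not_le] at hy
    rw [← sq_abs]
    nlinarith
  have sF : HasCompactSupport F := by
    refine HasCompactSupport.intro (isCompact_Icc.prod isCompact_Icc :
      IsCompact (Set.Icc (-(1 + δ)) (1 + δ) ×ˢ Set.Icc (-(1 + δ)) (1 + δ))) fun x hx => zF x ?_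
    rw [Set.mem_prod, not_and_or] at hx
    rcases hx with h | h
    · nlinarith [hbox h]
    · nlinarith [hbox h]
  have iF : Integrable F (volume : Measure (ℝ × ℝ)) := cF.integrable_of_hasCompactSupport sF
  have e1 : abel m (abelInv (2 * m) p) w = Real.pi⁻¹ * ∫ x, F x := by
    rw [Measure.volume_eq_prod, integral_prod _ iF, ← integral_const_mul, abel]
    congr 1
    ext v
    rw [abelInv]
    push_cast
    rw [← integral_complex_ofReal, mul_assoc, ← integral_mul_const]
    congr 2
    ext s
    simp only [hF]
    have hd := add_I_mul_ne_zero hc0 v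
    have hd' : (c : ℂ) - Complex.I * v ≠ 0 := by
      have := add_I_mul_ne_zero hc0 (-v)
      push_cast at this
      rwa [mul_neg, ← sub_eq_add_neg] at this
    -- Factoring 1 + w + v² as (c + iv)(c - iv) merges the phases of the two transforms into the
    -- square of a single quotient.
    have hsq : ((√(1 + (w + v ^ 2)) : ℝ) : ℂ) ^ 2 = (c + Complex.I * v) * (c - Complex.I * v) := by
      rw [← Complex.ofReal_pow, Real.sq_sqrt (by positivity)]
      have : (c : ℂ) ^ 2 = 1 + w := by exact_mod_cast hc2
      push_cast
      linear_combination (-1 : ℂ) * this + (v : ℂ) ^ 2 * Complex.I_sq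
    push_cast
    rw [mul_assoc, zpow_mul _ 2 m, zpow_mul _ 2 m, ← mul_zpow]
    congr 2
    rw [← hc, zpow_ofNat, zpow_ofNat, div_pow, hsq, div_pow, ← add_assoc (1 : ℝ) w]
    field_simp
  have e2 : ∫ x, F x = ∫ R in Set.Ioi (0 : ℝ), ((2 * R * p (w + R ^ 2) : ℝ) : ℂ) * Real.pi := by
    rw [← integral_comp_polarCoord_symm, polarCoord_target, Measure.volume_eq_prod]
    rw [setIntegral_prod]
    · refine setIntegral_congr_fun measurableSet_Ioi fun R hR => ?_
      simp only [polarCoord_symm_apply, hF]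
      have hs : ∀ α, (R * Real.cos α) ^ 2 + (R * Real.sin α) ^ 2 = R ^ 2 := fun α => by
        linear_combination R ^ 2 * Real.sin_sq_add_cos_sq α
      simp only [add_assoc, hs]
      simp only [← add_assoc]
      rw [← integral_Ioc_eq_integral_Ioo, ← intervalIntegral.integral_of_le (by linarith [Real.pi_pos]),
        intervalIntegral.integral_smul, intervalIntegral.integral_const_mul, ← hc2,
        integral_phase hc0, Complex.real_smul]
      push_cast
      ring
    · have hcont : Continuous fun x : ℝ × ℝ => x.1 • F (polarCoord.symm x) := by
        simp only [polarCoord_symm_apply]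
        fun_prop
      have hK : IntegrableOn (fun x : ℝ × ℝ => x.1 • F (polarCoord.symm x))
          (Set.Icc 0 (1 + δ) ×ˢ Set.Icc (-Real.pi) Real.pi) (volume.prod volume) :=
        hcont.continuousOn.integrableOn_compact (isCompact_Icc.prod isCompact_Icc)
      refine (hK.of_forall_sdiff_eq_zero (measurableSet_Ioi.prod measurableSet_Ioo) ?_)
      rintro ⟨R, α⟩ ⟨⟨h1, h2⟩, h3⟩
      simp only [polarCoord_symm_apply]
      have hR : R ∉ Set.Icc (-(1 + δ)) (1 + δ) := fun h =>
        h3 ⟨⟨le_of_lt h1, h.2⟩, ⟨h2.1.le, h2.2.le⟩⟩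
      rw [zF, smul_zero]
      have := hbox hR
      dsimp only
      linarith [show (R * Real.cos α) ^ 2 + (R * Real.sin α) ^ 2 = R ^ 2 by
        linear_combination R ^ 2 * Real.sin_sq_add_cos_sq α]
  have e3 : ∫ R in Set.Ioi (0 : ℝ), 2 * R * p (w + R ^ 2) = q w := by
    have hd : ∀ R ∈ Set.Ici (0 : ℝ), HasDerivAt (fun R => - q (w + R ^ 2)) (2 * R * p (w + R ^ 2)) R := by
      intro R _
      have h1 : HasDerivAt (fun R : ℝ => w + R ^ 2) (2 * R) R := by
        simpa using ((hasDerivAt_id R).pow 2).const_add w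
      have := ((hq _).comp R h1).neg
      exact this.congr_deriv (by ring)
    have hint : IntegrableOn (fun R => 2 * R * p (w + R ^ 2)) (Set.Ioi 0) := by
      refine Integrable.integrableOn (Continuous.integrable_of_hasCompactSupport (by fun_prop)
        (HasCompactSupport.intro (isCompact_Icc : IsCompact (Set.Icc (-(1 + δ)) (1 + δ))) fun R hR => ?_))
      have := hbox hR
      rw [hpδ _ (by linarith), mul_zero]
    have ht : Filter.Tendsto (fun R => - q (w + R ^ 2)) Filter.atTop (nhds 0) := by
      refine tendsto_const_nhds.congr' ?_
      filter_upwards [Filter.eventually_gt_atTop (1 + δ)] with R hR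
      rw [hqδ, neg_zero]
      nlinarith
    rw [integral_Ioi_of_hasDerivAt_of_tendsto' hd hint ht]
    simp
  rw [e1, e2, integral_mul_const, integral_complex_ofReal, e3]
  have : (Real.pi : ℂ) ≠ 0 := by exact_mod_cast Real.pi_ne_zero
  push_cast
  field_simp

/-! ### Parameter integrals and even functions of r as functions of sinh²(r/2) -/

theorem hasDerivAt_integral_param {F F' : ℝ × ℝ → ℝ} {U : Set ℝ} (hU : IsOpen U) (a b : ℝ)
    (hF : ContinuousOn F (U ×ˢ Set.univ)) (hF' : ContinuousOn F' (U ×ˢ Set.univ))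
    (hd : ∀ x ∈ U, ∀ s, HasDerivAt (fun x => F (x, s)) (F' (x, s)) x) {x : ℝ} (hx : x ∈ U) :
    HasDerivAt (fun x => ∫ s in a..b, F (x, s)) (∫ s in a..b, F' (x, s)) x := by
  obtain ⟨ε, hε, hball⟩ := Metric.nhds_basis_closedBall.mem_iff.1 (hU.mem_nhds hx)
  have hslice : ∀ {G : ℝ × ℝ → ℝ}, ContinuousOn G (U ×ˢ Set.univ) → ∀ y ∈ U,
      Continuous fun s => G (y, s) := fun hG y hy =>
    continuousOn_univ.1 (hG.comp (by fun_prop) fun s _ => ⟨hy, trivial⟩)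
  have hK : IsCompact (Metric.closedBall x ε ×ˢ Set.uIcc a b) :=
    (isCompact_closedBall x ε).prod isCompact_uIcc
  obtain ⟨C, hC⟩ := hK.exists_bound_of_continuousOn
    (hF'.mono (Set.prod_mono hball (Set.subset_univ _)))
  refine (intervalIntegral.hasDerivAt_integral_of_dominated_loc_of_deriv_le (μ := volume)
    (F := fun x s => F (x, s)) (F' := fun x s => F' (x, s))
    (bound := fun _ => C) (Metric.closedBall_mem_nhds x hε) ?_ ?_ ?_ ?_ ?_ ?_).2
  · filter_upwards [Metric.closedBall_mem_nhds x hε] with y hy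
    exact (hslice hF y (hball hy)).aestronglyMeasurable
  · exact (hslice hF x hx).intervalIntegrable _ _
  · exact (hslice hF' x hx).aestronglyMeasurable
  · exact Filter.Eventually.of_forall fun s hs y hy => hC (y, s) ⟨hy, Set.uIoc_subset_uIcc hs⟩
  · exact intervalIntegrable_const
  · exact Filter.Eventually.of_forall fun s _ y hy => hd y (hball hy) s

theorem continuousOn_integral_param {F : ℝ × ℝ → ℝ} {U : Set ℝ} (hU : IsOpen U) (a b : ℝ)
    (hF : ContinuousOn F (U ×ˢ Set.univ)) :
    ContinuousOn (fun x => ∫ s in a..b, F (x, s)) U := by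
  intro x hx
  obtain ⟨ε, hε, hball⟩ := Metric.nhds_basis_closedBall.mem_iff.1 (hU.mem_nhds hx)
  have hK : IsCompact (Metric.closedBall x ε ×ˢ Set.uIcc a b) :=
    (isCompact_closedBall x ε).prod isCompact_uIcc
  obtain ⟨C, hC⟩ := hK.exists_bound_of_continuousOn
    (hF.mono (Set.prod_mono hball (Set.subset_univ _)))
  refine (intervalIntegral.continuousAt_of_dominated_interval (bound := fun _ => C)
    ?_ ?_ intervalIntegrable_const ?_).continuousWithinAt
  · filter_upwards [Metric.closedBall_mem_nhds x hε] with y hy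
    exact (continuousOn_univ.1 (hF.comp (f := fun s : ℝ => (y, s)) (by fun_prop) fun s _ =>
      ⟨hball hy, trivial⟩)).aestronglyMeasurable
  · filter_upwards [Metric.closedBall_mem_nhds x hε] with y hy
    exact Filter.Eventually.of_forall fun s hs => hC (y, s) ⟨hy, Set.uIoc_subset_uIcc hs⟩
  · refine Filter.Eventually.of_forall fun s _ => ?_
    have h1 : ContinuousAt F (x, s) := hF.continuousAt
      ((hU.prod isOpen_univ).mem_nhds ⟨hx, trivial⟩)
    exact h1.comp (f := fun y : ℝ => (y, s)) (by fun_prop)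

theorem contDiffOn_integral_param {U : Set ℝ} (hU : IsOpen U) (a b : ℝ) (k : ℕ) :
    ∀ {F : ℝ × ℝ → ℝ}, ContDiffOn ℝ k F (U ×ˢ Set.univ) →
      ContDiffOn ℝ k (fun x => ∫ s in a..b, F (x, s)) U := by
  have hUo : IsOpen (U ×ˢ (Set.univ : Set ℝ)) := hU.prod isOpen_univ
  induction k with
  | zero =>
    intro F hF
    rw [Nat.cast_zero, contDiffOn_zero] at hF ⊢
    exact continuousOn_integral_param hU a b hF
  | succ k ih =>
    intro F hF
    rw [Nat.cast_succ] at hF ⊢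
    rw [contDiffOn_succ_iff_fderiv_of_isOpen hUo] at hF
    have hF' : ContDiffOn ℝ k (fun p => fderiv ℝ F p (1, 0)) (U ×ˢ Set.univ) :=
      hF.2.2.clm_apply contDiffOn_const
    have hd : ∀ x ∈ U, ∀ s, HasDerivAt (fun x => F (x, s)) (fderiv ℝ F (x, s) (1, 0)) x := by
      intro x hx s
      have h1 := ((hF.1 (x, s) ⟨hx, trivial⟩).differentiableAt
        (hUo.mem_nhds ⟨hx, trivial⟩)).hasFDerivAt
      exact h1.comp_hasDerivAt x ((hasDerivAt_id x).prodMk (hasDerivAt_const x s))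
    have hI := fun x hx => hasDerivAt_integral_param hU a b hF.1.continuousOn hF'.continuousOn hd
      (x := x) hx
    rw [contDiffOn_succ_iff_deriv_of_isOpen hU]
    refine ⟨fun x hx => (hI x hx).differentiableAt.differentiableWithinAt, by simp, ?_⟩
    exact (ih hF').congr fun x hx => (hI x hx).deriv

theorem contDiff_integral_param (a b : ℝ) (k : ℕ) {F : ℝ × ℝ → ℝ} (hF : ContDiff ℝ k F) :
    ContDiff ℝ k (fun x => ∫ s in a..b, F (x, s)) :=
  contDiffOn_univ.1 (contDiffOn_integral_param isOpen_univ a b k hF.contDiffOn)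

/-- Hadamard's form of the quotient (h(x) - h(0))/x, which stays regular at x = 0. -/
theorem mul_integral_deriv {h h' : ℝ → ℝ} (hd : ∀ x, HasDerivAt h (h' x) x) (hc : Continuous h')
    (x : ℝ) : x * ∫ s in (0 : ℝ)..1, h' (x * s) = h x - h 0 := by
  rw [← intervalIntegral.integral_const_mul]
  have := intervalIntegral.integral_eq_sub_of_hasDerivAt (a := 0) (b := 1)
    (f := fun s => h (x * s)) (f' := fun s => x * h' (x * s)) (fun s _ => ?_)
    (Continuous.intervalIntegrable (by fun_prop) _ _)
  · simpa using this
  · have h1 : HasDerivAt (fun s : ℝ => x * s) x s := by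
      simpa using (hasDerivAt_id s).const_mul x
    exact ((hd _).comp s h1).congr_deriv (mul_comm _ _)

theorem deriv_even_neg {g : ℝ → ℝ} (he : ∀ r, g (-r) = g r) (r : ℝ) : deriv g (-r) = -deriv g r := by
  have h1 := deriv_comp_neg g r
  have h2 : (fun x => g (-x)) = g := funext he
  rw [h2] at h1
  linarith

theorem deriv_odd_neg {g : ℝ → ℝ} (he : ∀ r, g (-r) = -g r) (r : ℝ) : deriv g (-r) = deriv g r := by
  have h1 := deriv_comp_neg g r
  have h2 : (fun x => g (-x)) = fun x => -g x := funext he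
  rw [h2, deriv.fun_neg] at h1
  linarith

theorem hasDerivAt_sinh_half_sq (r : ℝ) :
    HasDerivAt (fun r => Real.sinh (r / 2) ^ 2) (Real.sinh r / 2) r := by
  have h1 : HasDerivAt (fun r : ℝ => Real.sinh (r / 2)) (Real.cosh (r / 2) * (1 / 2)) r :=
    ((hasDerivAt_id r).div_const 2).sinh
  refine (h1.pow 2).congr_deriv ?_
  have : Real.sinh r = 2 * Real.sinh (r / 2) * Real.cosh (r / 2) := by
    rw [← Real.sinh_two_mul]
    congr 1
    ring
  rw [this]
  norm_num
  ring

/-- A `C^(2k)` even function of `r` is a `C^k` function of `sinh² (r/2)`. -/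
theorem exists_contDiff_sinh_half_sq (k : ℕ) : ∀ {g : ℝ → ℝ}, ContDiff ℝ (2 * k : ℕ) g →
    (∀ r, g (-r) = g r) →
    ∃ q : ℝ → ℝ, ContDiff ℝ k q ∧ ∀ r, q (Real.sinh (r / 2) ^ 2) = g r := by
  induction k with
  | zero =>
    intro g hg he
    rw [Nat.mul_zero, Nat.cast_zero, contDiff_zero] at hg
    -- Since `√w` is 0 for negative w, the same formula extends q continuously to the whole line.
    refine ⟨fun w => g (2 * Real.arsinh (√w)), ?_, fun r => ?_⟩
    · rw [Nat.cast_zero, contDiff_zero]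
      have := Real.continuous_arsinh
      fun_prop
    · simp only [Real.sqrt_sq_eq_abs]
      rcases abs_cases (Real.sinh (r / 2)) with ⟨h, _⟩ | ⟨h, _⟩
      · rw [h, Real.arsinh_sinh]
        congr 1
        ring
      · rw [h, Real.arsinh_neg, Real.arsinh_sinh, ← he]
        congr 1
        ring
  | succ k ih =>
    intro g hg he
    have h2 : ((2 * (k + 1) : ℕ) : ℕ∞ω) = ((2 * k : ℕ) : ℕ∞ω) + 1 + 1 := by
      push_cast
      ring
    rw [h2, contDiff_succ_iff_deriv] at hg
    obtain ⟨hg0, -, hg1⟩ := hg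
    rw [contDiff_succ_iff_deriv] at hg1
    obtain ⟨hg1, -, hg2⟩ := hg1
    have o1 := deriv_even_neg he
    have e2 := deriv_odd_neg o1
    have d0 : deriv g 0 = 0 := by
      have := o1 0
      rw [neg_zero] at this
      linarith
    -- The derivative of q is 2g'(r)/sinh r = 2G/S, where G = g'(r)/r and S = sinh(r)/r; it is again
    -- even, and two derivatives of g have been spent for one of q.
    set G : ℝ → ℝ := fun r => ∫ s in (0 : ℝ)..1, deriv (deriv g) (r * s) with hG
    set S : ℝ → ℝ := fun r => ∫ s in (0 : ℝ)..1, Real.cosh (r * s) with hS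
    have hGr : ∀ r, r * G r = deriv g r := fun r => by
      rw [hG, mul_integral_deriv (fun x => (hg1 x).hasDerivAt) hg2.continuous, d0, sub_zero]
    have hSr : ∀ r, r * S r = Real.sinh r := fun r => by
      rw [hS, mul_integral_deriv Real.hasDerivAt_sinh Real.continuous_cosh, Real.sinh_zero, sub_zero]
    have hS0 : ∀ r, 0 < S r := fun r => by
      refine intervalIntegral.intervalIntegral_pos_of_pos
        (Continuous.intervalIntegrable (by fun_prop) _ _) (fun s => Real.cosh_pos _) one_pos
    have cG : ContDiff ℝ (2 * k : ℕ) G :=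
      contDiff_integral_param 0 1 (2 * k) (F := fun p => deriv (deriv g) (p.1 * p.2))
        (hg2.comp (contDiff_fst.mul contDiff_snd))
    have cS : ContDiff ℝ (2 * k : ℕ) S :=
      contDiff_integral_param 0 1 (2 * k) (F := fun p => Real.cosh (p.1 * p.2))
        (Real.contDiff_cosh.comp (contDiff_fst.mul contDiff_snd))
    obtain ⟨q₁, hq₁, hq₁g⟩ := ih (g := fun r => 2 * (G r / S r))
      (contDiff_const.mul (cG.div cS fun r => (hS0 r).ne')) fun r => by
        simp only [hG, hS, neg_mul, e2, Real.cosh_neg]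
    have hq : ∀ w, HasDerivAt (fun w => g 0 + ∫ x in (0 : ℝ)..w, q₁ x) (q₁ w) w := fun w =>
      (intervalIntegral.integral_hasDerivAt_right (hq₁.continuous.intervalIntegrable _ _)
        (hq₁.continuous.stronglyMeasurableAtFilter _ _) hq₁.continuous.continuousAt).const_add _
    refine ⟨fun w => g 0 + ∫ x in (0 : ℝ)..w, q₁ x, ?_, fun r => ?_⟩
    · rw [Nat.cast_succ, contDiff_succ_iff_deriv]
      refine ⟨fun w => (hq w).differentiableAt, by simp, ?_⟩
      rwa [funext fun w => (hq w).deriv]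
    · have hd : ∀ x, HasDerivAt (fun x => (g 0 + ∫ x in (0 : ℝ)..(Real.sinh (x / 2) ^ 2), q₁ x) - g x)
          0 x := by
        intro x
        refine (((hq _).comp x (hasDerivAt_sinh_half_sq x)).sub (hg0 x).hasDerivAt).congr_deriv ?_
        rw [hq₁g, ← hGr, ← hSr]
        have := (hS0 x).ne'
        field_simp
        ring
      have := is_const_of_deriv_eq_zero (fun x => (hd x).differentiableAt) (fun x => (hd x).deriv) r 0
      simp at this
      simp only
      linarith

theorem sinh_half_sq_two_mul_arsinh {w : ℝ} (hw : 0 ≤ w) :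
    Real.sinh (2 * Real.arsinh (√w) / 2) ^ 2 = w := by
  rw [mul_div_cancel_left₀ _ two_ne_zero, Real.sinh_arsinh, Real.sq_sqrt hw]

theorem lt_two_mul_arsinh {w R : ℝ} (hw : Real.sinh (R / 2) ^ 2 < w) :
    R < 2 * Real.arsinh (√w) := by
  have h1 : Real.sinh (R / 2) < √w :=
    Real.lt_sqrt_of_sq_lt hw
  have := Real.arsinh_lt_arsinh.2 h1
  rw [Real.arsinh_sinh] at this
  linarith

/-- The density `p = -dq/dw` of an even function `g(r) = q (sinh² (r/2))`. -/
theorem exists_abel_density {g : ℝ → ℝ} {R M : ℝ} (hg : ContDiff ℝ 6 g)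
    (he : ∀ r, g (-r) = g r) (hs : ∀ r, R < |r| → g r = 0)
    (hd : ∀ r, 0 ≤ r → deriv g r ≤ 0) (hM : ∀ r, 0 ≤ r → -(M * r) ≤ deriv g r) :
    ∃ p q : ℝ → ℝ, ContDiff ℝ 2 p ∧ (∀ w, HasDerivAt q (-p w) w) ∧
      (∀ r, q (Real.sinh (r / 2) ^ 2) = g r) ∧
      (∀ w, Real.sinh (R / 2) ^ 2 < w → p w = 0) ∧ (∀ w, Real.sinh (R / 2) ^ 2 < w → q w = 0) ∧
      (∀ w, 0 ≤ w → 0 ≤ p w ∧ p w ≤ 2 * M) ∧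
      (∀ r, p (Real.sinh (r / 2) ^ 2) * Real.sinh r = -(2 * deriv g r)) := by
  -- Six derivatives of g give three of q, hence the two of p that make the final radial functions
  -- C².
  obtain ⟨q, hq, hqg⟩ := exists_contDiff_sinh_half_sq 3 (g := g) (by exact_mod_cast hg) he
  rw [show ((3 : ℕ) : ℕ∞ω) = 2 + 1 by norm_num, contDiff_succ_iff_deriv] at hq
  obtain ⟨hq1, -, hq2⟩ := hq
  have hqd : ∀ w, HasDerivAt q (- -deriv q w) w := fun w => by
    rw [neg_neg]
    exact (hq1 w).hasDerivAt
  have hrel : ∀ r, -deriv q (Real.sinh (r / 2) ^ 2) * Real.sinh r = -(2 * deriv g r) := by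
    intro r
    have h1 := (hqd (Real.sinh (r / 2) ^ 2)).comp r (hasDerivAt_sinh_half_sq r)
    have h2 : q ∘ (fun r => Real.sinh (r / 2) ^ 2) = g := funext hqg
    rw [h2] at h1
    rw [h1.deriv]
    ring
  have hq0 : ∀ w, Real.sinh (R / 2) ^ 2 < w → q w = 0 := by
    intro w hw
    have hw0 : 0 ≤ w := (sq_nonneg _).trans hw.le
    rw [← sinh_half_sq_two_mul_arsinh hw0, hqg]
    exact hs _ ((lt_two_mul_arsinh hw).trans_le (le_abs_self _))
  refine ⟨fun w => -deriv q w, q, hq2.neg, hqd, hqg, fun w hw => ?_, hq0, ?_, hrel⟩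
  · have : q =ᶠ[nhds w] fun _ => 0 := by
      filter_upwards [lt_mem_nhds hw] with x hx using hq0 x hx
    simp only [this.deriv_eq, deriv_const, neg_zero]
  · have hcl : IsClosed {w | 0 ≤ -deriv q w ∧ -deriv q w ≤ 2 * M} := by
      have := hq2.continuous
      exact (isClosed_le continuous_const this.neg).inter (isClosed_le this.neg continuous_const)
    have hsub : Set.Ioi (0 : ℝ) ⊆ {w | 0 ≤ -deriv q w ∧ -deriv q w ≤ 2 * M} := by
      intro w hw
      set r := 2 * Real.arsinh (√w) with hr
      have hw' : Real.sinh (r / 2) ^ 2 = w := sinh_half_sq_two_mul_arsinh (le_of_lt hw)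
      have hr0 : 0 < r := by
        have := Real.arsinh_pos_iff.2 (Real.sqrt_pos.2 hw)
        positivity
      have h1 := hrel r
      rw [hw'] at h1
      have h2 := hd r hr0.le
      have h3 := hM r hr0.le
      have h4 : r ≤ Real.sinh r := Real.self_le_sinh_iff.2 hr0.le
      have h5 : 0 < Real.sinh r := hr0.trans_le h4
      have h6 : 0 ≤ -deriv q w := by
        by_contra h
        nlinarith
      refine ⟨h6, ?_⟩
      by_contra h
      push Not at h
      have hM0 : 0 ≤ M := by
        by_contra hM0
        nlinarith
      nlinarith [mul_le_mul_of_nonneg_left h4 hM0]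
    have := hcl.closure_subset_iff.2 hsub
    rw [closure_Ioi] at this
    exact fun w hw => this hw

/-! ### A test function with positive cosine transform -/

section

/-- Symmetric decreasing integrable functions supported in `[-R, R]`. -/
structure IsSymmDecreasing (f : ℝ → ℝ) (R : ℝ) : Prop where
  anti : ∀ x y, |x| ≤ |y| → f y ≤ f x
  support : ∀ x, R < |x| → f x = 0
  integrable : Integrable f

variable {f : ℝ → ℝ} {R : ℝ}

theorem IsSymmDecreasing.even (h : IsSymmDecreasing f R) (x : ℝ) : f (-x) = f x :=
  le_antisymm (h.anti _ _ (abs_neg x).ge) (h.anti _ _ (abs_neg x).le)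

theorem IsSymmDecreasing.nonneg (h : IsSymmDecreasing f R) (x : ℝ) : 0 ≤ f x := by
  have h1 : f (|x| + |R| + 1) = 0 := h.support _ (by
    rw [abs_of_nonneg (by positivity)]
    linarith [le_abs_self R, abs_nonneg x])
  rw [← h1]
  refine h.anti _ _ ?_
  rw [abs_of_nonneg (by positivity : 0 ≤ |x| + |R| + 1)]
  linarith [abs_nonneg R]

theorem IsSymmDecreasing.le_zero (h : IsSymmDecreasing f R) (x : ℝ) : f x ≤ f 0 :=
  h.anti _ _ (by simp)

theorem IsSymmDecreasing.hasCompactSupport (h : IsSymmDecreasing f R) : HasCompactSupport f :=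
  HasCompactSupport.intro (isCompact_Icc : IsCompact (Set.Icc (-R) R)) fun x hx => h.support x (by
    rw [Set.mem_Icc, ← abs_le, not_le] at hx
    exact hx)

/-- The cosine transform. -/
noncomputable def cosTransform (f : ℝ → ℝ) (t : ℝ) : ℝ := ∫ x, f x * Real.cos (t * x)

theorem IsSymmDecreasing.integral_mul_sin (h : IsSymmDecreasing f R) (t : ℝ) :
    ∫ x, f x * Real.sin (t * x) = 0 := by
  have h1 := integral_neg_eq_self (fun x => f x * Real.sin (t * x)) volume
  simp only [h.even, mul_neg, Real.sin_neg, integral_neg] at h1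
  linarith

theorem integrable_mul_cos (hf : Integrable f) (t : ℝ) : Integrable fun x => f x * Real.cos (t * x) :=
  hf.mul_bdd (c := 1) (Continuous.aestronglyMeasurable (by fun_prop))
    (Filter.Eventually.of_forall fun x => Real.abs_cos_le_one _)

theorem integrable_mul_sin (hf : Integrable f) (t : ℝ) : Integrable fun x => f x * Real.sin (t * x) :=
  hf.mul_bdd (c := 1) (Continuous.aestronglyMeasurable (by fun_prop))
    (Filter.Eventually.of_forall fun x => Real.abs_sin_le_one _)

/-- Convolution with the indicator function of `[-1, 1]`. -/
noncomputable def boxAverage (f : ℝ → ℝ) (r : ℝ) : ℝ := ∫ x in (r - 1)..(r + 1), f x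

theorem boxAverage_eq (f : ℝ → ℝ) (r : ℝ) : boxAverage f r = ∫ s in (-1 : ℝ)..1, f (r - s) := by
  rw [intervalIntegral.integral_comp_sub_left, sub_neg_eq_add, boxAverage]

theorem continuous_boxAverage (hf : Integrable f) : Continuous (boxAverage f) := by
  have h : boxAverage f = fun r => (∫ x in (0 : ℝ)..(r + 1), f x) - ∫ x in (0 : ℝ)..(r - 1), f x := by
    ext r
    rw [boxAverage, intervalIntegral.integral_interval_sub_left] <;>
      exact hf.intervalIntegrable
  rw [h]
  have := intervalIntegral.continuous_primitive (fun a b => hf.intervalIntegrable (a := a) (b := b)) 0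
  exact (this.comp (by fun_prop)).sub (this.comp (by fun_prop))

theorem hasDerivAt_boxAverage (hf : Continuous f) (r : ℝ) :
    HasDerivAt (boxAverage f) (f (r + 1) - f (r - 1)) r := by
  have h : boxAverage f = fun r => (∫ x in (0 : ℝ)..(r + 1), f x) - ∫ x in (0 : ℝ)..(r - 1), f x := by
    ext r
    rw [boxAverage, intervalIntegral.integral_interval_sub_left] <;>
      exact hf.intervalIntegrable _ _
  rw [h]
  have hp : ∀ w, HasDerivAt (fun w => ∫ x in (0 : ℝ)..w, f x) (f w) w := fun w =>
    intervalIntegral.integral_hasDerivAt_right (hf.intervalIntegrable _ _)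
        (hf.stronglyMeasurableAtFilter _ _) hf.continuousAt
  exact ((hp _).comp_add_const r 1).sub ((hp _).comp_sub_const r 1)

theorem contDiff_boxAverage {k : ℕ} (hf : ContDiff ℝ k f) : ContDiff ℝ (k + 1 : ℕ) (boxAverage f) := by
  rw [Nat.cast_succ, contDiff_succ_iff_deriv]
  refine ⟨fun r => (hasDerivAt_boxAverage hf.continuous r).differentiableAt, by simp, ?_⟩
  rw [funext fun r => (hasDerivAt_boxAverage hf.continuous r).deriv]
  fun_prop

theorem IsSymmDecreasing.boxAverage (h : IsSymmDecreasing f R) :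
    IsSymmDecreasing (boxAverage f) (R + 1) := by
  have heven : ∀ r, SL2Kernel.boxAverage f (-r) = SL2Kernel.boxAverage f r := by
    intro r
    rw [SL2Kernel.boxAverage, SL2Kernel.boxAverage]
    have := intervalIntegral.integral_comp_neg (a := r - 1) (b := r + 1) f
    simp only [h.even] at this
    rw [this]
    congr 1 <;> ring
  have habs : ∀ r, SL2Kernel.boxAverage f |r| = SL2Kernel.boxAverage f r := by
    intro r
    rcases abs_choice r with h | h
    · rw [h]
    · rw [h, heven]
  have hint : ∀ a b, IntervalIntegrable f volume a b := fun a b => h.integrable.intervalIntegrable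
  have hmono : ∀ x y, 0 ≤ x → x ≤ y → SL2Kernel.boxAverage f y ≤ SL2Kernel.boxAverage f x := by
    intro x y hx hxy
    -- The difference is an integral over [x, y] of f(s-1) - f(s+1), nonnegative since |s-1| ≤ s+1
    -- for s ≥ 0.
    have e : SL2Kernel.boxAverage f x - SL2Kernel.boxAverage f y
        = ∫ s in x..y, (f (s - 1) - f (s + 1)) := by
      rw [intervalIntegral.integral_sub ((h.integrable.comp_sub_right 1).intervalIntegrable)
        ((h.integrable.comp_add_right 1).intervalIntegrable),
        intervalIntegral.integral_comp_sub_right, intervalIntegral.integral_comp_add_right]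
      rw [SL2Kernel.boxAverage, SL2Kernel.boxAverage]
      have h1 := intervalIntegral.integral_add_adjacent_intervals (hint (x - 1) (x + 1)) (hint (x + 1) (y + 1))
      have h2 := intervalIntegral.integral_add_adjacent_intervals (hint (x - 1) (y - 1)) (hint (y - 1) (y + 1))
      linarith
    have : 0 ≤ ∫ s in x..y, (f (s - 1) - f (s + 1)) := by
      refine intervalIntegral.integral_nonneg hxy fun s hs => sub_nonneg.2 (h.anti _ _ ?_)
      rw [abs_of_nonneg (by linarith [hs.1] : 0 ≤ s + 1), abs_le]
      constructor <;> linarith [hs.1]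
    linarith
  have hsupp : ∀ x, R + 1 < |x| → SL2Kernel.boxAverage f x = 0 := by
    intro x hx
    rw [← habs, SL2Kernel.boxAverage]
    refine (intervalIntegral.integral_congr (g := fun _ => 0) fun s hs => ?_).trans (by simp)
    rw [Set.uIcc_of_le (by linarith)] at hs
    exact h.support s (lt_of_lt_of_le (by linarith [hs.1]) (le_abs_self s))
  refine ⟨fun x y hxy => ?_, hsupp, ?_⟩
  · rw [← habs x, ← habs y]
    exact hmono _ _ (abs_nonneg x) hxy
  · refine (continuous_boxAverage h.integrable).integrable_of_hasCompactSupport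
      (HasCompactSupport.intro (isCompact_Icc : IsCompact (Set.Icc (-(R + 1)) (R + 1)))
      fun x hx => hsupp x ?_)
    rw [Set.mem_Icc, ← abs_le, not_le] at hx
    exact hx

/-- The convolution theorem in real form: the sine term in the addition formula integrates to zero
because f is even. -/
theorem IsSymmDecreasing.cosTransform_boxAverage (h : IsSymmDecreasing f R) (t : ℝ) :
    cosTransform (SL2Kernel.boxAverage f) t
      = (∫ s in (-1 : ℝ)..1, Real.cos (t * s)) * cosTransform f t := by
  have hI : Integrable ((Set.Ioc (-1 : ℝ) 1).indicator fun _ => (1 : ℝ)) :=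
    (integrable_indicator_iff measurableSet_Ioc).2 (integrable_const _)
  have h1 := (hI.convolution_integrand (ContinuousLinearMap.mul ℝ ℝ) h.integrable).mul_bdd
    (g := fun p : ℝ × ℝ => Real.cos (t * p.1)) (c := 1)
    (Continuous.aestronglyMeasurable (by fun_prop))
    (Filter.Eventually.of_forall fun x => Real.abs_cos_le_one _)
  simp only [ContinuousLinearMap.mul_apply'] at h1
  have e1 : ∀ r, SL2Kernel.boxAverage f r * Real.cos (t * r)
      = ∫ s, (Set.Ioc (-1 : ℝ) 1).indicator (fun _ => (1 : ℝ)) s * f (r - s) * Real.cos (t * r) := by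
    intro r
    rw [integral_mul_const, boxAverage_eq, intervalIntegral.integral_of_le (by norm_num),
      ← integral_indicator measurableSet_Ioc]
    congr 2
    ext s
    by_cases hs : s ∈ Set.Ioc (-1 : ℝ) 1 <;> simp [hs]
  rw [cosTransform]
  simp only [e1]
  rw [integral_integral_swap h1, intervalIntegral.integral_of_le (by norm_num),
    ← integral_indicator measurableSet_Ioc, ← integral_mul_const]
  congr 1
  ext s
  simp only [mul_assoc]
  rw [integral_const_mul]
  have e2 : ∫ r, f (r - s) * Real.cos (t * r) = Real.cos (t * s) * cosTransform f t := by
    have := integral_sub_right_eq_self (μ := volume) (fun r => f r * Real.cos (t * (r + s))) s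
    simp only [sub_add_cancel] at this
    rw [this]
    have e3 : ∀ r, f r * Real.cos (t * (r + s)) = Real.cos (t * s) * (f r * Real.cos (t * r))
        - Real.sin (t * s) * (f r * Real.sin (t * r)) := by
      intro r
      rw [mul_add, Real.cos_add]
      ring
    simp only [e3]
    rw [integral_sub ((integrable_mul_cos h.integrable t).const_mul _)
      ((integrable_mul_sin h.integrable t).const_mul _), integral_const_mul, integral_const_mul,
      h.integral_mul_sin, mul_zero, sub_zero, cosTransform]
  rw [e2]
  by_cases hs : s ∈ Set.Ioc (-1 : ℝ) 1 <;> simp [hs]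

/-- Iterated box averages of the indicator function of `[-1, 1]`. -/
noncomputable def bSpline : ℕ → ℝ → ℝ
  | 0 => (Set.Icc (-1) 1).indicator fun _ => 1
  | k + 1 => boxAverage (bSpline k)

theorem isSymmDecreasing_bSpline (k : ℕ) : IsSymmDecreasing (bSpline k) (k + 1) := by
  induction k with
  | zero =>
    refine ⟨fun x y hxy => ?_, fun x hx => ?_, ?_⟩
    · simp only [bSpline]
      by_cases hy : y ∈ Set.Icc (-1 : ℝ) 1
      · have hx : x ∈ Set.Icc (-1 : ℝ) 1 := by
          rw [Set.mem_Icc, ← abs_le] at hy ⊢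
          exact hxy.trans hy
        simp [Set.indicator_of_mem hx, Set.indicator_of_mem hy]
      · rw [Set.indicator_of_notMem hy]
        exact Set.indicator_nonneg (fun _ _ => zero_le_one) _
    · refine Set.indicator_of_notMem ?_ _
      rw [Set.mem_Icc, ← abs_le]
      simpa using hx
    · exact (integrable_indicator_iff measurableSet_Icc).2 (integrable_const _)
  | succ k ih =>
    have := ih.boxAverage
    push_cast
    exact this

theorem contDiff_bSpline (k : ℕ) : ContDiff ℝ k (bSpline (k + 1)) := by
  induction k with
  | zero =>
    rw [Nat.cast_zero, contDiff_zero]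
    exact continuous_boxAverage (isSymmDecreasing_bSpline 0).integrable
  | succ k ih => exact contDiff_boxAverage ih

theorem cosTransform_bSpline (k : ℕ) (t : ℝ) :
    cosTransform (bSpline k) t = (∫ s in (-1 : ℝ)..1, Real.cos (t * s)) ^ (k + 1) := by
  induction k with
  | zero =>
    rw [zero_add, pow_one, intervalIntegral.integral_of_le (by norm_num), ← integral_Icc_eq_integral_Ioc,
      ← integral_indicator measurableSet_Icc, cosTransform]
    congr 1
    ext s
    by_cases hs : s ∈ Set.Icc (-1 : ℝ) 1 <;> simp [bSpline, hs]
  | succ k ih => rw [bSpline, (isSymmDecreasing_bSpline k).cosTransform_boxAverage, ih, pow_succ' _ (k + 1)]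

/-- The superposition `∫₀¹ a^N f (r / a) da`. -/
noncomputable def scaleAverage (N : ℕ) (f : ℝ → ℝ) (r : ℝ) : ℝ :=
  ∫ a in Set.Ioc (0 : ℝ) 1, a ^ N * f (r / a)

theorem measurable_scaleIntegrand (N : ℕ) (hf : Continuous f) :
    Measurable fun p : ℝ × ℝ => p.2 ^ N * f (p.1 / p.2) :=
  (measurable_snd.pow_const N).mul (hf.measurable.comp (measurable_fst.div measurable_snd))

theorem norm_scaleIntegrand_le (N : ℕ) {C : ℝ} (hC : ∀ x, ‖f x‖ ≤ C) (r : ℝ) {a : ℝ}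
    (ha : a ∈ Set.Ioc (0 : ℝ) 1) : ‖a ^ N * f (r / a)‖ ≤ C := by
  rw [norm_mul, norm_pow, Real.norm_of_nonneg ha.1.le]
  exact (mul_le_of_le_one_left (norm_nonneg _) (pow_le_one₀ ha.1.le ha.2)).trans (hC _)

theorem integrableOn_scaleIntegrand (N : ℕ) (hf : Continuous f) {C : ℝ} (hC : ∀ x, ‖f x‖ ≤ C)
    (r : ℝ) : IntegrableOn (fun a => a ^ N * f (r / a)) (Set.Ioc 0 1) := by
  refine Measure.integrableOn_of_bounded (M := C) (by simp)
    ((measurable_scaleIntegrand N hf).comp measurable_prodMk_left).aestronglyMeasurable ?_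
  exact (ae_restrict_mem measurableSet_Ioc).mono fun a ha => norm_scaleIntegrand_le N hC r ha

theorem continuous_scaleAverage (N : ℕ) (hf : Continuous f) {C : ℝ} (hC : ∀ x, ‖f x‖ ≤ C) :
    Continuous (scaleAverage N f) := by
  refine continuous_of_dominated (bound := fun _ => C)
    (fun r => (integrableOn_scaleIntegrand N hf hC r).aestronglyMeasurable) (fun r => ?_)
    (integrable_const _) ?_
  · exact (ae_restrict_mem measurableSet_Ioc).mono fun a ha => norm_scaleIntegrand_le N hC r ha
  · exact Filter.Eventually.of_forall fun a => by fun_prop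

/-- Each derivative of f(r/a) costs a factor 1/a, which the weight a^N absorbs; hence N bounds the
available smoothness. -/
theorem hasDerivAt_scaleAverage (N : ℕ) (hf : ContDiff ℝ 1 f) {C C' : ℝ} (hC : ∀ x, ‖f x‖ ≤ C)
    (hC' : ∀ x, ‖deriv f x‖ ≤ C') (r : ℝ) :
    HasDerivAt (scaleAverage (N + 1) f) (scaleAverage N (deriv f) r) r := by
  have hd := hf.continuous_deriv le_rfl
  refine (hasDerivAt_integral_of_dominated_loc_of_deriv_le (bound := fun _ => C')
    (F := fun r a => a ^ (N + 1) * f (r / a)) (F' := fun r a => a ^ N * deriv f (r / a))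
    (Filter.univ_mem) ?_ (integrableOn_scaleIntegrand _ hf.continuous hC r)
    (integrableOn_scaleIntegrand _ hd hC' r).aestronglyMeasurable ?_ (integrable_const _) ?_).2
  · exact Filter.Eventually.of_forall fun r =>
      (integrableOn_scaleIntegrand _ hf.continuous hC r).aestronglyMeasurable
  · exact (ae_restrict_mem measurableSet_Ioc).mono fun a ha x _ => norm_scaleIntegrand_le N hC' x ha
  · refine (ae_restrict_mem measurableSet_Ioc).mono fun a ha x _ => ?_
    have h1 := (hf.differentiable one_ne_zero (x / a)).hasDerivAt.comp x
      ((hasDerivAt_id x).div_const a)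
    refine (h1.const_mul (a ^ (N + 1))).congr_deriv ?_
    have := ha.1.ne'
    field_simp
    ring

theorem contDiff_scaleAverage (k : ℕ) : ∀ {f : ℝ → ℝ} {N : ℕ}, ContDiff ℝ k f → HasCompactSupport f →
    k ≤ N → ContDiff ℝ k (scaleAverage N f) := by
  induction k with
  | zero =>
    intro f N hf hs _
    rw [Nat.cast_zero, contDiff_zero] at hf ⊢
    obtain ⟨C, hC⟩ := hs.exists_bound_of_continuous hf
    exact continuous_scaleAverage N hf hC
  | succ k ih =>
    intro f N hf hs hN
    obtain ⟨N, rfl⟩ : ∃ n, N = n + 1 := ⟨N - 1, by omega⟩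
    obtain ⟨C, hC⟩ := hs.exists_bound_of_continuous hf.continuous
    have hf1 : ContDiff ℝ 1 f := hf.of_le (by exact_mod_cast (by omega : 1 ≤ k + 1))
    obtain ⟨C', hC'⟩ := hs.deriv.exists_bound_of_continuous (hf1.continuous_deriv le_rfl)
    rw [Nat.cast_succ, contDiff_succ_iff_deriv] at hf ⊢
    have hd := hasDerivAt_scaleAverage N hf1 hC hC'
    refine ⟨fun r => (hd r).differentiableAt, by simp, ?_⟩
    rw [funext fun r => (hd r).deriv]
    exact ih hf.2.2 hs.deriv (by omega)

theorem IsSymmDecreasing.norm_le (h : IsSymmDecreasing f R) (x : ℝ) : ‖f x‖ ≤ f 0 := by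
  rw [Real.norm_of_nonneg (h.nonneg x)]
  exact h.le_zero x

theorem IsSymmDecreasing.scaleIntegrand_eq_zero (h : IsSymmDecreasing f R) (N : ℕ) {x a : ℝ}
    (hx : R < |x|) (ha : a ∈ Set.Ioc (0 : ℝ) 1) : a ^ N * f (x / a) = 0 := by
  rw [h.support, mul_zero]
  rw [abs_div, abs_of_pos ha.1, lt_div_iff₀ ha.1]
  rcases le_or_gt R 0 with hR | hR
  · nlinarith [ha.1, ha.2, abs_nonneg x, mul_nonpos_of_nonpos_of_nonneg hR ha.1.le]
  · nlinarith [ha.1, ha.2]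

theorem IsSymmDecreasing.scaleAverage (h : IsSymmDecreasing f R) (hf : Continuous f) (N : ℕ) :
    IsSymmDecreasing (scaleAverage N f) R := by
  have hsupp : ∀ x, R < |x| → SL2Kernel.scaleAverage N f x = 0 := fun x hx =>
    (setIntegral_congr_fun measurableSet_Ioc fun a ha => h.scaleIntegrand_eq_zero N hx ha).trans
      (by simp)
  refine ⟨fun x y hxy => ?_, hsupp, ?_⟩
  · refine setIntegral_mono_on (integrableOn_scaleIntegrand N hf h.norm_le y)
      (integrableOn_scaleIntegrand N hf h.norm_le x) measurableSet_Ioc fun a ha => ?_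
    refine mul_le_mul_of_nonneg_left (h.anti _ _ ?_) (pow_nonneg ha.1.le _)
    rw [abs_div, abs_div]
    gcongr
  · refine (continuous_scaleAverage N hf h.norm_le).integrable_of_hasCompactSupport
      (HasCompactSupport.intro (isCompact_Icc : IsCompact (Set.Icc (-R) R)) fun x hx => hsupp x ?_)
    rw [Set.mem_Icc, ← abs_le, not_le] at hx
    exact hx

theorem cosTransform_comp_div (f : ℝ → ℝ) (t : ℝ) {a : ℝ} (ha : 0 < a) :
    ∫ x, f (x / a) * Real.cos (t * x) = a * cosTransform f (t * a) := by
  have := Measure.integral_comp_div (fun x => f x * Real.cos (t * a * x)) a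
  rw [abs_of_pos ha, smul_eq_mul] at this
  rw [cosTransform, ← this]
  congr 1
  ext x
  congr 2
  field_simp

theorem IsSymmDecreasing.cosTransform_scaleAverage (h : IsSymmDecreasing f R) (hf : Continuous f)
    (N : ℕ) (t : ℝ) : cosTransform (SL2Kernel.scaleAverage N f) t
      = ∫ a in Set.Ioc (0 : ℝ) 1, a ^ (N + 1) * cosTransform f (t * a) := by
  have hint : Integrable (fun p : ℝ × ℝ => p.2 ^ N * f (p.1 / p.2) * Real.cos (t * p.1))
      (volume.prod (volume.restrict (Set.Ioc 0 1))) := by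
    have hm : Measurable fun p : ℝ × ℝ => p.2 ^ N * f (p.1 / p.2) * Real.cos (t * p.1) :=
      (measurable_scaleIntegrand N hf).mul (by fun_prop)
    have hI : IntegrableOn (fun p : ℝ × ℝ => p.2 ^ N * f (p.1 / p.2) * Real.cos (t * p.1))
        (Set.Icc (-R) R ×ˢ Set.Ioc 0 1) (volume.prod volume) := by
      refine Measure.integrableOn_of_bounded (M := f 0) ?_ hm.aestronglyMeasurable ?_
      · rw [Measure.prod_prod]
        exact ENNReal.mul_ne_top (by simp) (by simp)
      · refine (ae_restrict_mem (measurableSet_Icc.prod measurableSet_Ioc)).mono fun p hp => ?_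
        rw [norm_mul]
        exact (mul_le_of_le_one_right (norm_nonneg _) (Real.abs_cos_le_one _)).trans
          (norm_scaleIntegrand_le N h.norm_le _ hp.2)
    have h2 : IntegrableOn (fun p : ℝ × ℝ => p.2 ^ N * f (p.1 / p.2) * Real.cos (t * p.1))
        (Set.univ ×ˢ Set.Ioc 0 1) (volume.prod volume) := by
      refine hI.of_forall_sdiff_eq_zero (MeasurableSet.univ.prod measurableSet_Ioc) ?_
      rintro ⟨x, a⟩ ⟨⟨_, ha⟩, hx⟩
      dsimp only
      rw [h.scaleIntegrand_eq_zero N _ ha, zero_mul]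
      by_contra hx'
      exact hx ⟨abs_le.1 (not_lt.1 hx'), ha⟩
    rwa [IntegrableOn, ← Measure.prod_restrict, Measure.restrict_univ] at h2
  rw [cosTransform]
  simp only [SL2Kernel.scaleAverage, ← integral_mul_const]
  rw [integral_integral_swap hint]
  refine setIntegral_congr_fun measurableSet_Ioc fun a ha => ?_
  simp only [mul_assoc, integral_const_mul]
  rw [cosTransform_comp_div f t ha.1]
  ring

theorem two_cos_one_le {τ : ℝ} (hτ : |τ| ≤ 1) : 2 * Real.cos 1 ≤ ∫ s in (-1 : ℝ)..1, Real.cos (τ * s) := by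
  have h : ∫ _ in (-1 : ℝ)..1, Real.cos 1 = 2 * Real.cos 1 := by
    rw [intervalIntegral.integral_const, smul_eq_mul]
    ring
  rw [← h]
  refine intervalIntegral.integral_mono_on (by norm_num) intervalIntegrable_const
    (Continuous.intervalIntegrable (by fun_prop) _ _) fun s hs => ?_
  rw [← Real.cos_abs (τ * s)]
  refine Real.cos_le_cos_of_nonneg_of_le_pi (abs_nonneg _) (by linarith [Real.pi_gt_three]) ?_
  rw [abs_mul]
  exact mul_le_one₀ hτ (abs_nonneg _) (abs_le.2 hs)

/-- The transform is an integral of a⁷σ(ta)⁸, nonnegative because the power is even, with σ(τ) the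
integral of cos(τs) over [-1, 1]. The dilations a ≤ 1/(1+|t|) keep |ta| ≤ 1, where σ ≥ 2 cos 1, and
already contribute the stated bound. -/
theorem le_cosTransform_scaleAverage_bSpline (t : ℝ) :
    (2 * Real.cos 1) ^ 8 / 8 * (1 / (1 + |t|)) ^ 8
      ≤ cosTransform (scaleAverage 6 (bSpline 7)) t := by
  rw [(isSymmDecreasing_bSpline 7).cosTransform_scaleAverage (contDiff_bSpline 6).continuous]
  simp only [cosTransform_bSpline]
  set A := 1 / (1 + |t|) with hA
  have hA0 : 0 < A := by positivity
  have hA1 : A ≤ 1 := by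
    rw [hA, div_le_one (by positivity)]
    linarith [abs_nonneg t]
  have hσ : Continuous fun τ : ℝ => ∫ s in (-1 : ℝ)..1, Real.cos (τ * s) :=
    continuousOn_univ.1 (continuousOn_integral_param (F := fun p => Real.cos (p.1 * p.2)) isOpen_univ
      (-1) 1 (Continuous.continuousOn (by fun_prop)))
  have hc : Continuous fun a : ℝ => a ^ (6 + 1) * (∫ s in (-1 : ℝ)..1, Real.cos (t * a * s)) ^ (7 + 1) :=
    (continuous_id.pow 7).mul ((hσ.comp (continuous_const.mul continuous_id)).pow 8)
  have hi : ∀ a b, IntervalIntegrable (fun a : ℝ => a ^ (6 + 1)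
      * (∫ s in (-1 : ℝ)..1, Real.cos (t * a * s)) ^ (7 + 1)) volume a b := fun a b =>
    hc.intervalIntegrable a b
  rw [← intervalIntegral.integral_of_le zero_le_one,
    ← intervalIntegral.integral_add_adjacent_intervals (hi 0 A) (hi A 1)]
  have h1 : 0 ≤ ∫ a in A..1, a ^ (6 + 1) * (∫ s in (-1 : ℝ)..1, Real.cos (t * a * s)) ^ (7 + 1) := by
    refine intervalIntegral.integral_nonneg hA1 fun a ha => ?_
    exact mul_nonneg (pow_nonneg (hA0.le.trans ha.1) _) (Even.pow_nonneg (by decide) _)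
  have h2 : ∫ a in (0 : ℝ)..A, a ^ 7 * (2 * Real.cos 1) ^ 8
      ≤ ∫ a in (0 : ℝ)..A, a ^ (6 + 1) * (∫ s in (-1 : ℝ)..1, Real.cos (t * a * s)) ^ (7 + 1) := by
    refine intervalIntegral.integral_mono_on hA0.le (Continuous.intervalIntegrable (by fun_prop) _ _)
      (hi _ _) fun a ha => ?_
    refine mul_le_mul_of_nonneg_left (pow_le_pow_left₀ (by linarith [Real.cos_one_pos]) (two_cos_one_le ?_) 8)
      (pow_nonneg ha.1 _)
    rw [abs_mul, abs_of_nonneg ha.1]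
    have : a * (1 + |t|) ≤ 1 := by
      have := ha.2
      rwa [hA, le_div_iff₀ (by positivity)] at this
    nlinarith [ha.1]
  rw [intervalIntegral.integral_mul_const, integral_pow] at h2
  norm_num at h2 h1 ⊢
  linarith

theorem exists_test_function : ∃ (g : ℝ → ℝ) (R M c r₁ : ℝ), 0 ≤ R ∧ 0 ≤ M ∧ 0 < c ∧ 0 < r₁ ∧
    ContDiff ℝ 6 g ∧ IsSymmDecreasing g R ∧ (∀ r, 0 ≤ r → deriv g r ≤ 0) ∧
    (∀ r, 0 ≤ r → -(M * r) ≤ deriv g r) ∧ deriv g r₁ < 0 ∧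
    ∀ t, c * (1 / (1 + |t|)) ^ 8 ≤ cosTransform g t := by
  set g := scaleAverage 6 (bSpline 7)
  have hb := isSymmDecreasing_bSpline 7
  have hg : IsSymmDecreasing g ((7 : ℕ) + 1) := hb.scaleAverage (contDiff_bSpline 6).continuous 6
  have hg6 : ContDiff ℝ 6 g := contDiff_scaleAverage 6 (contDiff_bSpline 6) hb.hasCompactSupport le_rfl
  have hdiff : Differentiable ℝ g := hg6.differentiable (by norm_num)
  have hg1 : ContDiff ℝ 1 (deriv g) := by
    have := hg6.of_le (show (1 + 1 : ℕ∞ω) ≤ 6 by norm_num)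
    rw [contDiff_succ_iff_deriv] at this
    exact this.2.2
  obtain ⟨M, hM⟩ := hg.hasCompactSupport.deriv.deriv.exists_bound_of_continuous
    (hg1.continuous_deriv le_rfl)
  have hM0 : 0 ≤ M := (norm_nonneg _).trans (hM 0)
  have d0 : deriv g 0 = 0 := by
    have := deriv_even_neg hg.even 0
    rw [neg_zero] at this
    linarith
  have hanti : AntitoneOn g (Set.Ici 0) := fun x hx y hy hxy =>
    hg.anti x y (by rwa [abs_of_nonneg hx, abs_of_nonneg hy])
  have hneg : ∀ r, 0 ≤ r → deriv g r ≤ 0 := by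
    intro r hr
    rcases hr.eq_or_lt with rfl | hr
    · exact d0.le
    · rw [← derivWithin_of_mem_nhds (Ici_mem_nhds hr)]
      exact hanti.derivWithin_nonpos
  have hpos : 0 < cosTransform g 0 := lt_of_lt_of_le
    (by have := Real.cos_one_pos; positivity) (le_cosTransform_scaleAverage_bSpline 0)
  -- Otherwise g would be both increasing and decreasing on r ≥ 0 and vanish beyond its support
  -- radius 8, so g = 0, against positivity of its transform at 0.
  obtain ⟨r₁, hr₁, hr₁'⟩ : ∃ r₁, 0 < r₁ ∧ deriv g r₁ < 0 := by
    by_contra! h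
    have hmono : MonotoneOn g (Set.Ici 0) := by
      refine monotoneOn_of_deriv_nonneg (convex_Ici 0) hdiff.continuous.continuousOn
        hdiff.differentiableOn fun x hx => ?_
      rw [interior_Ici] at hx
      exact h x hx
    have h0 : g 0 ≤ 0 :=
      (hmono Set.self_mem_Ici (show (9 : ℝ) ∈ Set.Ici 0 by norm_num) (by norm_num)).trans_eq
        (hg.support 9 (by norm_num))
    have hz : ∀ x, g x = 0 := fun x => le_antisymm ((hg.le_zero x).trans h0) (hg.nonneg x)
    simp [cosTransform, hz] at hpos
  refine ⟨g, (7 : ℕ) + 1, M, (2 * Real.cos 1) ^ 8 / 8, r₁, by positivity, hM0, ?_, hr₁, hg6, hg, hneg, ?_, hr₁',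
    le_cosTransform_scaleAverage_bSpline⟩
  · have := Real.cos_one_pos
    positivity
  · intro r hr
    -- M bounds g'', and g'(0) = 0 by evenness, so |g'(r)| ≤ Mr.
    have := convex_univ.norm_image_sub_le_of_norm_deriv_le (f := deriv g) (C := M) (x := 0) (y := r)
      (fun x _ => hg1.differentiable one_ne_zero x) (fun x _ => hM x) trivial trivial
    rw [d0, sub_zero, sub_zero, Real.norm_of_nonneg hr] at this
    linarith [neg_abs_le (deriv g r), Real.norm_eq_abs (deriv g r)]

end

/-! ### Size, sign and smoothness of the inverse Abel transform -/

section

/-- In exponential form the weight dependence of the inverse Abel kernel is explicit: growth at most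
exponential in |n| times the support radius, and n ↦ -n amounts to s ↦ -s. -/
theorem sqrt_sub_div_sqrt {u : ℝ} (hu : -1 < u) (s : ℝ) :
    (√(1 + u + s ^ 2) - s) / √(1 + u) = Real.exp (-Real.arsinh (s / √(1 + u))) := by
  have h0 : 0 < 1 + u := by linarith
  have h1 : 0 < √(1 + u) := Real.sqrt_pos.2 h0
  have h2 : √(1 + u + s ^ 2) = √(1 + u) * √(1 + (s / √(1 + u)) ^ 2) := by
    rw [← Real.sqrt_mul h0.le, div_pow, Real.sq_sqrt h0.le]
    congr 1
    field_simp
  rw [← Real.arsinh_neg, Real.exp_arsinh, neg_sq, h2]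
  field_simp
  ring

theorem abelInv_eq_exp (n : ℤ) (p : ℝ → ℝ) {u : ℝ} (hu : -1 < u) : abelInv n p u
    = Real.pi⁻¹ * ∫ s : ℝ, p (u + s ^ 2) * Real.exp (-(n * Real.arsinh (s / √(1 + u)))) := by
  have h : ∀ x : ℝ, Real.exp (-x) ^ n = Real.exp (-(n * x)) := fun x => by
    rw [← Real.rpow_intCast, ← Real.exp_mul]
    ring_nf
  simp only [abelInv, sqrt_sub_div_sqrt hu, h]

theorem abelInv_neg (n : ℤ) (p : ℝ → ℝ) {u : ℝ} (hu : -1 < u) : abelInv (-n) p u = abelInv n p u := by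
  rw [abelInv_eq_exp _ _ hu, abelInv_eq_exp _ _ hu, ← integral_neg_eq_self]
  congr 2
  ext s
  rw [neg_sq, neg_div, Real.arsinh_neg]
  push_cast
  ring_nf

variable {p : ℝ → ℝ} {S : ℝ}

theorem abelInv_eq_intervalIntegral {T : ℝ} (hT : 0 ≤ T) (hp : ∀ u, S ^ 2 < u → p u = 0) (n : ℤ) {u : ℝ}
    (hu : -1 < u) (hST : S ^ 2 ≤ u + T ^ 2) : abelInv n p u = Real.pi⁻¹ * ∫ s in (-T)..T,
      p (u + s ^ 2) * Real.exp (-(n * Real.arsinh (s / √(1 + u)))) := by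
  rw [abelInv_eq_exp _ _ hu, intervalIntegral.integral_of_le (by linarith),
    ← integral_Icc_eq_integral_Ioc, setIntegral_eq_integral_of_forall_compl_eq_zero]
  intro s hs
  rw [Set.mem_Icc, ← abs_le, not_le] at hs
  have : T ^ 2 < s ^ 2 := by
    rw [← sq_abs s]
    exact pow_lt_pow_left₀ hs hT two_ne_zero
  rw [hp _ (by linarith), zero_mul]

/-- Working on the open set u > -1, where 1 + u stays positive, avoids one-sided derivatives at u =
0. -/
theorem contDiffOn_abelInv (hp : ContDiff ℝ 2 p) (hps : ∀ u, S ^ 2 < u → p u = 0) (n : ℤ) :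
    ContDiffOn ℝ 2 (abelInv n p) (Set.Ioi (-1)) := by
  have h1 : ContDiffOn ℝ (2 : ℕ) (fun u => ∫ s in (-(|S| + 1))..(|S| + 1), p (u + s ^ 2)
      * Real.exp (-(n * Real.arsinh (s / √(1 + u))))) (Set.Ioi (-1)) := by
    refine contDiffOn_integral_param isOpen_Ioi _ _ 2 (F := fun x => p (x.1 + x.2 ^ 2)
      * Real.exp (-(n * Real.arsinh (x.2 / √(1 + x.1))))) ?_
    have h2 : ContDiffOn ℝ 2 (fun x : ℝ × ℝ => √(1 + x.1)) (Set.Ioi (-1) ×ˢ Set.univ) :=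
      ContDiffOn.sqrt (by fun_prop) fun x hx => by
        have : (-1 : ℝ) < x.1 := hx.1
        linarith
    have h3 : ContDiffOn ℝ 2 (fun x : ℝ × ℝ => x.2 / √(1 + x.1)) (Set.Ioi (-1) ×ˢ Set.univ) :=
      contDiffOn_snd.div h2 fun x hx => by
        have : (-1 : ℝ) < x.1 := hx.1
        exact (Real.sqrt_pos.2 (by linarith)).ne'
    have h4 : ContDiffOn ℝ 2 (fun x : ℝ × ℝ => p (x.1 + x.2 ^ 2)) (Set.Ioi (-1) ×ˢ Set.univ) :=
      (hp.comp (by fun_prop : ContDiff ℝ 2 fun x : ℝ × ℝ => x.1 + x.2 ^ 2)).contDiffOn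
    exact h4.mul (contDiffOn_const.mul (Real.contDiff_arsinh.comp_contDiffOn h3)).neg.exp
  refine ((contDiffOn_const (c := Real.pi⁻¹)).mul h1).congr fun u hu => ?_
  have hu' : (-1 : ℝ) < u := hu
  refine abelInv_eq_intervalIntegral (by positivity) hps n hu ?_
  nlinarith [abs_nonneg S, sq_abs S]

theorem abelInv_nonneg (hp0 : ∀ u, 0 ≤ u → 0 ≤ p u) (n : ℤ) {u : ℝ} (hu : 0 ≤ u) :
    0 ≤ abelInv n p u := by
  rw [abelInv_eq_exp _ _ (by linarith)]
  exact mul_nonneg (by positivity) (integral_nonneg fun s =>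
    mul_nonneg (hp0 _ (by positivity)) (Real.exp_pos _).le)

theorem abelInv_eq_zero (hp : ∀ u, S ^ 2 < u → p u = 0) (n : ℤ) {u : ℝ} (hu : S ^ 2 < u) :
    abelInv n p u = 0 := by
  have : ∀ s : ℝ, p (u + s ^ 2) = 0 := fun s => hp _ (by nlinarith [sq_nonneg s])
  simp [abelInv, this]

theorem abs_arsinh_le (x : ℝ) : |Real.arsinh x| ≤ |x| := by
  have h : ∀ y, 0 ≤ y → Real.arsinh y ≤ y := fun y hy => by
    have h1 := Real.self_le_sinh_iff.2 (Real.arsinh_nonneg_iff.2 hy)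
    rwa [Real.sinh_arsinh] at h1
  rcases le_total 0 x with hx | hx
  · rw [abs_of_nonneg hx, abs_of_nonneg (Real.arsinh_nonneg_iff.2 hx)]
    exact h x hx
  · rw [abs_of_nonpos hx, abs_of_nonpos (Real.arsinh_nonpos_iff.2 hx), ← Real.arsinh_neg]
    exact h _ (by linarith)

/-- For u ≥ 0 only |s| ≤ S contributes, and there |arsinh(s/√(1+u))| ≤ S. The exponential is
harmless exactly when |n|S stays bounded, which dictates the scale used in weight n. -/
theorem abelInv_le (hS : 0 ≤ S) {C : ℝ} (hc : Continuous p) (hp : ∀ u, S ^ 2 < u → p u = 0)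
    (hpC : ∀ u, 0 ≤ u → p u ≤ C) (hC : 0 ≤ C) (n : ℤ) {u : ℝ} (hu : 0 ≤ u) :
    abelInv n p u ≤ 2 * S * C * Real.exp (|n| * S) := by
  rw [abelInv_eq_intervalIntegral hS hp n (by linarith) (by linarith)]
  have hu1 : 1 ≤ √(1 + u) := Real.one_le_sqrt.2 (by linarith)
  have hden : √(1 + u) ≠ 0 := by positivity
  have h1 : ∫ s in (-S)..S, p (u + s ^ 2) * Real.exp (-(n * Real.arsinh (s / √(1 + u))))
      ≤ ∫ _ in (-S)..S, C * Real.exp (|n| * S) := by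
    have := Real.continuous_arsinh
    refine intervalIntegral.integral_mono_on (by linarith) (Continuous.intervalIntegrable (by fun_prop) _ _)
      intervalIntegrable_const fun s hs => ?_
    refine mul_le_mul (hpC _ (by positivity)) (Real.exp_le_exp.2 ?_) (Real.exp_pos _).le hC
    have h2 : |Real.arsinh (s / √(1 + u))| ≤ S := by
      refine (abs_arsinh_le _).trans ?_
      rw [abs_div, abs_of_pos (by positivity : 0 < √(1 + u))]
      exact (div_le_self (abs_nonneg _) hu1).trans (abs_le.2 hs)
    refine (neg_le_abs _).trans ?_
    rw [abs_mul, Int.cast_abs]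
    exact mul_le_mul_of_nonneg_left h2 (abs_nonneg _)
  rw [intervalIntegral.integral_const, smul_eq_mul] at h1
  have hpi : Real.pi⁻¹ ≤ 1 := inv_le_one_of_one_le₀ (by linarith [Real.pi_gt_three])
  have h3 : 0 ≤ (S - -S) * (C * Real.exp (|n| * S)) := by
    have : 0 ≤ S - -S := by linarith
    positivity
  calc _ ≤ Real.pi⁻¹ * ((S - -S) * (C * Real.exp (|n| * S))) :=
        mul_le_mul_of_nonneg_left h1 (by positivity)
    _ ≤ 1 * ((S - -S) * (C * Real.exp (|n| * S))) := mul_le_mul_of_nonneg_right hpi h3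
    _ = _ := by ring

theorem abelInv_zero_pos (hc : Continuous p) (hp : ∀ u, S ^ 2 < u → p u = 0)
    (hp0 : ∀ u, 0 ≤ u → 0 ≤ p u) {w : ℝ} (hw : 0 < p w) {u : ℝ} (hu : 0 ≤ u) (huw : u ≤ w) :
    0 < abelInv 0 p u := by
  rw [abelInv_eq_exp _ _ (by linarith)]
  refine mul_pos (by positivity) ?_
  simp only [Int.cast_zero, zero_mul, neg_zero, Real.exp_zero, mul_one]
  -- At s = √(w - u) the argument u + s² equals w, where p is positive.
  refine Continuous.integral_pos_of_hasCompactSupport_nonneg_nonzero (x := √(w - u)) (by fun_prop)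
    (HasCompactSupport.intro (isCompact_Icc : IsCompact (Set.Icc (-|S|) |S|)) fun s hs => hp _ ?_)
    (fun s => hp0 _ (by positivity)) ?_
  · rw [Set.mem_Icc, ← abs_le, not_le] at hs
    nlinarith [sq_lt_sq.2 hs]
  · rw [Real.sq_sqrt (by linarith), add_sub_cancel]
    exact hw.ne'

/-- Induction with the addition formula and cosh ≥ 1. It converts a support radius of order 1/|n| in
r into a bound for |n| times the radius in the variable s. -/
theorem nat_mul_sinh_le (n : ℕ) {y : ℝ} (hy : 0 ≤ y) : n * Real.sinh y ≤ Real.sinh (n * y) := by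
  induction n with
  | zero => simp
  | succ n ih =>
    push_cast
    rw [add_mul, one_mul, add_mul, one_mul, Real.sinh_add]
    have h1 : 0 ≤ Real.sinh (n * y) := Real.sinh_nonneg_iff.2 (by positivity)
    have h2 : 0 ≤ Real.sinh y := Real.sinh_nonneg_iff.2 hy
    nlinarith [Real.one_le_cosh y, Real.one_le_cosh (n * y)]

variable {g : ℝ → ℝ} {R M c : ℝ}

theorem IsSymmDecreasing.comp_mul (h : IsSymmDecreasing g R) {a : ℝ} (ha : 0 < a) :
    IsSymmDecreasing (fun r => g (a * r)) (R / a) := by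
  refine ⟨fun x y hxy => h.anti _ _ ?_, fun x hx => h.support _ ?_, h.integrable.comp_mul_left' ha.ne'⟩
  · rw [abs_mul, abs_mul]
    gcongr
  · rw [abs_mul, abs_of_pos ha]
    rw [div_lt_iff₀ ha] at hx
    linarith

/-- The condition 0 < a sits inside the existential so that a choice yields p and q as functions of
a alone. -/
theorem exists_scaled_abel_density (hg : ContDiff ℝ 6 g) (h : IsSymmDecreasing g R)
    (hd : ∀ r, 0 ≤ r → deriv g r ≤ 0) (hM : ∀ r, 0 ≤ r → -(M * r) ≤ deriv g r) (a : ℝ) :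
    ∃ p q : ℝ → ℝ, 0 < a → ContDiff ℝ 2 p ∧ (∀ w, HasDerivAt q (-p w) w) ∧
      (∀ r, q (Real.sinh (r / 2) ^ 2) = g (a * r)) ∧
      (∀ w, Real.sinh (R / a / 2) ^ 2 < w → p w = 0) ∧ (∀ w, Real.sinh (R / a / 2) ^ 2 < w → q w = 0) ∧
      (∀ w, 0 ≤ w → 0 ≤ p w ∧ p w ≤ 2 * (a ^ 2 * M)) ∧
      (∀ r, p (Real.sinh (r / 2) ^ 2) * Real.sinh r = -(2 * (a * deriv g (a * r)))) := by
  by_cases ha : 0 < a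
  · have hder : ∀ r, deriv (fun r => g (a * r)) r = a * deriv g (a * r) := fun r => by
      simpa using deriv_comp_mul_left a g r
    obtain ⟨p, q, hpq⟩ := exists_abel_density (g := fun r => g (a * r)) (M := a ^ 2 * M)
      (hg.comp (contDiff_const.mul contDiff_id)) (h.comp_mul ha).even (h.comp_mul ha).support
      (fun r hr => by
        rw [hder]
        exact mul_nonpos_of_nonneg_of_nonpos ha.le (hd _ (by positivity)))
      (fun r hr => by
        rw [hder]
        nlinarith [hM (a * r) (by positivity)])
    simp only [hder] at hpq
    exact ⟨p, q, fun _ => hpq⟩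
  · exact ⟨0, 0, fun h => absurd h ha⟩

end

/-! ### Lower bounds for the transform, and the scales and coefficients in each weight -/

section

variable {g : ℝ → ℝ} {R M c : ℝ}

theorem cosTransform_comp_mul (g : ℝ → ℝ) (t : ℝ) {a : ℝ} (ha : 0 < a) :
    cosTransform (fun r => g (a * r)) t = a⁻¹ * cosTransform g (t / a) := by
  have := cosTransform_comp_div g t (inv_pos.2 ha)
  simp only [div_inv_eq_mul, mul_comm _ a] at this
  rw [cosTransform, this, div_eq_mul_inv]

theorem IsSymmDecreasing.integral_exp_of_real (h : IsSymmDecreasing g R) (t : ℝ) :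
    ∫ r : ℝ, Complex.exp (Complex.I * t * r) * (g r : ℂ) = (cosTransform g t : ℂ) := by
  have e : ∀ r : ℝ, Complex.exp (Complex.I * t * r) * (g r : ℂ)
      = ((g r * Real.cos (t * r) : ℝ) : ℂ) + ((g r * Real.sin (t * r) : ℝ) : ℂ) * Complex.I := by
    intro r
    rw [show Complex.I * t * r = ((t * r : ℝ) : ℂ) * Complex.I by push_cast; ring, Complex.exp_mul_I]
    push_cast
    ring
  simp only [e]
  rw [integral_add (integrable_mul_cos h.integrable t).ofReal
    ((integrable_mul_sin h.integrable t).ofReal.mul_const _), integral_mul_const,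
    integral_complex_ofReal, integral_complex_ofReal, h.integral_mul_sin, cosTransform]
  simp

/-- Since exp(sr) ≥ 1 + sr and g ≥ 0, the integral is at least that of (1 + sr)g, whose odd part
drops out. -/
theorem IsSymmDecreasing.le_integral_exp (h : IsSymmDecreasing g R) (hg : Continuous g) (s : ℝ) :
    cosTransform g 0 ≤ ∫ r : ℝ, Real.exp (s * r) * g r := by
  have hs := h.hasCompactSupport
  have h1 : ∫ r : ℝ, r * g r = 0 := by
    have h1 := integral_neg_eq_self (fun x => x * g x) volume
    simp only [h.even, neg_mul, integral_neg] at h1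
    linarith
  have h2 : cosTransform g 0 = ∫ r : ℝ, (s * (r * g r) + g r) := by
    have h3 : Integrable fun r => r * g r :=
      Continuous.integrable_of_hasCompactSupport (by fun_prop) hs.mul_left
    rw [integral_add (h3.const_mul s) h.integrable, integral_const_mul, h1, mul_zero, zero_add]
    simp [cosTransform]
  rw [h2]
  refine integral_mono (Continuous.integrable_of_hasCompactSupport (by fun_prop) ?_)
    (Continuous.integrable_of_hasCompactSupport (by fun_prop) hs.mul_left) fun r => ?_
  · exact ((hs.mul_left (f := fun r => r)).mul_left (f := fun _ => s)).add hs
  · have := Real.add_one_le_exp (s * r)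
    nlinarith [h.nonneg r]

/-- For real t this is the cosine transform at t/a; for imaginary t the integrand is real and the
value at t = 0 is a lower bound. -/
theorem IsSymmDecreasing.le_integral_exp_mul (h : IsSymmDecreasing g R) (hg : Continuous g)
    (hc : 0 ≤ c) (hcos : ∀ t, c * (1 / (1 + |t|)) ^ 8 ≤ cosTransform g t) {a : ℝ} (ha : 1 ≤ a) {t : ℂ}
    (ht : t.im = 0 ∨ t.re = 0) :
    (∫ r : ℝ, Complex.exp (Complex.I * t * r) * (g (a * r) : ℂ)).im = 0 ∧
      c / a * (1 / (1 + ‖t‖)) ^ 8 ≤ (∫ r : ℝ, Complex.exp (Complex.I * t * r) * (g (a * r) : ℂ)).re := by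
  have ha0 : 0 < a := by linarith
  have hga := h.comp_mul ha0
  have key : ∀ x : ℝ, |x| ≤ ‖t‖ → c / a * (1 / (1 + ‖t‖)) ^ 8
      ≤ cosTransform (fun r => g (a * r)) x := by
    intro x hx
    rw [cosTransform_comp_mul g x ha0]
    calc c / a * (1 / (1 + ‖t‖)) ^ 8 = a⁻¹ * (c * (1 / (1 + ‖t‖)) ^ 8) := by ring
      _ ≤ a⁻¹ * (c * (1 / (1 + |x / a|)) ^ 8) := by
          have : |x / a| ≤ ‖t‖ := by
            rw [abs_div, abs_of_pos ha0]
            exact (div_le_self (abs_nonneg _) ha).trans hx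
          gcongr
      _ ≤ _ := by
          gcongr
          exact hcos _
  rcases ht with ht | ht
  · have e : t = (t.re : ℂ) := Complex.ext rfl (by simpa using ht)
    have e2 := hga.integral_exp_of_real t.re
    rw [← e] at e2
    rw [e2]
    exact ⟨Complex.ofReal_im _, key _ (Complex.abs_re_le_norm t)⟩
  · have e : ∀ r : ℝ, Complex.exp (Complex.I * t * r) * (g (a * r) : ℂ)
        = ((Real.exp (-t.im * r) * g (a * r) : ℝ) : ℂ) := by
      intro r
      have : Complex.I * t = ((-t.im : ℝ) : ℂ) := Complex.ext (by simp) (by simp [ht])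
      rw [this]
      push_cast
      rfl
    simp only [e]
    rw [integral_complex_ofReal]
    exact ⟨Complex.ofReal_im _, (key 0 (by simp)).trans
      (hga.le_integral_exp (by fun_prop) _)⟩

theorem abel_const_mul (m : ℤ) (a : ℝ) (ψ : ℝ → ℝ) (w : ℝ) :
    abel m (fun u => a * ψ u) w = a * abel m ψ w := by
  rw [abel, abel, ← integral_const_mul]
  congr 1
  ext v
  push_cast
  ring

theorem abel_congr {m : ℤ} {ψ χ : ℝ → ℝ} (h : ∀ u, 0 ≤ u → ψ u = χ u) {w : ℝ} (hw : 0 ≤ w) :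
    abel m ψ w = abel m χ w := by
  rw [abel, abel]
  congr 1
  ext v
  rw [h _ (by positivity)]

/-- The scale used in weight `n`. -/
noncomputable def weightScale (κ : ℝ) (n : ℤ) : ℝ := if n = 0 then 1 else κ * |(n : ℝ)|

/-- The coefficient used in weight `n`. -/
noncomputable def weightCoeff (η : ℝ) (n : ℤ) : ℝ := if n = 0 then 1 else η / (n : ℝ) ^ 4

/-- The family of point-pair invariants with Abel densities `p`. -/
noncomputable def abelFamily (p : ℝ → ℝ → ℝ) (κ η : ℝ) (n : ℤ) : ℝ → ℝ :=
  if Odd n then 0 else fun u => weightCoeff η n * abelInv n (p (weightScale κ n)) (max u 0)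

theorem one_le_abs_cast {n : ℤ} (hn : n ≠ 0) : (1 : ℝ) ≤ |(n : ℝ)| := by
  exact_mod_cast Int.one_le_abs hn

theorem one_le_weightScale {κ : ℝ} (hκ : 1 ≤ κ) (n : ℤ) : 1 ≤ weightScale κ n := by
  rw [weightScale]
  split_ifs with h
  · rfl
  · nlinarith [one_le_abs_cast h]

theorem weightScale_neg (κ : ℝ) (n : ℤ) : weightScale κ (-n) = weightScale κ n := by
  simp [weightScale]

theorem weightCoeff_neg (η : ℝ) (n : ℤ) : weightCoeff η (-n) = weightCoeff η n := by
  simp [weightCoeff, Even.neg_pow (by decide : Even 4)]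

theorem weightCoeff_nonneg {η : ℝ} (hη : 0 ≤ η) (n : ℤ) : 0 ≤ weightCoeff η n := by
  rw [weightCoeff]
  split_ifs
  · exact zero_le_one
  · exact div_nonneg hη (Even.pow_nonneg (by decide) _)

/-- The exponent 5 comes from n⁴ in the coefficient and one factor |n| from the dilation. -/
theorem le_weightCoeff_div {κ η : ℝ} (hκ : 1 ≤ κ) (hη0 : 0 < η) (hη : η ≤ 1) (n : ℤ) :
    η / κ * (1 / (1 + |(n : ℝ)|)) ^ 5 ≤ weightCoeff η n / weightScale κ n := by
  have hκ0 : 0 < κ := by linarith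
  rw [weightCoeff, weightScale]
  split_ifs with h
  · subst h
    simp only [Int.cast_zero, abs_zero, add_zero, div_one, one_pow, mul_one]
    rw [div_le_one hκ0]
    linarith
  · have h1 := one_le_abs_cast h
    have h4 : (n : ℝ) ^ 4 = |(n : ℝ)| ^ 4 := (Even.pow_abs (by decide) _).symm
    rw [h4]
    calc η / κ * (1 / (1 + |(n : ℝ)|)) ^ 5 ≤ η / κ * (1 / |(n : ℝ)|) ^ 5 := by
          gcongr
          linarith
      _ = _ := by
          field_simp

theorem abelFamily_neg (p : ℝ → ℝ → ℝ) (κ η : ℝ) (n : ℤ) : abelFamily p κ η (-n) = abelFamily p κ η n := by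
  have h : ∀ u : ℝ, (-1 : ℝ) < max u 0 := fun u => by linarith [le_max_right u 0]
  ext u
  simp only [abelFamily, odd_neg, weightCoeff_neg, weightScale_neg]
  split_ifs
  · rfl
  · simp only [abelInv_neg _ _ (h u)]

/-- The choice κ = 1 + R/r₁ gives R/κ ≤ r₁; the bound then controls both the exponential in
`abelInv_le` and, as |n| ≥ 1, the support radius. -/
theorem abs_sinh_scale_le {κ r₁ : ℝ} (hR : 0 ≤ R) (hr : 0 < r₁) (hκ : κ = 1 + R / r₁) {n : ℤ} (hn : n ≠ 0) :
    |(n : ℝ)| * Real.sinh (R / weightScale κ n / 2) ≤ Real.sinh (r₁ / 2) := by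
  have hκ0 : 0 < κ := by
    rw [hκ]
    positivity
  have h1 := one_le_abs_cast hn
  have h2 := nat_mul_sinh_le n.natAbs (y := R / weightScale κ n / 2) (by
    rw [weightScale, if_neg hn]
    positivity)
  have h3 : ((n.natAbs : ℕ) : ℝ) = |(n : ℝ)| := by
    rw [Nat.cast_natAbs, Int.cast_abs]
  rw [h3] at h2
  refine h2.trans (Real.sinh_le_sinh.2 ?_)
  rw [weightScale, if_neg hn]
  have e : |(n : ℝ)| * (R / (κ * |(n : ℝ)|) / 2) = R / κ / 2 := by
    field_simp
  rw [e]
  have : R / κ ≤ r₁ := by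
    rw [div_le_iff₀ hκ0, hκ]
    field_simp
    linarith
  linarith

end

/-! ### The family of radial functions -/

/-- Dilation by κ|n| confines nonzero weights to the region where weight zero is bounded below, the
factor n⁻⁴ beats the resulting n² growth, and η fixes the relative size. Only a polynomial factor is
lost in the transform. -/
theorem exists_point_pair_family : ∃ (Φ : ℤ → ℝ → ℝ) (δ B d : ℝ), 0 ≤ δ ∧ 0 < d ∧ IsTestFamily Φ δ B ∧
    (∀ n, ContDiffOn ℝ 2 (Φ n) (Set.Ici 0)) ∧ (∀ n, Odd n → Φ n = 0) ∧ (∀ n, Φ (-n) = Φ n) ∧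
    (∀ u, 0 ≤ u → ∑' n : {n : ℤ // n ≠ 0}, |Φ n u| ≤ Φ 0 u) ∧
    ∀ (m : ℤ) (t : ℂ), t.im = 0 ∨ t.re = 0 →
      (∫ r : ℝ, Complex.exp (Complex.I * t * r) * abel m (Φ (2 * m)) (Real.sinh (r / 2) ^ 2)).im = 0 ∧
      d * (1 / (1 + ‖t‖ + |((2 * m : ℤ) : ℝ)|)) ^ 13
        ≤ (∫ r : ℝ, Complex.exp (Complex.I * t * r) * abel m (Φ (2 * m)) (Real.sinh (r / 2) ^ 2)).re := by
  obtain ⟨g, R, M, c, r₁, hR, hM, hc, hr₁, hg6, hg, hd, hdM, hr₁', hcos⟩ := exists_test_function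
  choose p q hpq using exists_scaled_abel_density hg6 hg hd hdM
  set κ := 1 + R / r₁ with hκ
  have hκ1 : 1 ≤ κ := by
    have : 0 ≤ R / r₁ := by positivity
    linarith
  set lam := weightScale κ with hlam
  have hlam1 : ∀ n, 1 ≤ lam n := one_le_weightScale hκ1
  have hlam0 : ∀ n, 0 < lam n := fun n => by linarith [hlam1 n]
  set S : ℤ → ℝ := fun n => Real.sinh (R / lam n / 2) with hS
  have hS0 : ∀ n, 0 ≤ S n := fun n => Real.sinh_nonneg_iff.2 (by have := hlam0 n; positivity)
  set S₁ := Real.sinh (r₁ / 2) with hS1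
  have hS10 : 0 ≤ S₁ := Real.sinh_nonneg_iff.2 (by positivity)
  have hnS : ∀ n : ℤ, n ≠ 0 → |(n : ℝ)| * S n ≤ S₁ := fun n hn => abs_sinh_scale_le hR hr₁ hκ hn
  have hSS : ∀ n : ℤ, n ≠ 0 → S n ≤ S₁ := fun n hn => by
    nlinarith [hnS n hn, one_le_abs_cast hn, hS0 n]
  have pc : ∀ n, ContDiff ℝ 2 (p (lam n)) := fun n => (hpq _ (hlam0 n)).1
  have ps : ∀ n u, S n ^ 2 < u → p (lam n) u = 0 := fun n => (hpq _ (hlam0 n)).2.2.2.1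
  have qs : ∀ n u, S n ^ 2 < u → q (lam n) u = 0 := fun n => (hpq _ (hlam0 n)).2.2.2.2.1
  have pb : ∀ n u, 0 ≤ u → 0 ≤ p (lam n) u ∧ p (lam n) u ≤ 2 * (lam n ^ 2 * M) :=
    fun n => (hpq _ (hlam0 n)).2.2.2.2.2.1
  -- Clamping the argument at 0 makes the function continuous, hence measurable, on all of ℝ without
  -- changing it for u ≥ 0.
  set A : ℤ → ℝ → ℝ := fun n u => abelInv n (p (lam n)) (max u 0) with hA
  have hA0 : ∀ n u, 0 ≤ A n u := fun n u =>
    abelInv_nonneg (fun u hu => (pb n u hu).1) n (le_max_right u 0)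
  have hAc : ∀ n, ContDiffOn ℝ 2 (A n) (Set.Ici 0) := fun n =>
    ((contDiffOn_abelInv (pc n) (ps n) n).mono fun u hu => by
      have : (0 : ℝ) ≤ u := hu
      exact lt_of_lt_of_le (by norm_num) this).congr fun u hu => by
        simp only [hA, max_eq_left (show (0 : ℝ) ≤ u from hu)]
  have hAcont : ∀ n, Continuous (A n) := fun n => by
    have h1 := (hAc n).continuousOn.comp_continuous (f := fun u : ℝ => max u 0) (by fun_prop)
      fun u => le_max_right u 0
    simpa [hA, Function.comp_def] using h1
  have hAs : ∀ n u, S n ^ 2 < u → A n u = 0 := fun n u hu =>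
    abelInv_eq_zero (ps n) n (lt_of_lt_of_le hu (le_max_left u 0))
  have hAle : ∀ n u, A n u ≤ 2 * S n * (2 * (lam n ^ 2 * M)) * Real.exp (|n| * S n) := fun n u =>
    abelInv_le (hS0 n) (pc n).continuous (ps n) (fun u hu => (pb n u hu).2) (by positivity) n
      (le_max_right u 0)
  -- The n² in the bound below comes from the second derivative of g(κ|n|r); support length and
  -- exponential are bounded uniformly in n.
  set D := 2 * S₁ * (2 * (κ ^ 2 * M)) * Real.exp S₁ with hD
  have hD0 : 0 ≤ D := by positivity
  have hAD : ∀ n : ℤ, n ≠ 0 → ∀ u, A n u ≤ D * (n : ℝ) ^ 2 := by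
    intro n hn u
    refine (hAle n u).trans ?_
    have e : lam n ^ 2 = κ ^ 2 * (n : ℝ) ^ 2 := by
      rw [hlam, weightScale, if_neg hn, mul_pow, sq_abs]
    rw [e, Int.cast_abs]
    calc 2 * S n * (2 * (κ ^ 2 * (n : ℝ) ^ 2 * M)) * Real.exp (|(n : ℝ)| * S n)
        ≤ 2 * S₁ * (2 * (κ ^ 2 * (n : ℝ) ^ 2 * M)) * Real.exp S₁ := by
          gcongr
          · exact hSS n hn
          · exact hnS n hn
      _ = D * (n : ℝ) ^ 2 := by
          rw [hD]
          ring
  -- Since g'(r₁) < 0, the density in weight zero is positive at S₁² = sinh²(r₁/2), hence its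
  -- inverse Abel transform is positive on all of [0, S₁²].
  have hpos : ∀ u ∈ Set.Icc (0 : ℝ) (S₁ ^ 2), 0 < A 0 u := by
    intro u hu
    have hl : lam 0 = 1 := by simp [hlam, weightScale]
    have hw : 0 < p (lam 0) (S₁ ^ 2) := by
      have h1 := (hpq _ (hlam0 0)).2.2.2.2.2.2 r₁
      rw [hl, one_mul, one_mul] at h1
      have h2 : 0 < Real.sinh r₁ := Real.sinh_pos_iff.2 hr₁
      rw [hl]
      by_contra h
      have : p 1 (Real.sinh (r₁ / 2) ^ 2) * Real.sinh r₁ ≤ 0 :=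
        mul_nonpos_of_nonpos_of_nonneg (not_lt.1 h) h2.le
      linarith
    have := abelInv_zero_pos (pc 0).continuous (ps 0) (fun u hu => (pb 0 u hu).1) hw hu.1 hu.2
    simpa only [hA, max_eq_left hu.1] using this
  obtain ⟨u₀, hu₀, hmin⟩ := isCompact_Icc.exists_isMinOn
    (Set.nonempty_Icc.2 (sq_nonneg S₁)) (hAcont 0).continuousOn
  set ε := A 0 u₀ with hε
  have hε0 : 0 < ε := hpos u₀ hu₀
  have hsum : Summable fun n : ℤ => 1 / (n : ℝ) ^ 2 := Real.summable_one_div_int_pow.2 one_lt_two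
  set Z := ∑' n : ℤ, 1 / (n : ℝ) ^ 2 with hZ
  have hZ0 : 0 ≤ Z := tsum_nonneg fun n => by positivity
  -- Chosen so that the total ηDZ of the nonzero weights is at most the minimum ε of weight zero;
  -- the summand ε in the denominator also gives η ≤ 1.
  set η := ε / (D * Z + 1 + ε) with hη
  have hη0 : 0 < η := by positivity
  have hη1 : η ≤ 1 := by
    rw [hη, div_le_one (by positivity)]
    nlinarith [mul_nonneg hD0 hZ0]
  have hηε : η * D * Z ≤ ε := by
    rw [hη, div_mul_eq_mul_div, div_mul_eq_mul_div, div_le_iff₀ (by positivity)]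
    nlinarith [mul_nonneg hD0 hZ0]
  set Φ := abelFamily p κ η with hΦ
  have hΦodd : ∀ n, Odd n → Φ n = 0 := fun n hn => by rw [hΦ, abelFamily, if_pos hn]
  have hΦev : ∀ n, ¬ Odd n → Φ n = fun u => weightCoeff η n * A n u := fun n hn => by
    rw [hΦ, abelFamily, if_neg hn]
  have hΦ0 : Φ 0 = A 0 := by
    rw [hΦev 0 (by decide)]
    simp [weightCoeff]
  have hΦle : ∀ n : ℤ, n ≠ 0 → ∀ u, |Φ n u| ≤ η * D * (1 / (n : ℝ) ^ 2) := by
    intro n hn u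
    by_cases ho : Odd n
    · rw [hΦodd n ho, Pi.zero_apply, abs_zero]
      positivity
    · have hn' : (n : ℝ) ≠ 0 := by exact_mod_cast hn
      rw [hΦev n ho, abs_of_nonneg (mul_nonneg (weightCoeff_nonneg hη0.le n) (hA0 n u)), weightCoeff,
        if_neg hn]
      calc η / (n : ℝ) ^ 4 * A n u ≤ η / (n : ℝ) ^ 4 * (D * (n : ℝ) ^ 2) :=
            mul_le_mul_of_nonneg_left (hAD n hn u) (div_nonneg hη0.le (Even.pow_nonneg (by decide) _))
        _ = _ := by field_simp
  have hΦs : ∀ n : ℤ, n ≠ 0 → ∀ u, S₁ ^ 2 < u → Φ n u = 0 := by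
    intro n hn u hu
    by_cases ho : Odd n
    · rw [hΦodd n ho, Pi.zero_apply]
    · rw [hΦev n ho]
      simp only
      rw [hAs n u (lt_of_le_of_lt (pow_le_pow_left₀ (hS0 n) (hSS n hn) 2) hu), mul_zero]
  have hΦcont : ∀ n, Continuous (Φ n) := fun n => by
    by_cases ho : Odd n
    · rw [hΦodd n ho]
      exact continuous_const
    · rw [hΦev n ho]
      exact continuous_const.mul (hAcont n)
  set B₀ := 2 * S 0 * (2 * (lam 0 ^ 2 * M)) with hB₀
  have hsum1 : Summable fun n : ℤ => η * D * (1 / (n : ℝ) ^ 2) := hsum.mul_left _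
  have hsum2 : Summable fun n : ℤ => if n = 0 then B₀ else 0 := (hasSum_ite_eq 0 B₀).summable
  have hΦb : ∀ u n, |Φ n u| ≤ η * D * (1 / (n : ℝ) ^ 2) + if n = 0 then B₀ else 0 := by
    intro u n
    split_ifs with hn
    · subst hn
      rw [hΦ0, abs_of_nonneg (hA0 0 u)]
      simpa using hAle 0 u
    · rw [add_zero]
      exact hΦle n hn u
  have hΦsum : ∀ u, Summable fun n => |Φ n u| := fun u =>
    (hsum1.add hsum2).of_nonneg_of_le (fun n => abs_nonneg _) (hΦb u)
  -- The supports of the nonzero weights lie below S₁² and that of weight zero below S(0)², so the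
  -- sum covers both.
  set δ := S₁ ^ 2 + S 0 ^ 2 with hδ
  have hδ0 : 0 ≤ δ := by positivity
  have hsupp : ∀ n u, δ < u → Φ n u = 0 := by
    intro n u hu
    by_cases hn : n = 0
    · subst hn
      rw [hΦ0, hAs 0 u (by nlinarith [sq_nonneg S₁])]
    · exact hΦs n hn u (by nlinarith [sq_nonneg (S 0)])
  refine ⟨Φ, δ, _, c * (η / κ), hδ0, by positivity,
    ⟨fun n => (hΦcont n).measurable, hsupp, fun u _ => hΦsum u,
      fun u _ => (hΦsum u).tsum_le_tsum (hΦb u) (hsum1.add hsum2)⟩, fun n => ?_, hΦodd,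
    abelFamily_neg p κ η, fun u hu => ?_, fun m t ht => ?_⟩
  · by_cases ho : Odd n
    · rw [hΦodd n ho]
      exact contDiffOn_const
    · rw [hΦev n ho]
      exact contDiffOn_const.mul (hAc n)
  · rw [hΦ0]
    by_cases huS : u ≤ S₁ ^ 2
    · calc ∑' n : {n : ℤ // n ≠ 0}, |Φ n u| ≤ ∑' n : {n : ℤ // n ≠ 0}, η * D * (1 / (n : ℝ) ^ 2) :=
            ((hΦsum u).subtype _).tsum_le_tsum (fun n => hΦle n n.2 u) (hsum1.subtype _)
        _ ≤ ∑' n : ℤ, η * D * (1 / (n : ℝ) ^ 2) :=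
            hsum1.tsum_subtype_le _ {n | n ≠ 0} fun n => by positivity
        _ = η * D * Z := tsum_mul_left
        _ ≤ ε := hηε
        _ ≤ A 0 u := hmin ⟨hu, huS⟩
    · have : ∀ n : {n : ℤ // n ≠ 0}, |Φ n u| = 0 := fun n => by
        rw [hΦs n n.2 u (not_le.1 huS), abs_zero]
      simp only [this, tsum_zero]
      exact hA0 0 u
  · set n := 2 * m with hn
    have hev : ¬ Odd n := by
      rw [Int.not_odd_iff_even]
      exact even_two_mul m
    -- Inversion returns the prescribed profile: the Abel transform is the scaled test function
    -- times the coefficient.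
    have e : ∀ r : ℝ, abel m (Φ n) (Real.sinh (r / 2) ^ 2) = weightCoeff η n * (g (lam n * r) : ℂ) := by
      intro r
      have hw : 0 ≤ Real.sinh (r / 2) ^ 2 := sq_nonneg _
      rw [hΦev n hev, abel_const_mul, abel_congr (χ := abelInv n (p (lam n))) (fun u hu => by
        simp only [hA, max_eq_left hu]) hw, hn, abel_abelInv (sq_nonneg (S (2 * m)))
        (pc (2 * m)).continuous (hpq _ (hlam0 (2 * m))).2.1 (ps (2 * m)) (qs (2 * m)) m hw,
        (hpq _ (hlam0 (2 * m))).2.2.1]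
    simp only [e]
    have e2 : ∀ r : ℝ, Complex.exp (Complex.I * t * r) * (weightCoeff η n * (g (lam n * r) : ℂ))
        = weightCoeff η n * (Complex.exp (Complex.I * t * r) * (g (lam n * r) : ℂ)) := fun r => by ring
    simp only [e2]
    rw [integral_const_mul, Complex.re_ofReal_mul, Complex.im_ofReal_mul]
    obtain ⟨h1, h2⟩ := hg.le_integral_exp_mul hg6.continuous hc.le hcos (hlam1 n) ht
    refine ⟨by rw [h1, mul_zero], ?_⟩
    -- The exponent 13 is 8 from the decay of the cosine transform plus 5 from `le_weightCoeff_div`.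
    calc c * (η / κ) * (1 / (1 + ‖t‖ + |(n : ℝ)|)) ^ 13
        = c * ((η / κ * (1 / (1 + ‖t‖ + |(n : ℝ)|)) ^ 5) * (1 / (1 + ‖t‖ + |(n : ℝ)|)) ^ 8) := by ring
      _ ≤ c * ((η / κ * (1 / (1 + |(n : ℝ)|)) ^ 5) * (1 / (1 + ‖t‖)) ^ 8) := by
          have i1 : 1 / (1 + ‖t‖ + |(n : ℝ)|) ≤ 1 / (1 + |(n : ℝ)|) :=
            one_div_le_one_div_of_le (by positivity) (by linarith [norm_nonneg t])
          have i2 : 1 / (1 + ‖t‖ + |(n : ℝ)|) ≤ 1 / (1 + ‖t‖) :=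
            one_div_le_one_div_of_le (by positivity) (by linarith [abs_nonneg (n : ℝ)])
          have i0 : 0 ≤ 1 / (1 + ‖t‖ + |(n : ℝ)|) := by positivity
          have j1 := pow_le_pow_left₀ i0 i1 5
          have j2 := pow_le_pow_left₀ i0 i2 8
          have : 0 ≤ η / κ := by positivity
          exact mul_le_mul_of_nonneg_left (mul_le_mul (mul_le_mul_of_nonneg_left j1 this) j2
            (by positivity) (by positivity)) hc.le
      _ ≤ c * ((weightCoeff η n / lam n) * (1 / (1 + ‖t‖)) ^ 8) := by
          gcongr
          exact le_weightCoeff_div hκ1 hη0 hη1 n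
      _ = weightCoeff η n * (c / lam n * (1 / (1 + ‖t‖)) ^ 8) := by ring
      _ ≤ _ := mul_le_mul_of_nonneg_left h2 (weightCoeff_nonneg hη0.le n)

theorem weightKernel_zero (φ : ℝ → ℝ) (g h : SL(2, ℝ)) :
    weightKernel 0 φ g h = (φ (uDist (proj g) (proj h)) : ℂ) := by
  simp [weightKernel, hFactor]

/-- Conjugation exchanges the terms n and -n when Φ is even in n, so it only permutes the series. -/
theorem kernel_im_eq_zero {Φ : ℤ → ℝ → ℝ} (hΦ : ∀ n, Φ (-n) = Φ n) (g h : SL(2, ℝ)) :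
    (kernel Φ g h).im = 0 := by
  rw [← Complex.conj_eq_iff_im, kernel, Complex.conj_tsum, ← (Equiv.neg ℤ).tsum_eq]
  congr 1
  ext n
  rw [Equiv.neg_apply, weightKernel_neg, hΦ, Complex.conj_conj]

end SL2Kernel

/-! ### The main theorem -/

open SL2Kernel

theorem theorem7p1 :
    ∃ ρ : ℂ → ℤ → ℂ,
      -- the function is supported on even `n`
      (∀ t n, Odd n → ρ t n = 0) ∧
      -- (1) it is real and positive at all spectral parameters
      (∀ (N : ℕ) (t : ℂ) (n : ℤ), 0 < N → SL2Kernel.IsSpectralPair N t n →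
        (ρ t n).im = 0 ∧ 0 < (ρ t n).re) ∧
      (∃ Φ : ℤ → ℝ → ℝ,
        -- (2) it is the transform of an even point-pair invariant
        SL2Kernel.IsEvenPointPairFamily Φ ∧
        SL2Kernel.HasAbsoluteConvergence Φ ∧
        SL2Kernel.IsSelbergTransform ρ (SL2Kernel.kernel Φ) ∧
        -- (3) that point-pair invariant is real valued
        (∀ g h, (SL2Kernel.kernel Φ g h).im = 0) ∧
        -- (4) its weight-zero part, which is real, dominates the other weights
        (∀ g h, (SL2Kernel.weightKernel 0 (Φ 0) g h).im = 0 ∧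
          ∑' n : {n : ℤ // n ≠ 0}, ‖SL2Kernel.weightKernel n (Φ n) g h‖
            ≤ (SL2Kernel.weightKernel 0 (Φ 0) g h).re)) ∧
      -- (5) its inverse is polynomially bounded at the spectral parameters, uniformly in `N`
      (∃ (C : ℝ) (A : ℕ), ∀ (N : ℕ) (t : ℂ) (n : ℤ), 0 < N → SL2Kernel.IsSpectralPair N t n →
        ‖(ρ t n)⁻¹‖ ≤ C * (1 + ‖t‖ + |(n : ℝ)|) ^ A) := by
  obtain ⟨Φ, δ, B, d, hδ, hd, hΦ, hC, hodd, hneg, hdom, hρ⟩ := exists_point_pair_family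
  have hlow : ∀ (N : ℕ) (t : ℂ) (n : ℤ), 0 < N → IsSpectralPair N t n →
      (∫ g, transformIntegrand (kernel Φ) t n g ∂haar).im = 0 ∧
      d * (1 / (1 + ‖t‖ + |(n : ℝ)|)) ^ 13 ≤ (∫ g, transformIntegrand (kernel Φ) t n g ∂haar).re := by
    intro N t n hN h
    obtain ⟨m, rfl⟩ := h.even.two_dvd
    obtain ⟨h1, h2⟩ := hρ m t (h.real_or_imaginary)
    rw [hΦ.integral_transform_even, integral_radial_eq_abel m hδ (hC _).continuousOn (hΦ.support _) t]
    set J := ∫ r : ℝ, Complex.exp (Complex.I * t * r) * abel m (Φ (2 * m)) (Real.sinh (r / 2) ^ 2)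
    -- One factor 2π comes from the θ-integration, the other 2 from the horocyclic substitution.
    have e : 2 * (Real.pi : ℂ) * (2 * J) = ((4 * Real.pi : ℝ) : ℂ) * J := by
      push_cast
      ring
    rw [e, Complex.re_ofReal_mul, Complex.im_ofReal_mul, h1, mul_zero]
    refine ⟨rfl, ?_⟩
    have h3 : 0 ≤ d * (1 / (1 + ‖t‖ + |((2 * m : ℤ) : ℝ)|)) ^ 13 := by positivity
    nlinarith [Real.pi_gt_three]
  have hpos : ∀ (t : ℂ) (n : ℤ), 0 < d * (1 / (1 + ‖t‖ + |(n : ℝ)|)) ^ 13 := fun t n => by positivity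
  refine ⟨fun t n => ∫ g, transformIntegrand (kernel Φ) t n g ∂haar, fun t n hn => ?_,
    fun N t n hN h => ⟨(hlow N t n hN h).1, (hpos t n).trans_le (hlow N t n hN h).2⟩,
    ⟨Φ, ⟨hC, hodd, hΦ.summable_norm⟩, hΦ.hasAbsoluteConvergence,
      fun t n => ⟨hΦ.integrable_transform t n, rfl⟩, kernel_im_eq_zero hneg, fun g h => ?_⟩,
    ⟨d⁻¹, 13, fun N t n hN h => ?_⟩⟩
  · simp only [hΦ.integral_transform, hodd n hn]
    simp [weightKernel]
  · simp only [weightKernel_zero, norm_weightKernel, Complex.ofReal_im, Complex.ofReal_re, true_and]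
    exact hdom _ (uDist_nonneg _ _)
  · obtain ⟨-, h2⟩ := hlow N t n hN h
    rw [norm_inv]
    -- A lower bound for the real part bounds the modulus below, so inverting gives the polynomial
    -- bound with the same exponent.
    have h3 := h2.trans ((le_abs_self _).trans (Complex.abs_re_le_norm _))
    refine (inv_anti₀ (hpos t n) h3).trans (le_of_eq ?_)
    rw [mul_inv, one_div, inv_pow, inv_inv]
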